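/- **Corollary 3.8 (Continuous dependency on the initial data).** Let $\alpha\in[0,1)$, $\gamma\in(0,1)$, $q>0$, $\bar\varrho>0$, $T>0$ and $\mathbb{R}_+=(0,\infty)$. Let $M$ be the set of nonnegative Borel measures $\nu$ on $\mathbb{R}_+$ with $\int\lambda\,\nu(d\lambda)=\bar\varrho$, and put $$E(\nu)=\frac{q}{1-\gamma}\int\lambda^{1-\gamma}\,\nu(d\lambda)\in[0,\infty],\qquad u(\nu)=\frac{q\int\lambda^{\alpha-\gamma}\,d\nu}{\int\lambda^{\alpha}\,d\nu}.$$ A curve $[0,T]\ni t\mapsto\nu_t\in M$, continuous with respect to weak* convergence in $C_c^0(\mathbb{R}_+)^*$, together with a measurable vector field $w$ is a *curve of finite action* if $\int\lambda^\alpha w_t\,d\nu_t=0$ (with $\lambda^\alpha w_t\in L^1(\nu_t)$) for a.e. $t\in[0,T]$, $\int_0^T\int\lambda^\alpha|w_t|^2\,d\nu_t\,dt<\infty$, and $\partial_t\nu_t+\partial_\lambda(\lambda^\alpha w_t\nu_t)=0$ weakly, that is $$\int_0^T\int\big(\partial_t\varphi+\lambda^\alpha w_t\,\partial_\lambda\varphi\big)\,d\nu_t\,dt=\int\varphi(T,\cdot)\,d\nu_T-\int\varphi(0,\cdot)\,d\nu_0\qquad\text{for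 all }\varphi\in C_c^\infty([0,T]\times\mathbb{R}_+).$$ A *solution of the LSW equation* $\partial_t\nu_t+\partial_\lambda\big(\lambda^\alpha(u(\nu_t)-q\lambda^{-\gamma})\nu_t\big)=0$ on $[0,T]$ is a curve $\nu$ in $M$ which is of finite action with a vector field $w$ such that, for a.e. $t\in[0,T]$, the moments $\int\lambda^\alpha d\nu_t$ and $\int\lambda^{\alpha-\gamma}d\nu_t$ are finite and $w_t(\lambda)=u(\nu_t)-q\lambda^{-\gamma}$ for $\nu_t$-a.e. $\lambda$. For every $\varepsilon>0$ let $\nu^\varepsilon$ be a solution of the LSW equation on $[0,T]$ with initial datum $\nu_0^\varepsilon$. Assume that the initial data are tight, $$\int_{(R,\infty)}\lambda\,\nu_0^\varepsilon(d\lambda)\to0\quad\text{as }R\to\infty,\text{ uniformly in }\varepsilon>0,$$ and that, for some nonnegative Borel measure $\nu_0$ on $\mathbb{R}_+$, as $\varepsilon\to0$, $$\nu_0^\varepsilon\overset{*}{\rightharpoonup}\nu_0\ \text{ in } C_c^0(\mathbb{R}_+)^*\qquad\text{and}\qquad E(\nu_0^\varepsilon)\to E(\nu_0)<\infty .$$ Then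 every sequence $\varepsilon_n\to0^+$ has a subsequence $(\varepsilon_{n_k})_k$ for which there is a solution $\nu$ of the LSW equation on $[0,T]$ with initial datum $\nu_0$ such that $\nu_t^{\varepsilon_{n_k}}\overset{*}{\rightharpoonup}\nu_t$ in $C_c^0(\mathbb{R}_+)^*$ for all $t\in[0,T]$. -/

import Mathlib

open MeasureTheory Filter Topology Set
open scoped ENNReal ContDiff

namespace LSW

/-- `ζ ∈ C_c^0(ℝ₊)` with `ℝ₊ = (0, ∞)`: continuous with compact support inside the open half-line
(extended by zero to `ℝ`). -/
def IsTestFun (ζ : ℝ → ℝ) : Prop :=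
  Continuous ζ ∧ HasCompactSupport ζ ∧ tsupport ζ ⊆ Ioi 0

/-- `φ ∈ C_c^∞([0, T] × ℝ₊)`, given as the restriction of a smooth function of `(t, x) ∈ ℝ × ℝ` whose
compact support lies in `ℝ × (0, ∞)`; there is no condition at `t = 0` and `t = T`. -/
def IsSpaceTimeTestFun (φ : ℝ × ℝ → ℝ) : Prop :=
  ContDiff ℝ ∞ φ ∧ HasCompactSupport φ ∧ tsupport φ ⊆ univ ×ˢ Ioi 0

/-- Weak* convergence `ν_i ⇀* ν` in `C_c^0(ℝ₊)^*` along the filter `l`. -/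
def WeakStarTendsto {ι : Type*} (ν : ι → Measure ℝ) (l : Filter ι) (ν' : Measure ℝ) : Prop :=
  ∀ ζ : ℝ → ℝ, IsTestFun ζ → Tendsto (fun i => ∫ x, ζ x ∂(ν i)) l (𝓝 (∫ x, ζ x ∂ν'))

/-- The state manifold `M`: nonnegative measures carried by `ℝ₊ = (0, ∞)` with `∫ x dν = ρ`
(such a measure is finite on compact subsets of `(0, ∞)`). -/
def IsState (ρ : ℝ) (ν : Measure ℝ) : Prop :=
  ν (Iic 0) = 0 ∧ ∫⁻ x, ENNReal.ofReal x ∂ν = ENNReal.ofReal ρ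

/-- The energy `E(ν) = q / (1 - γ) ∫ x^(1-γ) dν`, with values in `[0, ∞]`. -/
noncomputable def energy (γ q : ℝ) (ν : Measure ℝ) : ℝ≥0∞ :=
  ENNReal.ofReal (q / (1 - γ)) * ∫⁻ x, ENNReal.ofReal (x ^ (1 - γ)) ∂ν

/-- The mean field `u(ν) = q ∫ x^(α-γ) dν / ∫ x^α dν`. -/
noncomputable def meanField (α γ q : ℝ) (ν : Measure ℝ) : ℝ :=
  q * (∫ x, x ^ (α - γ) ∂ν) / ∫ x, x ^ α ∂ν

/-- The constraint `∫ x^α w dν = 0` on cotangent vectors `w ∈ T_ν^* M`. -/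
def IsCotangent (α : ℝ) (ν : Measure ℝ) (w : ℝ → ℝ) : Prop :=
  Integrable (fun x => x ^ α * w x) ν ∧ ∫ x, x ^ α * w x ∂ν = 0

/-- The action `A(ν, w) = ∫_0^T ∫ x^α |w_t|² dν_t dt`, with values in `[0, ∞]`. -/
noncomputable def action (α T : ℝ) (ν : ℝ → Measure ℝ) (w : ℝ → ℝ → ℝ) : ℝ≥0∞ :=
  ∫⁻ t in Icc 0 T, ∫⁻ x, ENNReal.ofReal (x ^ α * w t x ^ 2) ∂(ν t)

/-- The continuity equation `∂_t ν_t + ∂_x (x^α w_t ν_t) = 0` in `C_c^∞([0, T] × ℝ₊)^*`; as the test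
functions need not vanish at the end points, the boundary terms appear. -/
def ContinuityEq (α T : ℝ) (ν : ℝ → Measure ℝ) (w : ℝ → ℝ → ℝ) : Prop :=
  ∀ φ : ℝ × ℝ → ℝ, IsSpaceTimeTestFun φ →
    ∫ t in (0 : ℝ)..T, ∫ x, (fderiv ℝ φ (t, x) (1, 0)
        + fderiv ℝ φ (t, x) (0, 1) * (x ^ α * w t x)) ∂(ν t)
      = (∫ x, φ (T, x) ∂(ν T)) - ∫ x, φ (0, x) ∂(ν 0)

/-- A curve of finite action in `M` on `[0, T]` together with its vector field. -/
structure IsFiniteActionCurve (α ρ T : ℝ) (ν : ℝ → Measure ℝ) (w : ℝ → ℝ → ℝ) : Prop where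
  state : ∀ t ∈ Icc 0 T, IsState ρ (ν t)
  weakStar_continuous : ∀ t ∈ Icc 0 T, WeakStarTendsto ν (𝓝[Icc 0 T] t) (ν t)
  measurable : Measurable (Function.uncurry w)
  cotangent : ∀ᵐ t ∂(volume.restrict (Icc 0 T)), IsCotangent α (ν t) (w t)
  action_lt_top : action α T ν w < ⊤
  continuity_eq : ContinuityEq α T ν w

/-- Solutions on `[0, T]` of the LSW equation
`∂_t ν_t + ∂_x (x^α (u(ν_t) - q x^(-γ)) ν_t) = 0`: curves of finite action whose vector field is
`u(ν_t) - q x^(-γ)`, the moments which define `u(ν_t)` being finite for almost every `t`. -/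
def IsSolution (α γ q ρ T : ℝ) (ν : ℝ → Measure ℝ) : Prop :=
  ∃ w : ℝ → ℝ → ℝ, IsFiniteActionCurve α ρ T ν w ∧
    ∀ᵐ t ∂(volume.restrict (Icc 0 T)),
      Integrable (fun x : ℝ => x ^ α) (ν t) ∧ Integrable (fun x : ℝ => x ^ (α - γ)) (ν t) ∧
      ∀ᵐ x ∂(ν t), w t x = meanField α γ q (ν t) - q * x ^ (-γ)

/-- Tightness: `∫_{(R, ∞)} x dν^ε → 0` as `R → ∞`, uniformly in `ε > 0`. -/
def IsTight (ν : ℝ → Measure ℝ) : Prop :=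
  ∀ δ : ℝ, 0 < δ → ∃ R₀ : ℝ, ∀ R ≥ R₀, ∀ ε > 0,
    ∫⁻ x in Ioi R, ENNReal.ofReal x ∂(ν ε) ≤ ENNReal.ofReal δ

end LSW

/-! The proof is a compactness argument for a gradient flow. Call ∫ x dν the mass. Two properties of
the drift x^α (u - q x^(-γ)) drive everything: its integral vanishes, and it changes sign from - to
+ at the critical size (q / u)^(1/γ). For nondecreasing ψ the value of ψ at the critical size may
therefore be subtracted, which gives ∫ ψ x^α (u - q x^(-γ)) dν ≥ 0: moments of convex profiles grow
along solutions (`IsBalancedFlow.integral_mono`). The energy is a concave moment, so it decreases,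
and the total dissipation ∫∫ x^α (u - q x^(-γ))² dν dt is at most the initial energy
(`IsBalancedFlow.dissipation_le`).

Compactness: the dissipation controls the rate of change of moments. Tightness at infinity thus
propagates in time because α < 1, the energy controls the mass near zero, moments of test functions
are equicontinuous in time, and the mean fields are bounded in L²(0, T). Prokhorov's theorem for the
normalized mass distributions x ν_t / ρ yields a subsequence which converges at all times without
loss of mass (`IsTightFamily.exists_limit_curve`), while the mean fields converge weakly in L² to
some v.

Limit: weakly convergent mean fields multiply boundedly convergent moments, so the continuity
equation survives (`ConvergesTo.continuityEq`); the dissipation is convex in the mean field, hence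
lower semicontinuous (`ConvergesTo.hasFiniteDissipation`). It remains to see that v is the mean
field of the limit, that is, ∫ x^α (v - q x^(-γ)) dμ_t = 0. The constant density 1 is not admissible
near zero, so conservation of mass does not give this at once. But the convex moments √(x² + R²) - R
still grow along the limit curve. As R → 0 they tend to the mass, which equals ρ at all times, and
Fatou's lemma forces their nonnegative limiting rate of change to vanish
(`IsFlow.ae_integral_drift_eq_zero`). Convergence of the initial energies enters only as an upper
bound along the sequence. -/

namespace LSW

/-! ### States -/

theorem ae_pos_of_measure_Iic {ν : Measure ℝ} (h : ν (Iic 0) = 0) : ∀ᵐ x ∂ν, 0 < x := by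
  rw [ae_iff]
  convert h using 2
  ext x
  simp

namespace IsState

variable {ρ : ℝ} {ν : Measure ℝ}

theorem ae_pos (h : IsState ρ ν) : ∀ᵐ x ∂ν, 0 < x := ae_pos_of_measure_Iic h.1

theorem integrable_id (h : IsState ρ ν) : Integrable (fun x : ℝ => x) ν := by
  refine ⟨measurable_id.aestronglyMeasurable, ?_⟩
  rw [hasFiniteIntegral_iff_ofReal (h.ae_pos.mono fun x hx => hx.le), h.2]
  exact ENNReal.ofReal_lt_top

theorem integral_id (h : IsState ρ ν) (hρ : 0 ≤ ρ) : ∫ x, x ∂ν = ρ := by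
  rw [integral_eq_lintegral_of_nonneg_ae (h.ae_pos.mono fun x hx => hx.le)
    measurable_id.aestronglyMeasurable, h.2, ENNReal.toReal_ofReal hρ]

theorem integrable_of_abs_le (h : IsState ρ ν) {f : ℝ → ℝ} {C : ℝ} (hf : AEStronglyMeasurable f ν)
    (hC : ∀ x > 0, |f x| ≤ C * x) : Integrable f ν :=
  (h.integrable_id.const_mul C).mono' hf (h.ae_pos.mono fun x hx => hC x hx)

theorem abs_integral_le (h : IsState ρ ν) (hρ : 0 ≤ ρ) {f : ℝ → ℝ} {C : ℝ}
    (hC : ∀ x > 0, |f x| ≤ C * x) : |∫ x, f x ∂ν| ≤ C * ρ := by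
  have := norm_integral_le_of_norm_le (f := f) (h.integrable_id.const_mul C)
    (h.ae_pos.mono fun x hx => hC x hx)
  rwa [integral_const_mul, h.integral_id hρ] at this

theorem ne_zero (h : IsState ρ ν) (hρ : 0 < ρ) : ν ≠ 0 := by
  rintro rfl
  have := h.2
  simp only [lintegral_zero_measure] at this
  exact absurd this.symm (by simpa using hρ)

/-- A function which is continuous on `(0, ∞)` is measurable for every state. -/
theorem aestronglyMeasurable (h : IsState ρ ν) {f : ℝ → ℝ} (hf : ContinuousOn f (Ioi 0)) :
    AEStronglyMeasurable f ν := by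
  have h1 : ν = ν.restrict (Ioi 0) :=
    (Measure.restrict_eq_self_of_ae_mem (h.ae_pos.mono fun x hx => hx)).symm
  rw [h1]
  exact hf.aestronglyMeasurable measurableSet_Ioi

end IsState

/-! ### Test functions -/

theorem IsTestFun.exists_lower {ζ : ℝ → ℝ} (h : IsTestFun ζ) :
    ∃ a > 0, ∀ x, ζ x ≠ 0 → a ≤ x := by
  rcases (tsupport ζ).eq_empty_or_nonempty with he | hne
  · refine ⟨1, one_pos, fun x hx => ?_⟩
    have := subset_tsupport ζ hx
    simp [he] at this
  · obtain ⟨a, ha, hmin⟩ := h.2.1.isCompact.exists_isMinOn hne continuousOn_id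
    exact ⟨a, h.2.2 ha, fun x hx => hmin (subset_tsupport ζ hx)⟩

theorem IsTestFun.mul {ζ g : ℝ → ℝ} (h : IsTestFun ζ) (hg : ContinuousOn g (Ioi 0)) :
    IsTestFun (fun x => ζ x * g x) := by
  have hs : tsupport (fun x => ζ x * g x) ⊆ tsupport ζ := tsupport_mul_subset_left
  refine ⟨?_, h.2.1.mul_right, hs.trans h.2.2⟩
  exact (h.1.continuousOn.mul hg).continuous_of_tsupport_subset isOpen_Ioi (hs.trans h.2.2)

theorem IsTestFun.mul_rpow {ζ : ℝ → ℝ} (h : IsTestFun ζ) (s : ℝ) :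
    IsTestFun (fun x => ζ x * x ^ s) :=
  h.mul fun x hx => (Real.continuousAt_rpow_const x s (Or.inl (ne_of_gt hx))).continuousWithinAt

theorem continuousOn_rpow (s : ℝ) : ContinuousOn (fun x : ℝ => x ^ s) (Ioi 0) :=
  fun x hx => (Real.continuousAt_rpow_const x s (Or.inl (ne_of_gt hx))).continuousWithinAt

/-- The product ζ x^(-s) is again a test function, hence bounded. The case s = 1 compares with the
mass, s = 1 - γ with the energy. -/
theorem IsTestFun.exists_bound_rpow {ζ : ℝ → ℝ} (h : IsTestFun ζ) (s : ℝ) :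
    ∃ C ≥ 0, ∀ x > 0, |ζ x| ≤ C * x ^ s := by
  obtain ⟨C, hC⟩ := (h.mul_rpow (-s)).2.1.exists_bound_of_continuous (h.mul_rpow (-s)).1
  refine ⟨C, (norm_nonneg _).trans (hC 0), fun x hx => ?_⟩
  have h1 := hC x
  have h2 := Real.rpow_pos_of_pos hx s
  rw [Real.norm_eq_abs, abs_mul, Real.rpow_neg hx.le, abs_inv, abs_of_pos h2] at h1
  rwa [← div_eq_mul_inv, div_le_iff₀ h2] at h1

theorem IsTestFun.exists_bound {ζ : ℝ → ℝ} (h : IsTestFun ζ) :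
    ∃ C ≥ 0, ∀ x > 0, |ζ x| ≤ C * x := by
  simpa using h.exists_bound_rpow 1

theorem IsTestFun.integrable {ρ : ℝ} {ν : Measure ℝ} (hν : IsState ρ ν) {ζ : ℝ → ℝ}
    (h : IsTestFun ζ) : Integrable ζ ν := by
  obtain ⟨C, -, hC⟩ := h.exists_bound
  exact hν.integrable_of_abs_le h.1.aestronglyMeasurable hC

theorem IsTestFun.deriv {ζ : ℝ → ℝ} (h : IsTestFun ζ) (hs : ContDiff ℝ ∞ ζ) :
    IsTestFun (deriv ζ) :=
  ⟨hs.continuous_deriv (by simp), h.2.1.deriv, (tsupport_deriv_subset).trans h.2.2⟩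

/-- Smooth test functions are dense, in the norm `sup |ζ x| / x`. -/
theorem IsTestFun.exists_smooth_approx {ζ : ℝ → ℝ} (h : IsTestFun ζ) {ε : ℝ} (hε : 0 < ε) :
    ∃ g, IsTestFun g ∧ ContDiff ℝ ∞ g ∧ ∀ x > 0, |ζ x - g x| ≤ ε * x := by
  obtain ⟨a, ha, hlow⟩ := h.exists_lower
  -- The tolerance ε * a is at most ε * x wherever ζ does not vanish, and g vanishes wherever ζ
  -- does.
  obtain ⟨g, hg, hd, hsupp⟩ := h.1.exists_contDiff_approx (ε := fun _ => ε * a) ⊤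
    continuous_const (fun _ => by positivity)
  have hts : tsupport g ⊆ tsupport ζ := closure_mono hsupp
  refine ⟨g, ⟨hg.continuous, h.2.1.mono hsupp, hts.trans h.2.2⟩, hg, fun x hx => ?_⟩
  by_cases hz : ζ x = 0
  · have : g x = 0 := by
      by_contra hne
      exact hsupp hne hz
    rw [hz, this]
    simp
    positivity
  · have := hd x
    rw [Real.dist_eq, abs_sub_comm] at this
    exact this.le.trans (mul_le_mul_of_nonneg_left (hlow x hz) hε.le)

theorem IsState.abs_integral_sub_le {ρ ε : ℝ} {ν : Measure ℝ} (hν : IsState ρ ν) (hρ : 0 ≤ ρ)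
    {ζ g : ℝ → ℝ} (hζ : IsTestFun ζ) (hg : IsTestFun g) (h : ∀ x > 0, |ζ x - g x| ≤ ε * x) :
    |∫ x, ζ x ∂ν - ∫ x, g x ∂ν| ≤ ε * ρ := by
  rw [← integral_sub (hζ.integrable hν) (hg.integrable hν)]
  exact hν.abs_integral_le hρ h

/-! ### Smooth cutoff functions -/

/-- A smooth cutoff of `(0, ∞)`, supported in `[1 / (j + 1), 2 (j + 1)]`. -/
noncomputable def cutoff (j : ℕ) (x : ℝ) : ℝ :=
  Real.smoothTransition ((j + 1) * x - 1) * Real.smoothTransition (2 - x / (j + 1))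

theorem cutoff_contDiff (j : ℕ) : ContDiff ℝ ∞ (cutoff j) := by
  unfold cutoff
  exact (Real.smoothTransition.contDiff.comp (by fun_prop)).mul
    (Real.smoothTransition.contDiff.comp (by fun_prop))

theorem cutoff_nonneg (j : ℕ) (x : ℝ) : 0 ≤ cutoff j x :=
  mul_nonneg (Real.smoothTransition.nonneg _) (Real.smoothTransition.nonneg _)

theorem cutoff_le_one (j : ℕ) (x : ℝ) : cutoff j x ≤ 1 :=
  mul_le_one₀ (Real.smoothTransition.le_one _) (Real.smoothTransition.nonneg _)
    (Real.smoothTransition.le_one _)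

theorem cutoff_mono {x : ℝ} (hx : 0 < x) : Monotone fun j => cutoff j x := by
  intro i j hij
  have h : (i : ℝ) ≤ j := by exact_mod_cast hij
  have h0 : (0 : ℝ) ≤ i := by positivity
  refine mul_le_mul (Real.smoothTransition.monotone ?_) (Real.smoothTransition.monotone ?_)
    (Real.smoothTransition.nonneg _) (Real.smoothTransition.nonneg _)
  · gcongr
  · gcongr

theorem cutoff_eq_one {j : ℕ} {x : ℝ} (h1 : 2 ≤ (j + 1) * x) (h2 : x ≤ j + 1) :
    cutoff j x = 1 := by
  have h0 : (0 : ℝ) < j + 1 := by positivity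
  have : x / (j + 1) ≤ 1 := (div_le_one h0).2 h2
  rw [cutoff, Real.smoothTransition.one_of_one_le (by linarith),
    Real.smoothTransition.one_of_one_le (by linarith), one_mul]

theorem cutoff_ne_zero {j : ℕ} {x : ℝ} (h : cutoff j x ≠ 0) :
    1 / (j + 1) ≤ x ∧ x ≤ 2 * (j + 1) := by
  have h0 : (0 : ℝ) < j + 1 := by positivity
  constructor
  · by_contra! hlt
    rw [lt_div_iff₀ h0] at hlt
    apply h
    rw [cutoff, Real.smoothTransition.zero_of_nonpos (by linarith), zero_mul]
  · by_contra! hlt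
    rw [← lt_div_iff₀ h0] at hlt
    apply h
    rw [cutoff, Real.smoothTransition.zero_of_nonpos (x := 2 - x / (j + 1)) (by linarith), mul_zero]

theorem cutoff_isTestFun (j : ℕ) : IsTestFun (cutoff j) := by
  have h0 : (0 : ℝ) < 1 / (j + 1) := by positivity
  have hs : Function.support (cutoff j) ⊆ Icc (1 / (j + 1)) (2 * (j + 1)) :=
    fun x hx => cutoff_ne_zero hx
  refine ⟨(cutoff_contDiff j).continuous,
    HasCompactSupport.of_support_subset_isCompact isCompact_Icc hs, ?_⟩
  exact (closure_minimal hs isClosed_Icc).trans fun x hx => h0.trans_le hx.1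

theorem cutoff_eventually_eq_one {x : ℝ} (hx : 0 < x) :
    ∀ᶠ j in atTop, cutoff j =ᶠ[𝓝 x] fun _ => 1 := by
  have ht : Tendsto (fun j : ℕ => (j : ℝ) + 1) atTop atTop :=
    tendsto_atTop_add_const_right _ _ tendsto_natCast_atTop_atTop
  filter_upwards [ht.eventually_ge_atTop (4 / x), ht.eventually_ge_atTop (2 * x)] with j h1 h2
  filter_upwards [Ioo_mem_nhds (show x / 2 < x by linarith) (show x < 2 * x by linarith)] with y hy
  refine cutoff_eq_one ?_ (hy.2.le.trans h2)
  rw [div_le_iff₀ hx] at h1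
  have h0 : (0 : ℝ) < j + 1 := by positivity
  nlinarith [hy.1]

theorem cutoff_tendsto {x : ℝ} (hx : 0 < x) : Tendsto (fun j => cutoff j x) atTop (𝓝 1) :=
  tendsto_const_nhds.congr' <| (cutoff_eventually_eq_one hx).mono fun _ h => h.eq_of_nhds.symm

theorem deriv_cutoff_eventually {x : ℝ} (hx : 0 < x) :
    ∀ᶠ j in atTop, deriv (cutoff j) x = 0 :=
  (cutoff_eventually_eq_one hx).mono fun j h => by rw [h.deriv_eq]; simp

theorem deriv_smoothTransition_eq_zero {y : ℝ} (hy : y < 0 ∨ 1 < y) :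
    deriv Real.smoothTransition y = 0 := by
  rcases hy with hy | hy
  · have : Real.smoothTransition =ᶠ[𝓝 y] fun _ => 0 := by
      filter_upwards [Iio_mem_nhds hy] with z hz
      exact Real.smoothTransition.zero_of_nonpos (le_of_lt hz)
    rw [this.deriv_eq]; simp
  · have : Real.smoothTransition =ᶠ[𝓝 y] fun _ => 1 := by
      filter_upwards [Ioi_mem_nhds hy] with z hz
      exact Real.smoothTransition.one_of_one_le (le_of_lt hz)
    rw [this.deriv_eq]; simp

theorem exists_deriv_smoothTransition_bound :
    ∃ B ≥ 0, ∀ y, |deriv Real.smoothTransition y| ≤ B := by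
  have hc : Continuous (deriv Real.smoothTransition) :=
    (Real.smoothTransition.contDiff (n := ⊤)).continuous_deriv (by simp)
  obtain ⟨B, hB⟩ := isCompact_Icc.exists_bound_of_continuousOn
    (hc.continuousOn (s := Icc (0 : ℝ) 1))
  refine ⟨B, (norm_nonneg _).trans (hB 0 (by simp)), fun y => ?_⟩
  by_cases hy : y ∈ Icc (0 : ℝ) 1
  · exact hB y hy
  · rw [deriv_smoothTransition_eq_zero (by simp only [mem_Icc, not_and_or, not_le] at hy; exact hy),
      abs_zero]
    exact (norm_nonneg _).trans (hB 0 (by simp))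

/-- The slopes of the two factors are of order j + 1 on the scale x ≲ 1 / (j + 1) and of order 1 /
(j + 1) on the scale x ≲ j + 1, so x times the derivative does not see j. This is what allows
cutoffs to be removed from moment identities. -/
theorem exists_deriv_cutoff_bound : ∃ B ≥ 0, ∀ j, ∀ x > 0, x * |deriv (cutoff j) x| ≤ B := by
  obtain ⟨B, hB0, hB⟩ := exists_deriv_smoothTransition_bound
  refine ⟨4 * B, by positivity, fun j x hx => ?_⟩
  set c : ℝ := j + 1 with hc
  have h0 : (0 : ℝ) < c := by positivity
  have hS : Differentiable ℝ Real.smoothTransition :=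
    (Real.smoothTransition.contDiff (n := ⊤)).differentiable (by simp)
  have d1 : HasDerivAt (fun y => Real.smoothTransition (c * y - 1))
      (deriv Real.smoothTransition (c * x - 1) * c) x := by
    have := (hS (c * x - 1)).hasDerivAt.comp x
      (((hasDerivAt_id x).const_mul c).sub_const 1)
    simpa [Function.comp_def] using this
  have d2 : HasDerivAt (fun y => Real.smoothTransition (2 - y / c))
      (deriv Real.smoothTransition (2 - x / c) * (-(1 / c))) x := by
    have := (hS (2 - x / c)).hasDerivAt.comp x
      (((hasDerivAt_id x).div_const c).const_sub 2)
    simpa [Function.comp_def] using this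
  have hd : deriv (cutoff j) x = _ := (d1.mul d2).deriv
  rw [hd]
  have e1 : |deriv Real.smoothTransition (c * x - 1)| * (c * x) ≤ 2 * B := by
    by_cases hy : c * x ≤ 2
    · calc _ ≤ B * 2 := mul_le_mul (hB _) hy (by positivity) hB0
        _ = _ := by ring
    · rw [deriv_smoothTransition_eq_zero (Or.inr (by linarith))]
      simp [hB0]
  have e2 : |deriv Real.smoothTransition (2 - x / c)| * (x / c) ≤ 2 * B := by
    by_cases hy : x / c ≤ 2
    · calc _ ≤ B * 2 := mul_le_mul (hB _) hy (by positivity) hB0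
        _ = _ := by ring
    · rw [deriv_smoothTransition_eq_zero (Or.inl (by linarith))]
      simp [hB0]
  have s1 := Real.smoothTransition.nonneg (c * x - 1)
  have s2 := Real.smoothTransition.nonneg (2 - x / c)
  have t1 := Real.smoothTransition.le_one (c * x - 1)
  have t2 := Real.smoothTransition.le_one (2 - x / c)
  calc x * |deriv Real.smoothTransition (c * x - 1) * c * Real.smoothTransition (2 - x / c)
        + Real.smoothTransition (c * x - 1) * (deriv Real.smoothTransition (2 - x / c) * -(1 / c))|
      ≤ x * (|deriv Real.smoothTransition (c * x - 1) * c * Real.smoothTransition (2 - x / c)|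
        + |Real.smoothTransition (c * x - 1)
            * (deriv Real.smoothTransition (2 - x / c) * -(1 / c))|) := by
        gcongr; exact abs_add_le _ _
    _ = |deriv Real.smoothTransition (c * x - 1)| * (c * x) * Real.smoothTransition (2 - x / c)
        + Real.smoothTransition (c * x - 1)
          * (|deriv Real.smoothTransition (2 - x / c)| * (x / c)) := by
        simp only [abs_mul, abs_neg, abs_of_nonneg s1, abs_of_nonneg s2, abs_of_pos h0, abs_div,
          abs_one]
        ring
    _ ≤ 2 * B * 1 + 1 * (2 * B) := by gcongr
    _ = 4 * B := by ring

/-- Measures on `(0, ∞)` are determined by the integrals of test functions. -/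
theorem measure_eq_of_integral_eq {ν ν' : Measure ℝ} (h0 : ν (Iic 0) = 0) (h0' : ν' (Iic 0) = 0)
    (hi : ∀ ζ, IsTestFun ζ → Integrable ζ ν) (hi' : ∀ ζ, IsTestFun ζ → Integrable ζ ν')
    (h : ∀ ζ, IsTestFun ζ → ∫ x, ζ x ∂ν = ∫ x, ζ x ∂ν') : ν = ν' := by
  have hm : ∀ j, Measurable fun x => ENNReal.ofReal (cutoff j x) := fun j =>
    (cutoff_contDiff j).continuous.measurable.ennreal_ofReal
  -- With the density `cutoff j` both measures become finite, and `cutoff j` times a bounded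
  -- continuous function is a test function. Monotone convergence then removes the cutoff.
  have key : ∀ j, ν.withDensity (fun x => ENNReal.ofReal (cutoff j x))
      = ν'.withDensity (fun x => ENNReal.ofReal (cutoff j x)) := by
    intro j
    have fin : ∀ m : Measure ℝ, (∀ ζ, IsTestFun ζ → Integrable ζ m) →
        IsFiniteMeasure (m.withDensity fun x => ENNReal.ofReal (cutoff j x)) := fun m hm =>
      isFiniteMeasure_withDensity_ofReal (hm _ (cutoff_isTestFun j)).2
    have := fin ν hi
    have := fin ν' hi'
    refine ext_of_forall_integral_eq_of_IsFiniteMeasure fun f => ?_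
    have e : ∀ m : Measure ℝ, ∫ x, f x ∂(m.withDensity fun x => ENNReal.ofReal (cutoff j x))
        = ∫ x, cutoff j x * f x ∂m := by
      intro m
      rw [integral_withDensity_eq_integral_toReal_smul (hm j)
        (ae_of_all _ fun x => ENNReal.ofReal_lt_top)]
      simp only [ENNReal.toReal_ofReal (cutoff_nonneg j _), smul_eq_mul]
    rw [e, e]
    exact h _ ((cutoff_isTestFun j).mul f.continuous.continuousOn)
  have lim : ∀ m : Measure ℝ, m (Iic 0) = 0 → ∀ s, MeasurableSet s →
      m s = ⨆ j, (m.withDensity fun x => ENNReal.ofReal (cutoff j x)) s := by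
    intro m hm0 s hs
    have hpos := ae_restrict_of_ae (s := s) (ae_pos_of_measure_Iic hm0)
    simp_rw [withDensity_apply _ hs]
    rw [← lintegral_iSup_ae hm]
    · rw [← setLIntegral_one]
      refine lintegral_congr_ae (hpos.mono fun x hx => ?_)
      have ht := (ENNReal.continuous_ofReal.tendsto _).comp (cutoff_tendsto hx)
      rw [ENNReal.ofReal_one] at ht
      exact tendsto_nhds_unique ht (tendsto_atTop_iSup
        fun i j hij => ENNReal.ofReal_le_ofReal (cutoff_mono hx hij))
    · exact fun n => hpos.mono fun x hx => ENNReal.ofReal_le_ofReal (cutoff_mono hx n.le_succ)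
  ext s hs
  rw [lim ν h0 s hs, lim ν' h0' s hs]
  simp_rw [key]

end LSW

/-! ### Weak time derivatives with boundary terms. -/

namespace LSW

/-- A continuous function satisfying `F' = g` weakly on `[0, T]`, with boundary terms, is the
primitive of `g`. -/
theorem sub_eq_integral_of_weak_deriv {T : ℝ} (hT : 0 < T) {F g : ℝ → ℝ}
    (hF : ContinuousOn F (Icc 0 T)) (hg : IntervalIntegrable g volume 0 T)
    (h : ∀ ψ : ℝ → ℝ, ContDiff ℝ ∞ ψ → HasCompactSupport ψ →
      ∫ t in (0 : ℝ)..T, (deriv ψ t * F t + ψ t * g t) = ψ T * F T - ψ 0 * F 0) :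
    ∀ t ∈ Icc 0 T, F t - F 0 = ∫ s in (0 : ℝ)..t, g s := by
  set H : ℝ → ℝ := fun t => ∫ s in (0 : ℝ)..t, g s with hH
  have hHac : AbsolutelyContinuousOnInterval H 0 T :=
    hg.absolutelyContinuousOnInterval_intervalIntegral (by simp)
  have hHc : ContinuousOn H (Icc 0 T) := by
    simpa [uIcc_of_le hT.le] using hHac.continuousOn
  have hderiv : ∀ᵐ t, t ∈ uIoc 0 T → deriv H t = g t := by
    filter_upwards [hg.ae_hasDerivAt_integral] with t ht hm
    exact (ht (uIoc_subset_uIcc hm) 0 (by simp)).deriv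
  have hH0 : H 0 = 0 := by simp [hH]
  -- the identity for `D = F - H`
  have hD : ∀ ψ : ℝ → ℝ, ContDiff ℝ ∞ ψ → HasCompactSupport ψ →
      ∫ t in (0 : ℝ)..T, deriv ψ t * (F t - H t) = ψ T * (F T - H T) - ψ 0 * (F 0 - H 0) := by
    intro ψ hψ hc
    have hψ' : Continuous (deriv ψ) := hψ.continuous_deriv (by simp)
    obtain ⟨K, hK⟩ := ContDiff.lipschitzWith_of_hasCompactSupport hc hψ (by simp)
    have hψac : AbsolutelyContinuousOnInterval ψ 0 T :=
      (hK.lipschitzOnWith (s := uIcc 0 T)).absolutelyContinuousOnInterval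
    have parts := hψac.integral_mul_deriv_eq_deriv_mul hHac
    have e1 : ∫ t in (0 : ℝ)..T, ψ t * deriv H t = ∫ t in (0 : ℝ)..T, ψ t * g t :=
      intervalIntegral.integral_congr_ae (hderiv.mono fun t ht hm => by rw [ht hm])
    have i1 : IntervalIntegrable (fun t => deriv ψ t * F t) volume 0 T :=
      (hψ'.continuousOn.mul (by simpa [uIcc_of_le hT.le] using hF)).intervalIntegrable
    have i2 : IntervalIntegrable (fun t => deriv ψ t * H t) volume 0 T :=
      (hψ'.continuousOn.mul (by simpa [uIcc_of_le hT.le] using hHc)).intervalIntegrable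
    have i3 : IntervalIntegrable (fun t => ψ t * g t) volume 0 T :=
      hg.continuousOn_mul hψ.continuous.continuousOn
    have := h ψ hψ hc
    rw [intervalIntegral.integral_add i1 i3] at this
    simp_rw [mul_sub]
    rw [intervalIntegral.integral_sub i1 i2]
    linarith
  -- The inner radius T about T / 2 makes b equal to 1 near [0, T]. It thus stands in for the
  -- constant test function, and the identity for D yields D T = D 0.
  let b : ContDiffBump (T / 2) := ⟨T, 2 * T, hT, by linarith⟩
  have hbT : b T = 1 := b.one_of_mem_closedBall (by
    rw [Metric.mem_closedBall, Real.dist_eq, abs_of_pos (by linarith)]; linarith)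
  have hb0 : b 0 = 1 := b.one_of_mem_closedBall (by
    rw [Metric.mem_closedBall, Real.dist_eq, abs_of_neg (by linarith)]; linarith)
  have hb1 : ∀ t ∈ Icc 0 T, (b : ℝ → ℝ) =ᶠ[𝓝 t] fun _ => 1 := fun t ht =>
    b.eventuallyEq_one_of_mem_ball (by
      rw [Metric.mem_ball, Real.dist_eq, abs_lt]; constructor <;> linarith [ht.1, ht.2])
  set D : ℝ → ℝ := fun t => F t - H t with hDdef
  have hDc : ContinuousOn D (Icc 0 T) := hF.sub hHc
  have hDT : D T = D 0 := by
    have := hD b b.contDiff b.hasCompactSupport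
    rw [hbT, hb0] at this
    have z : ∫ t in (0 : ℝ)..T, deriv b t * (F t - H t) = 0 := by
      rw [intervalIntegral.integral_congr (g := fun _ => 0)]
      · simp
      · intro t ht
        rw [uIcc_of_le hT.le] at ht
        simp [(hb1 t ht).deriv_eq]
    rw [z] at this
    simp only [hDdef]
    linarith
  have hz : ∀ᵐ t, t ∈ Ioo 0 T → D t - D 0 = 0 := by
    refine isOpen_Ioo.ae_eq_zero_of_integral_contDiff_smul_eq_zero
      (((hDc.sub continuousOn_const).mono Ioo_subset_Icc_self).locallyIntegrableOn
        measurableSet_Ioo) fun θ hθ hθc hθs => ?_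
    have hθi : ∀ a b : ℝ, IntervalIntegrable θ volume a b := fun a b =>
      hθ.continuous.intervalIntegrable a b
    -- Every θ supported in (0, T) is on [0, T] the derivative of the admissible function b Ψ. Since
    -- D T = D 0, the boundary term is D 0 times the integral of θ, so θ annihilates D - D 0.
    set Ψ : ℝ → ℝ := fun t => ∫ s in (0 : ℝ)..t, θ s with hΨ
    have hΨd : ∀ t, HasDerivAt Ψ (θ t) t := fun t =>
      intervalIntegral.integral_hasDerivAt_right (hθi 0 t)
        (hθ.continuous.stronglyMeasurableAtFilter _ _) hθ.continuous.continuousAt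
    have hΨs : ContDiff ℝ ∞ Ψ := by
      rw [contDiff_infty_iff_deriv]
      refine ⟨fun t => (hΨd t).differentiableAt, ?_⟩
      rw [show deriv Ψ = θ from funext fun t => (hΨd t).deriv]
      exact hθ
    have key := hD (fun t => b t * Ψ t) (b.contDiff.mul hΨs) b.hasCompactSupport.mul_right
    have e : ∫ t in (0 : ℝ)..T, deriv (fun t => b t * Ψ t) t * (F t - H t)
        = ∫ t in (0 : ℝ)..T, θ t * D t := by
      refine intervalIntegral.integral_congr fun t ht => ?_
      rw [uIcc_of_le hT.le] at ht
      have : (fun t => b t * Ψ t) =ᶠ[𝓝 t] Ψ := by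
        filter_upwards [hb1 t ht] with s hs
        rw [hs, one_mul]
      simp only [this.deriv_eq, (hΨd t).deriv, hDdef]
    have hΨ0 : Ψ 0 = 0 := by simp [hΨ]
    rw [e, hbT, hb0, hΨ0] at key
    have hout : ∀ t ∉ Ioc 0 T, θ t • (D t - D 0) = 0 := by
      intro t ht
      have : θ t = 0 := by
        by_contra hne
        exact ht (Ioo_subset_Ioc_self (hθs (subset_tsupport θ hne)))
      simp [this]
    rw [← setIntegral_eq_integral_of_forall_compl_eq_zero hout,
      ← intervalIntegral.integral_of_le hT.le]
    simp only [smul_eq_mul, mul_sub]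
    rw [intervalIntegral.integral_sub, key, intervalIntegral.integral_mul_const]
    · change 1 * Ψ T * D T - 1 * 0 * D 0 - Ψ T * D 0 = 0
      rw [hDT]
      ring
    · exact (hθ.continuous.continuousOn.mul
        (by simpa [uIcc_of_le hT.le] using hDc)).intervalIntegrable
    · exact (hθi 0 T).mul_const _
  have heq : EqOn D (fun _ => D 0) (Icc 0 T) := by
    refine Measure.eqOn_Icc_of_ae_eq volume hT.ne ?_ hDc continuousOn_const
    rw [Filter.EventuallyEq, ← restrict_Ioo_eq_restrict_Icc, ae_restrict_iff' measurableSet_Ioo]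
    filter_upwards [hz] with t ht hm
    linarith [ht hm]
  intro t ht
  have := heq ht
  simp only [hDdef, hH0] at this
  linarith

end LSW

namespace LSW

/-! ### Flows driven by a mean field -/

/-- A weak* continuous curve of states. -/
structure IsCurve (ρ T : ℝ) (ν : ℝ → Measure ℝ) : Prop where
  state : ∀ t ∈ Icc 0 T, IsState ρ (ν t)
  weakStar_continuous : ∀ t ∈ Icc 0 T, WeakStarTendsto ν (𝓝[Icc 0 T] t) (ν t)

/-- The dissipation `∫ x^α (v - q x^(-γ))² dν`. -/
noncomputable def dissipation (α γ q : ℝ) (ν : Measure ℝ) (v : ℝ) : ℝ≥0∞ :=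
  ∫⁻ x, ENNReal.ofReal (x ^ α * (v - q * x ^ (-γ)) ^ 2) ∂ν

/-- The dissipation localized by a cutoff. -/
noncomputable def cutDissipation (α γ q : ℝ) (j : ℕ) (ν : Measure ℝ) (v : ℝ) : ℝ :=
  v ^ 2 * (∫ x, cutoff j x * x ^ α ∂ν) - 2 * v * q * (∫ x, cutoff j x * x ^ (α - γ) ∂ν)
    + q ^ 2 * ∫ x, cutoff j x * x ^ (α - 2 * γ) ∂ν

/-- The rate of change `∫ ψ x^α (v - q x^(-γ)) dν` of a moment `∫ η dν` with `ψ = η'`. -/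
noncomputable def flux (α γ q : ℝ) (ν : Measure ℝ) (v : ℝ) (ψ : ℝ → ℝ) : ℝ :=
  ∫ x, ψ x * (x ^ α * (v - q * x ^ (-γ))) ∂ν

/-- A curve of states together with a mean field `u` of finite total dissipation. -/
structure HasFiniteDissipation (α γ q ρ T : ℝ) (ν : ℝ → Measure ℝ) (u : ℝ → ℝ) : Prop
    extends IsCurve ρ T ν where
  aemeasurable : AEMeasurable u (volume.restrict (Icc 0 T))
  dissipation_lt_top : ∫⁻ t in Icc 0 T, dissipation α γ q (ν t) (u t) < ⊤

/-- A curve of states transported by the vector field `x^α (u_t - q x^(-γ))`, with finite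
dissipation. -/
structure IsFlow (α γ q ρ T : ℝ) (ν : ℝ → Measure ℝ) (u : ℝ → ℝ) : Prop
    extends HasFiniteDissipation α γ q ρ T ν u where
  evolution : ∀ ζ, IsTestFun ζ → ContDiff ℝ ∞ ζ → ∀ t ∈ Icc 0 T,
    ∫ x, ζ x ∂(ν t) - ∫ x, ζ x ∂(ν 0) = ∫ s in (0 : ℝ)..t, flux α γ q (ν s) (u s) (deriv ζ)

variable {α γ q ρ T v : ℝ}

theorem rpow_mul_drift {x : ℝ} (hx : 0 < x) (y : ℝ) :
    y * (x ^ α * (v - q * x ^ (-γ))) = v * (y * x ^ α) - q * (y * x ^ (α - γ)) := by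
  rw [sub_eq_add_neg α γ, Real.rpow_add hx]
  ring

theorem rpow_mul_drift_sq {x : ℝ} (hx : 0 < x) (y : ℝ) :
    y * (x ^ α * (v - q * x ^ (-γ)) ^ 2)
      = v ^ 2 * (y * x ^ α) - 2 * v * q * (y * x ^ (α - γ)) + q ^ 2 * (y * x ^ (α - 2 * γ)) := by
  rw [show α - 2 * γ = α + (-γ) + (-γ) by ring, sub_eq_add_neg α γ]
  simp only [Real.rpow_add hx]
  ring

theorem flux_eq {ν : Measure ℝ} (hν : IsState ρ ν) {θ : ℝ → ℝ} (hθ : IsTestFun θ) :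
    flux α γ q ν v θ = v * (∫ x, θ x * x ^ α ∂ν) - q * ∫ x, θ x * x ^ (α - γ) ∂ν := by
  rw [← integral_const_mul, ← integral_const_mul, ← integral_sub
    (((hθ.mul_rpow _).integrable hν).const_mul _) (((hθ.mul_rpow _).integrable hν).const_mul _)]
  exact integral_congr_ae (hν.ae_pos.mono fun x hx => rpow_mul_drift hx _)

/-- Expanding the square makes the localized dissipation a quadratic polynomial in v whose
coefficients are moments of test functions. These are continuous in time and stable under weak*
limits, which the full dissipation is not. -/
theorem cutDissipation_eq {ν : Measure ℝ} (hν : IsState ρ ν) (j : ℕ) :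
    Integrable (fun x => cutoff j x * (x ^ α * (v - q * x ^ (-γ)) ^ 2)) ν ∧
    cutDissipation α γ q j ν v = ∫ x, cutoff j x * (x ^ α * (v - q * x ^ (-γ)) ^ 2) ∂ν := by
  have hi : ∀ s c : ℝ, Integrable (fun x => c * (cutoff j x * x ^ s)) ν := fun s c =>
    (((cutoff_isTestFun j).mul_rpow s).integrable hν).const_mul c
  have e := hν.ae_pos.mono fun x hx =>
    (rpow_mul_drift_sq (α := α) (γ := γ) (q := q) (v := v) hx (cutoff j x)).symm
  have i1 : Integrable (fun x => v ^ 2 * (cutoff j x * x ^ α)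
      - 2 * v * q * (cutoff j x * x ^ (α - γ))) ν := (hi α (v ^ 2)).sub (hi (α - γ) (2 * v * q))
  refine ⟨(i1.add (hi (α - 2 * γ) (q ^ 2))).congr e, ?_⟩
  rw [← integral_congr_ae e, integral_add i1 (hi (α - 2 * γ) (q ^ 2)), integral_sub (hi _ _) (hi _ _)]
  simp only [integral_const_mul, cutDissipation]

theorem dissipation_integrand_nonneg {x : ℝ} (hx : 0 < x) :
    0 ≤ x ^ α * (v - q * x ^ (-γ)) ^ 2 := by positivity

theorem ofReal_cutDissipation {ν : Measure ℝ} (hν : IsState ρ ν) (j : ℕ) :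
    ENNReal.ofReal (cutDissipation α γ q j ν v)
      = ∫⁻ x, ENNReal.ofReal (cutoff j x * (x ^ α * (v - q * x ^ (-γ)) ^ 2)) ∂ν := by
  rw [(cutDissipation_eq hν j).2]
  exact ofReal_integral_eq_lintegral_ofReal (cutDissipation_eq hν j).1
    (hν.ae_pos.mono fun x hx => mul_nonneg (cutoff_nonneg j x) (dissipation_integrand_nonneg hx))

theorem ofReal_cutDissipation_mono {ν : Measure ℝ} (hν : IsState ρ ν) :
    Monotone fun j => ENNReal.ofReal (cutDissipation α γ q j ν v) := by
  intro i j hij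
  simp only [ofReal_cutDissipation hν]
  exact lintegral_mono_ae (hν.ae_pos.mono fun x hx => ENNReal.ofReal_le_ofReal
    (mul_le_mul_of_nonneg_right (cutoff_mono hx hij) (dissipation_integrand_nonneg hx)))

/-- Monotone convergence in the cutoff. Through this supremum the dissipation inherits measurability
in time and lower semicontinuity from its localizations. -/
theorem dissipation_eq_iSup {ν : Measure ℝ} (hν : IsState ρ ν) :
    dissipation α γ q ν v = ⨆ j, ENNReal.ofReal (cutDissipation α γ q j ν v) := by
  simp_rw [ofReal_cutDissipation hν]
  rw [← lintegral_iSup_ae]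
  · refine lintegral_congr_ae (hν.ae_pos.mono fun x hx => ?_)
    have ht := (ENNReal.continuous_ofReal.tendsto _).comp
      ((cutoff_tendsto hx).mul_const (x ^ α * (v - q * x ^ (-γ)) ^ 2))
    rw [one_mul] at ht
    exact tendsto_nhds_unique ht (tendsto_atTop_iSup fun i j hij => ENNReal.ofReal_le_ofReal
      (mul_le_mul_of_nonneg_right (cutoff_mono hx hij) (dissipation_integrand_nonneg hx)))
  · intro j
    exact ((cutoff_contDiff j).continuous.measurable.mul (by fun_prop)).ennreal_ofReal
  · exact fun n => hν.ae_pos.mono fun x hx => ENNReal.ofReal_le_ofReal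
      (mul_le_mul_of_nonneg_right (cutoff_mono hx n.le_succ) (dissipation_integrand_nonneg hx))

theorem cutDissipation_le {ν : Measure ℝ} (hν : IsState ρ ν) (j : ℕ) :
    ENNReal.ofReal (cutDissipation α γ q j ν v) ≤ dissipation α γ q ν v := by
  rw [dissipation_eq_iSup hν]
  exact le_iSup (fun j => ENNReal.ofReal (cutDissipation α γ q j ν v)) j

section Curve

variable {ν : ℝ → Measure ℝ} {u : ℝ → ℝ}

theorem IsCurve.continuousOn (h : IsCurve ρ T ν) {θ : ℝ → ℝ} (hθ : IsTestFun θ) :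
    ContinuousOn (fun t => ∫ x, θ x ∂(ν t)) (Icc 0 T) :=
  fun t ht => h.weakStar_continuous t ht θ hθ

theorem IsCurve.aemeasurable_integral (h : IsCurve ρ T ν) {θ : ℝ → ℝ} (hθ : IsTestFun θ) :
    AEMeasurable (fun t => ∫ x, θ x ∂(ν t)) (volume.restrict (Icc 0 T)) :=
  (h.continuousOn hθ).aemeasurable measurableSet_Icc

theorem IsCurve.aemeasurable_flux (h : IsCurve ρ T ν)
    (hu : AEMeasurable u (volume.restrict (Icc 0 T))) {θ : ℝ → ℝ} (hθ : IsTestFun θ) :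
    AEMeasurable (fun t => flux α γ q (ν t) (u t) θ) (volume.restrict (Icc 0 T)) := by
  have := (hu.mul (h.aemeasurable_integral (hθ.mul_rpow α))).sub
    ((h.aemeasurable_integral (hθ.mul_rpow (α - γ))).const_mul q)
  refine this.congr ?_
  filter_upwards [ae_restrict_mem measurableSet_Icc] with t ht
  simp [flux_eq (h.state t ht) hθ]

theorem IsCurve.aemeasurable_cutDissipation (h : IsCurve ρ T ν)
    (hu : AEMeasurable u (volume.restrict (Icc 0 T))) (j : ℕ) :
    AEMeasurable (fun t => cutDissipation α γ q j (ν t) (u t)) (volume.restrict (Icc 0 T)) := by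
  have hm : ∀ s : ℝ, AEMeasurable (fun t => ∫ x, cutoff j x * x ^ s ∂(ν t))
      (volume.restrict (Icc 0 T)) := fun s =>
    h.aemeasurable_integral ((cutoff_isTestFun j).mul_rpow s)
  exact (((hu.pow_const 2).mul (hm α)).sub (((hu.const_mul 2).mul_const q).mul (hm _))).add
    ((hm _).const_mul _)

theorem IsCurve.aemeasurable_dissipation (h : IsCurve ρ T ν)
    (hu : AEMeasurable u (volume.restrict (Icc 0 T))) :
    AEMeasurable (fun t => dissipation α γ q (ν t) (u t)) (volume.restrict (Icc 0 T)) := by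
  refine (AEMeasurable.iSup fun j =>
    (h.aemeasurable_cutDissipation (α := α) (γ := γ) (q := q) hu j).ennreal_ofReal).congr ?_
  filter_upwards [ae_restrict_mem measurableSet_Icc] with t ht
  exact (dissipation_eq_iSup (h.state t ht)).symm

end Curve

/-! ### Estimates of the flux -/

theorem aestronglyMeasurable_drift {ν : Measure ℝ} (hν : IsState ρ ν) {ψ : ℝ → ℝ}
    (hψ : ContinuousOn ψ (Ioi 0)) :
    AEStronglyMeasurable (fun x => ψ x * (x ^ α * (v - q * x ^ (-γ)))) ν :=
  hν.aestronglyMeasurable (hψ.mul ((continuousOn_rpow α).mul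
    (continuousOn_const.sub ((continuousOn_rpow _).const_mul q))))

theorem integrable_dissipation {ν : Measure ℝ} (hν : IsState ρ ν)
    (hd : dissipation α γ q ν v ≠ ⊤) :
    Integrable (fun x => x ^ α * (v - q * x ^ (-γ)) ^ 2) ν ∧
    ∫ x, x ^ α * (v - q * x ^ (-γ)) ^ 2 ∂ν = (dissipation α γ q ν v).toReal := by
  have hm : AEStronglyMeasurable (fun x => x ^ α * (v - q * x ^ (-γ)) ^ 2) ν := by
    apply Measurable.aestronglyMeasurable
    fun_prop
  have h0 := hν.ae_pos.mono fun x hx =>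
    dissipation_integrand_nonneg (α := α) (γ := γ) (q := q) (v := v) hx
  refine ⟨⟨hm, ?_⟩, integral_eq_lintegral_of_nonneg_ae h0 hm⟩
  rw [hasFiniteIntegral_iff_ofReal h0]
  exact lt_top_iff_ne_top.2 hd

/-- The two bounds on y combine to |y| x^α ≤ C x: for x ≤ 1 use |y| ≤ C x and x^α ≤ 1, for x ≥ 1 use
|y| ≤ C and x^α ≤ x. Then |w| ≤ 1 + w². This is the reason for the two bounds in `FluxBound`. -/
theorem abs_drift_le (hα₀ : 0 ≤ α) (hα₁ : α ≤ 1) {C x y w : ℝ} (hx : 0 < x) (h1 : |y| ≤ C)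
    (h2 : |y| ≤ C * x) : |y * (x ^ α * w)| ≤ C * (x + x ^ α * w ^ 2) := by
  have hC : 0 ≤ C := (abs_nonneg y).trans h1
  have hp : 0 < x ^ α := Real.rpow_pos_of_pos hx α
  have hx1 : |y| * x ^ α ≤ C * x := by
    rcases le_total x 1 with h | h
    · calc |y| * x ^ α ≤ |y| * 1 := by
            gcongr; exact Real.rpow_le_one hx.le h hα₀
        _ ≤ C * x := by rwa [mul_one]
    · calc |y| * x ^ α ≤ C * x ^ (1 : ℝ) := by
            gcongr
        _ = C * x := by rw [Real.rpow_one]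
  have hw : |w| ≤ 1 + w ^ 2 := by
    rw [abs_le]; constructor <;> nlinarith [sq_nonneg (w - 1), sq_nonneg (w + 1)]
  rw [abs_mul, abs_mul, abs_of_pos hp]
  calc |y| * (x ^ α * |w|) ≤ |y| * (x ^ α * (1 + w ^ 2)) := by gcongr
    _ = |y| * x ^ α + |y| * (x ^ α * w ^ 2) := by ring
    _ ≤ C * x + C * (x ^ α * w ^ 2) := by gcongr
    _ = _ := by ring

/-- Bounds on the density `ψ` under which the flux is controlled by mass and dissipation. -/
def FluxBound (C : ℝ) (ψ : ℝ → ℝ) : Prop := ∀ x > 0, |ψ x| ≤ C ∧ |ψ x| ≤ C * x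

theorem integrable_drift (hα₀ : 0 ≤ α) (hα₁ : α ≤ 1) {ν : Measure ℝ} (hν : IsState ρ ν)
    (hd : dissipation α γ q ν v ≠ ⊤) {ψ : ℝ → ℝ} {C : ℝ} (hψ : ContinuousOn ψ (Ioi 0))
    (hC : FluxBound C ψ) : Integrable (fun x => ψ x * (x ^ α * (v - q * x ^ (-γ)))) ν :=
  ((hν.integrable_id.add (integrable_dissipation hν hd).1).const_mul C).mono'
    (aestronglyMeasurable_drift hν hψ)
    (hν.ae_pos.mono fun x hx => abs_drift_le hα₀ hα₁ hx (hC x hx).1 (hC x hx).2)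

theorem abs_flux_le (hα₀ : 0 ≤ α) (hα₁ : α ≤ 1) (hρ : 0 ≤ ρ) {ν : Measure ℝ} (hν : IsState ρ ν)
    (hd : dissipation α γ q ν v ≠ ⊤) {ψ : ℝ → ℝ} {C : ℝ} (hC : FluxBound C ψ) :
    |flux α γ q ν v ψ| ≤ C * (ρ + (dissipation α γ q ν v).toReal) := by
  have := norm_integral_le_of_norm_le (f := fun x => ψ x * (x ^ α * (v - q * x ^ (-γ))))
    ((hν.integrable_id.add (integrable_dissipation hν hd).1).const_mul C)
    (hν.ae_pos.mono fun x hx => abs_drift_le hα₀ hα₁ hx (hC x hx).1 (hC x hx).2)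
  rw [integral_const_mul] at this
  simp only [Pi.add_apply] at this
  rwa [integral_add hν.integrable_id (integrable_dissipation hν hd).1, hν.integral_id hρ,
    (integrable_dissipation hν hd).2] at this

theorem IsTestFun.fluxBound {θ : ℝ → ℝ} (hθ : IsTestFun θ) : ∃ C, FluxBound C θ := by
  obtain ⟨C, h0, hC⟩ := hθ.exists_bound
  obtain ⟨B, hB0, hB⟩ := hθ.exists_bound_rpow 0
  refine ⟨C + B, fun x hx => ⟨?_, (hC x hx).trans (by nlinarith)⟩⟩
  have := hB x hx
  rw [Real.rpow_zero, mul_one] at this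
  linarith

end LSW

/-! ### Time regularity of fluxes, and moment identities for unbounded profiles. -/

namespace LSW

variable {α γ q ρ T v : ℝ} {ν : ℝ → Measure ℝ} {u : ℝ → ℝ}

theorem tendsto_flux (hα₀ : 0 ≤ α) (hα₁ : α ≤ 1) {m : Measure ℝ} (hm : IsState ρ m)
    (hd : dissipation α γ q m v ≠ ⊤) {ψ : ℝ → ℝ} {θ : ℕ → ℝ → ℝ} {C : ℝ}
    (hθ : ∀ j, ContinuousOn (θ j) (Ioi 0)) (hC : ∀ j, FluxBound C (θ j))
    (h : ∀ x > 0, Tendsto (fun j => θ j x) atTop (𝓝 (ψ x))) :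
    Tendsto (fun j => flux α γ q m v (θ j)) atTop (𝓝 (flux α γ q m v ψ)) := by
  refine tendsto_integral_of_dominated_convergence _
    (fun j => aestronglyMeasurable_drift hm (hθ j))
    ((hm.integrable_id.add (integrable_dissipation hm hd).1).const_mul C)
    (fun j => hm.ae_pos.mono fun x hx =>
      abs_drift_le hα₀ hα₁ hx (hC j x hx).1 (hC j x hx).2)
    (hm.ae_pos.mono fun x hx => (h x hx).mul_const _)

namespace HasFiniteDissipation

theorem ae_ne_top (h : HasFiniteDissipation α γ q ρ T ν u) :
    ∀ᵐ t ∂(volume.restrict (Icc 0 T)), dissipation α γ q (ν t) (u t) ≠ ⊤ :=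
  (ae_lt_top' (h.aemeasurable_dissipation h.aemeasurable) h.dissipation_lt_top.ne).mono
    fun _ ht => ht.ne

theorem integrableOn_toReal (h : HasFiniteDissipation α γ q ρ T ν u) :
    IntegrableOn (fun t => (dissipation α γ q (ν t) (u t)).toReal) (Icc 0 T) :=
  integrable_toReal_of_lintegral_ne_top (h.aemeasurable_dissipation h.aemeasurable)
    h.dissipation_lt_top.ne

theorem integrableOn_bound (h : HasFiniteDissipation α γ q ρ T ν u) (C : ℝ) :
    IntegrableOn (fun t => C * (ρ + (dissipation α γ q (ν t) (u t)).toReal)) (Icc 0 T) :=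
  ((integrable_const ρ).add h.integrableOn_toReal).const_mul C

theorem aemeasurable_flux' (hα₀ : 0 ≤ α) (hα₁ : α ≤ 1) (h : HasFiniteDissipation α γ q ρ T ν u)
    {ψ : ℝ → ℝ} {C : ℝ} (hψ : ContinuousOn ψ (Ioi 0)) (hC : FluxBound C ψ) :
    AEMeasurable (fun t => flux α γ q (ν t) (u t) ψ) (volume.restrict (Icc 0 T)) := by
  refine aemeasurable_of_tendsto_metrizable_ae atTop
    (f := fun j t => flux α γ q (ν t) (u t) (fun x => cutoff j x * ψ x))
    (fun j => h.aemeasurable_flux h.aemeasurable ((cutoff_isTestFun j).mul hψ)) ?_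
  filter_upwards [h.ae_ne_top, ae_restrict_mem measurableSet_Icc] with t ht hm
  refine tendsto_flux hα₀ hα₁ (h.state t hm) ht (C := C)
    (fun j => (cutoff_contDiff j).continuous.continuousOn.mul hψ) (fun j x hx => ?_)
    (fun x hx => by simpa using (cutoff_tendsto hx).mul_const (ψ x))
  have : |cutoff j x * ψ x| ≤ |ψ x| := by
    rw [abs_mul, abs_of_nonneg (cutoff_nonneg j x)]
    exact mul_le_of_le_one_left (abs_nonneg _) (cutoff_le_one j x)
  exact ⟨this.trans (hC x hx).1, this.trans (hC x hx).2⟩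

theorem ae_abs_flux_le (hα₀ : 0 ≤ α) (hα₁ : α ≤ 1) (hρ : 0 ≤ ρ)
    (h : HasFiniteDissipation α γ q ρ T ν u) {ψ : ℝ → ℝ} {C : ℝ} (hC : FluxBound C ψ) :
    ∀ᵐ t ∂(volume.restrict (Icc 0 T)), |flux α γ q (ν t) (u t) ψ|
      ≤ C * (ρ + (dissipation α γ q (ν t) (u t)).toReal) := by
  filter_upwards [h.ae_ne_top, ae_restrict_mem measurableSet_Icc] with t ht hm
  exact abs_flux_le hα₀ hα₁ hρ (h.state t hm) ht hC

theorem integrableOn_flux (hα₀ : 0 ≤ α) (hα₁ : α ≤ 1) (hρ : 0 ≤ ρ)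
    (h : HasFiniteDissipation α γ q ρ T ν u) {ψ : ℝ → ℝ} {C : ℝ} (hψ : ContinuousOn ψ (Ioi 0))
    (hC : FluxBound C ψ) :
    IntegrableOn (fun t => flux α γ q (ν t) (u t) ψ) (Icc 0 T) :=
  (h.integrableOn_bound C).mono' (h.aemeasurable_flux' hα₀ hα₁ hψ hC).aestronglyMeasurable
    (h.ae_abs_flux_le hα₀ hα₁ hρ hC)

theorem intervalIntegrable_flux (hα₀ : 0 ≤ α) (hα₁ : α ≤ 1) (hρ : 0 ≤ ρ)
    (h : HasFiniteDissipation α γ q ρ T ν u) {ψ : ℝ → ℝ} {C : ℝ} (hψ : ContinuousOn ψ (Ioi 0))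
    (hC : FluxBound C ψ) {s t : ℝ} (hs : s ∈ Icc 0 T) (ht : t ∈ Icc 0 T) :
    IntervalIntegrable (fun t => flux α γ q (ν t) (u t) ψ) volume s t :=
  ((h.integrableOn_flux hα₀ hα₁ hρ hψ hC).mono_set (ordConnected_Icc.uIcc_subset hs ht)).intervalIntegrable

end HasFiniteDissipation

/-! ### From the continuity equation to moment identities -/

theorem isSpaceTimeTestFun_mul {ψ ζ : ℝ → ℝ} (hψ : ContDiff ℝ ∞ ψ) (hψc : HasCompactSupport ψ)
    (hζ : IsTestFun ζ) (hζs : ContDiff ℝ ∞ ζ) :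
    IsSpaceTimeTestFun fun p => ψ p.1 * ζ p.2 := by
  have hs : Function.support (fun p : ℝ × ℝ => ψ p.1 * ζ p.2) ⊆ tsupport ψ ×ˢ tsupport ζ :=
    fun p hp => ⟨subset_tsupport _ (left_ne_zero_of_mul hp),
      subset_tsupport _ (right_ne_zero_of_mul hp)⟩
  refine ⟨(hψ.comp contDiff_fst).mul (hζs.comp contDiff_snd),
    HasCompactSupport.of_support_subset_isCompact (hψc.isCompact.prod hζ.2.1.isCompact) hs, ?_⟩
  exact (closure_minimal hs ((isClosed_tsupport _).prod (isClosed_tsupport _))).trans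
    fun p hp => ⟨trivial, hζ.2.2 hp.2⟩

theorem fderiv_mul_apply {ψ ζ : ℝ → ℝ} (hψ : Differentiable ℝ ψ) (hζ : Differentiable ℝ ζ)
    (t x : ℝ) :
    fderiv ℝ (fun p : ℝ × ℝ => ψ p.1 * ζ p.2) (t, x) (1, 0) = deriv ψ t * ζ x ∧
    fderiv ℝ (fun p : ℝ × ℝ => ψ p.1 * ζ p.2) (t, x) (0, 1) = ψ t * deriv ζ x := by
  have h1 : HasFDerivAt (fun p : ℝ × ℝ => ψ p.1)
      (deriv ψ t • ContinuousLinearMap.fst ℝ ℝ ℝ) (t, x) :=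
    HasDerivAt.comp_hasFDerivAt (f := Prod.fst) (t, x) (hψ t).hasDerivAt
      (hasFDerivAt_fst (𝕜 := ℝ) (E := ℝ) (F := ℝ))
  have h2 : HasFDerivAt (fun p : ℝ × ℝ => ζ p.2)
      (deriv ζ x • ContinuousLinearMap.snd ℝ ℝ ℝ) (t, x) :=
    HasDerivAt.comp_hasFDerivAt (f := Prod.snd) (t, x) (hζ x).hasDerivAt
      (hasFDerivAt_snd (𝕜 := ℝ) (E := ℝ) (F := ℝ))
  have h3 : fderiv ℝ (fun p : ℝ × ℝ => ψ p.1 * ζ p.2) (t, x) = _ := (h1.mul h2).fderiv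
  rw [h3]
  constructor
  · simp [mul_comm]
  · simp

/-- Test functions of product form ψ(t) ζ(x) reduce the continuity equation to a weak derivative of
t ↦ ∫ ζ dν_t, which is continuous; `sub_eq_integral_of_weak_deriv` integrates it. -/
theorem HasFiniteDissipation.isFlow (hα₀ : 0 ≤ α) (hα₁ : α ≤ 1) (hρ : 0 ≤ ρ) (hT : 0 < T)
    (h : HasFiniteDissipation α γ q ρ T ν u) {w : ℝ → ℝ → ℝ} (hw : ContinuityEq α T ν w)
    (hwu : ∀ᵐ t ∂(volume.restrict (Icc 0 T)), ∀ᵐ x ∂(ν t), w t x = u t - q * x ^ (-γ)) :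
    IsFlow α γ q ρ T ν u := by
  refine ⟨h, fun ζ hζ hζs t ht => ?_⟩
  obtain ⟨C, hC⟩ := (hζ.deriv hζs).fluxBound
  have hdc := (hζ.deriv hζs).1.continuousOn (s := Ioi 0)
  refine sub_eq_integral_of_weak_deriv hT (F := fun t => ∫ x, ζ x ∂(ν t)) (h.continuousOn hζ)
    (h.intervalIntegrable_flux hα₀ hα₁ hρ hdc hC ⟨le_rfl, hT.le⟩ ⟨hT.le, le_rfl⟩) ?_ t ht
  intro ψ hψ hψc
  have key := hw _ (isSpaceTimeTestFun_mul hψ hψc hζ hζs)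
  simp only [integral_const_mul] at key
  rw [← key, intervalIntegral.integral_of_le hT.le, intervalIntegral.integral_of_le hT.le,
    restrict_Ioc_eq_restrict_Icc]
  refine integral_congr_ae ?_
  filter_upwards [hwu, ae_restrict_mem measurableSet_Icc, h.ae_ne_top] with t hwt ht hd
  have hst := h.state t ht
  have e : ∀ᵐ x ∂(ν t), fderiv ℝ (fun p : ℝ × ℝ => ψ p.1 * ζ p.2) (t, x) (1, 0)
      + fderiv ℝ (fun p : ℝ × ℝ => ψ p.1 * ζ p.2) (t, x) (0, 1) * (x ^ α * w t x)
      = deriv ψ t * ζ x + ψ t * (deriv ζ x * (x ^ α * (u t - q * x ^ (-γ)))) := by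
    filter_upwards [hwt] with x hx
    have := fderiv_mul_apply (hψ.differentiable (by simp)) (hζs.differentiable (by simp)) t x
    rw [this.1, this.2, hx]
    ring
  rw [integral_congr_ae e, integral_add ((hζ.integrable hst).const_mul _)
    ((integrable_drift hα₀ hα₁ hst hd hdc hC).const_mul _), integral_const_mul, integral_const_mul]
  rfl

/-! ### Profiles -/

/-- Moments `η`, with derivative `ψ`, whose evolution along a flow is controlled by mass and
dissipation. -/
structure IsProfile (C : ℝ) (η ψ : ℝ → ℝ) : Prop where
  contDiffOn : ContDiffOn ℝ ∞ η (Ioi 0)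
  hasDerivAt : ∀ x > 0, HasDerivAt η (ψ x) x
  abs_le : ∀ x > 0, |η x| ≤ C * x ∧ |η x| ≤ C * x ^ 2
  fluxBound : FluxBound C ψ

namespace IsProfile

variable {C : ℝ} {η ψ : ℝ → ℝ}

/-- By the mean value theorem η x = ψ c * x with 0 < c < x, so each bound on ψ gains one power of x.
-/
theorem of_fluxBound (h : ContDiffOn ℝ ∞ η (Ioi 0)) (hd : ∀ x > 0, HasDerivAt η (ψ x) x)
    (hc : ContinuousOn η (Ici 0)) (h0 : η 0 = 0) (hb : FluxBound C ψ) : IsProfile C η ψ := by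
  refine ⟨h, hd, fun x hx => ?_, hb⟩
  obtain ⟨c, hcm, hce⟩ := exists_hasDerivAt_eq_slope η ψ hx
    (hc.mono Icc_subset_Ici_self) (fun y hy => hd y hy.1)
  rw [h0, sub_zero, sub_zero, eq_div_iff hx.ne'] at hce
  have hC : 0 ≤ C := (abs_nonneg _).trans (hb c hcm.1).1
  rw [← hce, abs_mul, abs_of_pos hx]
  refine ⟨mul_le_mul_of_nonneg_right (hb c hcm.1).1 hx.le, ?_⟩
  calc |ψ c| * x ≤ C * c * x := mul_le_mul_of_nonneg_right (hb c hcm.1).2 hx.le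
    _ ≤ C * x * x := by gcongr; exact hcm.2.le
    _ = _ := by ring

theorem continuousOn (h : IsProfile C η ψ) : ContinuousOn η (Ioi 0) := h.contDiffOn.continuousOn

theorem continuousOn_deriv (h : IsProfile C η ψ) : ContinuousOn ψ (Ioi 0) :=
  ((h.contDiffOn.continuousOn_deriv_of_isOpen isOpen_Ioi (by simp))).congr
    fun x hx => (h.hasDerivAt x hx).deriv.symm

theorem integrable (h : IsProfile C η ψ) {m : Measure ℝ} (hm : IsState ρ m) : Integrable η m :=
  hm.integrable_of_abs_le (hm.aestronglyMeasurable h.continuousOn) fun x hx => (h.abs_le x hx).1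

theorem cutoff_mul_contDiff (h : IsProfile C η ψ) (j : ℕ) :
    ContDiff ℝ ∞ fun x => cutoff j x * η x := by
  rw [contDiff_iff_contDiffAt]
  intro x
  rcases lt_or_ge 0 x with hx | hx
  · exact (cutoff_contDiff j).contDiffAt.mul (h.contDiffOn.contDiffAt (Ioi_mem_nhds hx))
  · have hn : x ∉ tsupport fun x => cutoff j x * η x := fun hm =>
      not_lt.2 hx (((cutoff_isTestFun j).mul h.continuousOn).2.2 hm)
    exact contDiffAt_const.congr_of_eventuallyEq (notMem_tsupport_iff_eventuallyEq.1 hn)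

theorem deriv_cutoff_mul (h : IsProfile C η ψ) (j : ℕ) {x : ℝ} (hx : 0 < x) :
    deriv (fun x => cutoff j x * η x) x = deriv (cutoff j) x * η x + cutoff j x * ψ x :=
  ((((cutoff_contDiff j).differentiable (by simp)) x).hasDerivAt.mul (h.hasDerivAt x hx)).deriv

/-- The delicate term is the derivative of the cutoff times η. As x times that derivative is
bounded, |η| ≤ C x makes the term bounded and |η| ≤ C x² makes it O(x); hence the two bounds on η in
`IsProfile`. -/
theorem exists_fluxBound_cutoff (h : IsProfile C η ψ) :
    ∃ C', ∀ j, FluxBound C' (deriv fun x => cutoff j x * η x) := by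
  obtain ⟨B, hB0, hB⟩ := exists_deriv_cutoff_bound
  refine ⟨B * C + C, fun j x hx => ?_⟩
  rw [h.deriv_cutoff_mul j hx]
  have h1 : |cutoff j x * ψ x| ≤ |ψ x| := by
    rw [abs_mul, abs_of_nonneg (cutoff_nonneg j x)]
    exact mul_le_of_le_one_left (abs_nonneg _) (cutoff_le_one j x)
  have key : ∀ D, |η x| ≤ D * x → |deriv (cutoff j) x * η x| ≤ B * D := by
    intro D hD
    have hD0 : 0 ≤ D := by
      by_contra! hlt
      nlinarith [abs_nonneg (η x)]
    rw [abs_mul]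
    calc |deriv (cutoff j) x| * |η x| ≤ |deriv (cutoff j) x| * (D * x) := by gcongr
      _ = (x * |deriv (cutoff j) x|) * D := by ring
      _ ≤ B * D := by gcongr; exact hB j x hx
  have k1 := key C (h.abs_le x hx).1
  have k2 := key (C * x) (by convert (h.abs_le x hx).2 using 1; ring)
  obtain ⟨f1, f2⟩ := h.fluxBound x hx
  constructor
  · exact (abs_add_le _ _).trans (by linarith)
  · exact (abs_add_le _ _).trans (by linarith)

end IsProfile

/-- The identity holds for `cutoff j` times η. As j → ∞ the moments converge by domination with |η|,
and the fluxes by domination in time with mass plus dissipation, thanks to the bound of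
`exists_fluxBound_cutoff` uniform in j. -/
theorem IsFlow.evolution_profile (hα₀ : 0 ≤ α) (hα₁ : α ≤ 1) (hρ : 0 ≤ ρ)
    (h : IsFlow α γ q ρ T ν u) {C : ℝ} {η ψ : ℝ → ℝ} (hη : IsProfile C η ψ) {s t : ℝ}
    (hs : s ∈ Icc 0 T) (ht : t ∈ Icc 0 T) :
    ∫ x, η x ∂(ν t) - ∫ x, η x ∂(ν s) = ∫ r in s..t, flux α γ q (ν r) (u r) ψ := by
  obtain ⟨C', hC'⟩ := hη.exists_fluxBound_cutoff
  have htest : ∀ j, IsTestFun fun x => cutoff j x * η x := fun j =>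
    (cutoff_isTestFun j).mul hη.continuousOn
  have hint : ∀ t ∈ Icc 0 T, ∫ x, η x ∂(ν t) - ∫ x, η x ∂(ν 0)
      = ∫ r in (0 : ℝ)..t, flux α γ q (ν r) (u r) ψ := by
    intro t ht
    have h0 : (0 : ℝ) ∈ Icc 0 T := ⟨le_rfl, ht.1.trans ht.2⟩
    have hl : ∀ r ∈ Icc 0 T, Tendsto (fun j => ∫ x, cutoff j x * η x ∂(ν r)) atTop
        (𝓝 (∫ x, η x ∂(ν r))) := by
      intro r hr
      have hst := h.state r hr
      refine tendsto_integral_of_dominated_convergence (fun x => |η x|)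
        (fun j => (htest j).1.aestronglyMeasurable) (hη.integrable hst).abs
        (fun j => ae_of_all _ fun x => ?_)
        (hst.ae_pos.mono fun x hx => by simpa using (cutoff_tendsto hx).mul_const (η x))
      rw [Real.norm_eq_abs, abs_mul, abs_of_nonneg (cutoff_nonneg j x)]
      exact mul_le_of_le_one_left (abs_nonneg _) (cutoff_le_one j x)
    have hr : Tendsto (fun j => ∫ r in (0 : ℝ)..t, flux α γ q (ν r) (u r)
        (deriv fun x => cutoff j x * η x)) atTop
        (𝓝 (∫ r in (0 : ℝ)..t, flux α γ q (ν r) (u r) ψ)) := by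
      have hsub : uIoc 0 t ⊆ Icc 0 T := by
        rw [uIoc_of_le ht.1]
        exact fun r hr => ⟨hr.1.le, hr.2.trans ht.2⟩
      have hcont : ∀ j, ContinuousOn (deriv fun x => cutoff j x * η x) (Ioi 0) := fun j =>
        ((hη.cutoff_mul_contDiff j).continuous_deriv (by simp)).continuousOn
      refine intervalIntegral.tendsto_integral_filter_of_dominated_convergence
        (fun r => C' * (ρ + (dissipation α γ q (ν r) (u r)).toReal))
        (Eventually.of_forall fun j => ?_) (Eventually.of_forall fun j => ?_) ?_ ?_
      · exact (h.aemeasurable_flux' hα₀ hα₁ (hcont j) (hC' j)).aestronglyMeasurable.mono_set hsub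
      · filter_upwards [(ae_restrict_iff' measurableSet_Icc).1
          (h.ae_abs_flux_le hα₀ hα₁ hρ (hC' j))] with r hr hm
        exact hr (hsub hm)
      · exact ((h.integrableOn_bound C').mono_set
          (ordConnected_Icc.uIcc_subset h0 ht)).intervalIntegrable
      · filter_upwards [(ae_restrict_iff' measurableSet_Icc).1 h.ae_ne_top] with r hr hm
        refine tendsto_flux hα₀ hα₁ (h.state r (hsub hm)) (hr (hsub hm)) hcont hC' fun x hx => ?_
        refine tendsto_const_nhds.congr' ?_
        filter_upwards [deriv_cutoff_eventually hx, cutoff_eventually_eq_one hx] with j h1 h2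
        rw [hη.deriv_cutoff_mul j hx, h1, h2.eq_of_nhds]
        ring
    refine tendsto_nhds_unique ((hl t ht).sub (hl 0 h0)) ?_
    refine hr.congr fun j => ?_
    exact (h.evolution _ (htest j) (hη.cutoff_mul_contDiff j) t ht).symm
  have h0 : (0 : ℝ) ∈ Icc 0 T := ⟨le_rfl, ht.1.trans ht.2⟩
  have hi := fun r (hr : r ∈ Icc 0 T) => h.intervalIntegrable_flux hα₀ hα₁ hρ
    hη.continuousOn_deriv hη.fluxBound h0 hr
  rw [← intervalIntegral.integral_interval_sub_left (hi t ht) (hi s hs), ← hint t ht, ← hint s hs]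
  ring

end LSW

/-! ### A priori estimates: growth of convex moments and the energy inequality. -/

namespace LSW

variable {α γ q ρ T v : ℝ} {ν : ℝ → Measure ℝ} {u : ℝ → ℝ}

/-! ### Fatou's lemma -/

theorem lintegral_le_of_le_liminf {X : Type*} [MeasurableSpace X] {μ : Measure X}
    {f : ℕ → X → ℝ≥0∞} {g : X → ℝ≥0∞} {b : ℝ≥0∞} (hf : ∀ j, AEMeasurable (f j) μ)
    (hg : ∀ᵐ x ∂μ, g x ≤ liminf (fun j => f j x) atTop) (hb : ∀ j, ∫⁻ x, f j x ∂μ ≤ b) :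
    ∫⁻ x, g x ∂μ ≤ b :=
  calc ∫⁻ x, g x ∂μ ≤ ∫⁻ x, liminf (fun j => f j x) atTop ∂μ := lintegral_mono_ae hg
    _ ≤ liminf (fun j => ∫⁻ x, f j x ∂μ) atTop := lintegral_liminf_le' hf
    _ ≤ liminf (fun _ : ℕ => b) atTop := liminf_le_liminf (Eventually.of_forall hb)
    _ = b := liminf_const b

theorem lintegral_le_of_tendsto {X : Type*} [MeasurableSpace X] {μ : Measure X}
    {f : ℕ → X → ℝ≥0∞} {g : X → ℝ≥0∞} {b : ℝ≥0∞} (hf : ∀ j, AEMeasurable (f j) μ)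
    (hg : ∀ᵐ x ∂μ, Tendsto (fun j => f j x) atTop (𝓝 (g x))) (hb : ∀ j, ∫⁻ x, f j x ∂μ ≤ b) :
    ∫⁻ x, g x ∂μ ≤ b :=
  lintegral_le_of_le_liminf hf (hg.mono fun _ hx => hx.liminf_eq.ge) hb

/-! ### Balanced flows -/

/-- The mean field `v` balances the state `m`: the total mass is instantaneously preserved. -/
structure IsBalanced (α γ q : ℝ) (m : Measure ℝ) (v : ℝ) : Prop where
  pos : 0 < v
  integrable : Integrable (fun x => x ^ α * (v - q * x ^ (-γ))) m
  integral_eq_zero : ∫ x, x ^ α * (v - q * x ^ (-γ)) ∂m = 0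

/-- A flow which is balanced at almost every time. -/
structure IsBalancedFlow (α γ q ρ T : ℝ) (ν : ℝ → Measure ℝ) (u : ℝ → ℝ) : Prop
    extends IsFlow α γ q ρ T ν u where
  balanced : ∀ᵐ t ∂(volume.restrict (Icc 0 T)), IsBalanced α γ q (ν t) (u t)

theorem integral_rpow_pos (hρ : 0 < ρ) {m : Measure ℝ} (hm : IsState ρ m) {s : ℝ}
    (hi : Integrable (fun x : ℝ => x ^ s) m) : 0 < ∫ x, x ^ s ∂m := by
  rw [integral_pos_iff_support_of_nonneg_ae (hm.ae_pos.mono fun x hx => (Real.rpow_pos_of_pos hx s).le) hi]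
  rw [pos_iff_ne_zero]
  intro h0
  apply hm.ne_zero hρ
  have : ∀ᵐ x ∂m, x ∉ Function.support fun x : ℝ => x ^ s := measure_eq_zero_iff_ae_notMem.1 h0
  have hf : ∀ᵐ x ∂m, False := by
    filter_upwards [this, hm.ae_pos] with x h1 h2
    exact h1 (Real.rpow_pos_of_pos h2 s).ne'
  rwa [eventually_false_iff_eq_bot, ae_eq_bot] at hf

theorem IsSolution.isBalancedFlow (hα₀ : 0 ≤ α) (hα₁ : α ≤ 1) (hq : 0 < q) (hρ : 0 < ρ)
    (hT : 0 < T) (h : IsSolution α γ q ρ T ν) :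
    IsBalancedFlow α γ q ρ T ν fun t => meanField α γ q (ν t) := by
  obtain ⟨w, hc, hw⟩ := h
  have hcurve : IsCurve ρ T ν := ⟨hc.state, hc.weakStar_continuous⟩
  -- Needed for measurability of the mean field in time: full moments are limits of cut moments,
  -- which are continuous in time.
  have hmom : ∀ s : ℝ, (∀ᵐ t ∂(volume.restrict (Icc 0 T)), Integrable (fun x : ℝ => x ^ s) (ν t)) →
      AEMeasurable (fun t => ∫ x, x ^ s ∂(ν t)) (volume.restrict (Icc 0 T)) := by
    intro s hs
    refine aemeasurable_of_tendsto_metrizable_ae atTop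
      (f := fun j t => ∫ x, cutoff j x * x ^ s ∂(ν t))
      (fun j => hcurve.aemeasurable_integral ((cutoff_isTestFun j).mul_rpow s)) ?_
    filter_upwards [hs, ae_restrict_mem measurableSet_Icc] with t ht hm
    have hst := hc.state t hm
    refine tendsto_integral_of_dominated_convergence (fun x => |x ^ s|)
      (fun j => ((cutoff_isTestFun j).mul_rpow s).1.aestronglyMeasurable) ht.abs
      (fun j => ae_of_all _ fun x => ?_)
      (hst.ae_pos.mono fun x hx => by simpa using (cutoff_tendsto hx).mul_const (x ^ s))
    rw [Real.norm_eq_abs, abs_mul, abs_of_nonneg (cutoff_nonneg j x)]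
    exact mul_le_of_le_one_left (abs_nonneg _) (cutoff_le_one j x)
  have hdiss : ∫⁻ t in Icc 0 T, dissipation α γ q (ν t) (meanField α γ q (ν t)) < ⊤ := by
    refine lt_of_le_of_lt (le_of_eq ?_) hc.action_lt_top
    refine lintegral_congr_ae ?_
    filter_upwards [hw] with t ht
    refine lintegral_congr_ae ?_
    filter_upwards [ht.2.2] with x hx
    rw [hx]
  have hfd : HasFiniteDissipation α γ q ρ T ν fun t => meanField α γ q (ν t) :=
    ⟨hcurve, ((hmom _ (hw.mono fun t ht => ht.2.1)).const_mul q).div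
      (hmom _ (hw.mono fun t ht => ht.1)), hdiss⟩
  refine ⟨hfd.isFlow hα₀ hα₁ hρ.le hT hc.continuity_eq (hw.mono fun t ht => ht.2.2), ?_⟩
  filter_upwards [hw, hc.cotangent, ae_restrict_mem measurableSet_Icc] with t ht hcot hm
  have hst := hc.state t hm
  have e : (fun x => x ^ α * w t x) =ᵐ[ν t]
      fun x => x ^ α * (meanField α γ q (ν t) - q * x ^ (-γ)) := by
    filter_upwards [ht.2.2] with x hx
    rw [hx]
  refine ⟨?_, hcot.1.congr e, (integral_congr_ae e).symm.trans hcot.2⟩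
  exact div_pos (mul_pos hq (integral_rpow_pos hρ hst ht.2.1)) (integral_rpow_pos hρ hst ht.1)

namespace IsBalanced

theorem crit_rpow (hγ : 0 < γ) (hq : 0 < q) (hv : 0 < v) :
    ((q / v) ^ (1 / γ)) ^ (-γ) = v / q := by
  rw [← Real.rpow_mul (by positivity), show 1 / γ * -γ = -1 by field_simp, Real.rpow_neg_one,
    inv_div]

/-- The number (q / v)^(1/γ) is the critical size, where v = q x^(-γ). Smaller sizes shrink and
larger ones grow, so the drift and the increment of a nondecreasing ψ from the critical size have
the same sign. -/
theorem nonneg_mul_drift (hγ : 0 < γ) (hq : 0 < q) (hv : 0 < v) {ψ : ℝ → ℝ}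
    (hψ : MonotoneOn ψ (Ioi 0)) {x : ℝ} (hx : 0 < x) :
    0 ≤ (ψ x - ψ ((q / v) ^ (1 / γ))) * (x ^ α * (v - q * x ^ (-γ))) := by
  set c := (q / v) ^ (1 / γ) with hc
  have hc0 : 0 < c := by positivity
  have hcv : q * c ^ (-γ) = v := by
    rw [hc, crit_rpow hγ hq hv]; field_simp
  have hp := Real.rpow_pos_of_pos hx α
  rcases le_total x c with h | h
  · have h1 := hψ hx hc0 h
    have h2 := Real.rpow_le_rpow_of_nonpos hx h (neg_nonpos.2 hγ.le)
    have h3 : v - q * x ^ (-γ) ≤ 0 := by nlinarith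
    exact mul_nonneg_of_nonpos_of_nonpos (by linarith)
      (mul_nonpos_of_nonneg_of_nonpos hp.le h3)
  · have h1 := hψ hc0 hx h
    have h2 := Real.rpow_le_rpow_of_nonpos hc0 h (neg_nonpos.2 hγ.le)
    have h3 : 0 ≤ v - q * x ^ (-γ) := by nlinarith
    exact mul_nonneg (by linarith) (mul_nonneg hp.le h3)

/-- Constants may be subtracted from ψ because a balanced drift has integral zero. The constant
wanted is the value of ψ at the critical size. -/
theorem flux_eq_sub {m : Measure ℝ} (h : IsBalanced α γ q m v) {ψ : ℝ → ℝ}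
    (hi : Integrable (fun x => ψ x * (x ^ α * (v - q * x ^ (-γ)))) m) (c : ℝ) :
    Integrable (fun x => (ψ x - c) * (x ^ α * (v - q * x ^ (-γ)))) m ∧
    flux α γ q m v ψ = ∫ x, (ψ x - c) * (x ^ α * (v - q * x ^ (-γ))) ∂m := by
  simp_rw [sub_mul]
  refine ⟨hi.sub (h.integrable.const_mul c), ?_⟩
  rw [integral_sub hi (h.integrable.const_mul c), integral_const_mul, h.integral_eq_zero]
  simp [flux]

/-- For a balanced state the flux of a nondecreasing density is nonnegative. -/
theorem ofReal_flux (hγ : 0 < γ) (hq : 0 < q) {m : Measure ℝ} (hm : IsState ρ m)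
    (h : IsBalanced α γ q m v) {ψ : ℝ → ℝ} (hψ : MonotoneOn ψ (Ioi 0))
    (hi : Integrable (fun x => ψ x * (x ^ α * (v - q * x ^ (-γ)))) m) :
    0 ≤ flux α γ q m v ψ ∧ ENNReal.ofReal (flux α γ q m v ψ)
      = ∫⁻ x, ENNReal.ofReal
          ((ψ x - ψ ((q / v) ^ (1 / γ))) * (x ^ α * (v - q * x ^ (-γ)))) ∂m := by
  obtain ⟨i, e⟩ := h.flux_eq_sub hi (ψ ((q / v) ^ (1 / γ)))
  have h0 := hm.ae_pos.mono fun x hx => nonneg_mul_drift (α := α) hγ hq h.pos hψ hx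
  rw [e]
  exact ⟨integral_nonneg_of_ae h0, ofReal_integral_eq_lintegral_ofReal i h0⟩

end IsBalanced

theorem IsBalancedFlow.ae_flux_nonneg (hα₀ : 0 ≤ α) (hα₁ : α ≤ 1) (hγ : 0 < γ) (hq : 0 < q)
    (h : IsBalancedFlow α γ q ρ T ν u) {C : ℝ} {ψ : ℝ → ℝ}
    (hc : ContinuousOn ψ (Ioi 0)) (hC : FluxBound C ψ) (hψ : MonotoneOn ψ (Ioi 0)) :
    ∀ᵐ t ∂(volume.restrict (Icc 0 T)), 0 ≤ flux α γ q (ν t) (u t) ψ := by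
  filter_upwards [h.balanced, h.ae_ne_top, ae_restrict_mem measurableSet_Icc] with t hb hd ht
  exact (hb.ofReal_flux hγ hq (h.state t ht) hψ
    (integrable_drift hα₀ hα₁ (h.state t ht) hd hc hC)).1

/-- Along balanced flows, moments of convex profiles are nondecreasing. -/
theorem IsBalancedFlow.integral_mono (hα₀ : 0 ≤ α) (hα₁ : α ≤ 1) (hρ : 0 ≤ ρ) (hγ : 0 < γ)
    (hq : 0 < q) (h : IsBalancedFlow α γ q ρ T ν u) {C : ℝ} {η ψ : ℝ → ℝ} (hη : IsProfile C η ψ)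
    (hψ : MonotoneOn ψ (Ioi 0)) {s t : ℝ} (hs : s ∈ Icc 0 T) (ht : t ∈ Icc 0 T) (hst : s ≤ t) :
    ∫ x, η x ∂(ν s) ≤ ∫ x, η x ∂(ν t) := by
  rw [← sub_nonneg, h.evolution_profile hα₀ hα₁ hρ hη hs ht]
  refine intervalIntegral.integral_nonneg_of_ae_restrict hst ?_
  exact ae_restrict_of_ae_restrict_of_subset (Icc_subset_Icc hs.1 ht.2)
    (h.ae_flux_nonneg hα₀ hα₁ hγ hq hη.continuousOn_deriv hη.fluxBound hψ)

/-! ### The energy estimate -/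

/-- A regularization of the potential `x^(1-γ) / (1-γ)` with bounded derivative. -/
noncomputable def regPotential (γ δ x : ℝ) : ℝ := ((x + δ) ^ (1 - γ) - δ ^ (1 - γ)) / (1 - γ)

section regPotential

variable {δ : ℝ}

theorem hasDerivAt_regPotential (hγ₁ : γ < 1) (hδ : 0 < δ) {x : ℝ} (hx : 0 < x) :
    HasDerivAt (regPotential γ δ) ((x + δ) ^ (-γ)) x := by
  have h1 : 1 - γ ≠ 0 := by linarith
  have := ((((hasDerivAt_id x).add_const δ).rpow_const (p := 1 - γ)
    (Or.inl (by simp; linarith))).sub_const (δ ^ (1 - γ))).div_const (1 - γ)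
  convert! this using 1
  rw [show 1 - γ - 1 = -γ by ring]
  simp
  field_simp

theorem regPotential_nonneg (hγ₁ : γ < 1) (hδ : 0 < δ) {x : ℝ} (hx : 0 < x) :
    0 ≤ regPotential γ δ x := by
  refine div_nonneg (sub_nonneg.2 (Real.rpow_le_rpow hδ.le (by linarith) (by linarith)))
    (by linarith)

theorem regPotential_le (hγ₀ : 0 < γ) (hγ₁ : γ < 1) (hδ : 0 < δ) {x : ℝ} (hx : 0 < x) :
    regPotential γ δ x ≤ x ^ (1 - γ) / (1 - γ) := by
  refine div_le_div_of_nonneg_right ?_ (by linarith)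
  have := Real.rpow_add_le_add_rpow hx.le hδ.le (p := 1 - γ) (by linarith) (by linarith)
  linarith

/-- Linear vanishing at the origin comes from (δ / (x + δ))^γ ≥ δ / (x + δ) ≥ 1 - x / δ, where the
first inequality uses γ < 1. The two terms of the constant serve the two bounds. -/
theorem regPotential_density_fluxBound (hγ₀ : 0 < γ) (hγ₁ : γ < 1) (hδ : 0 < δ) :
    FluxBound (δ ^ (-γ) * (1 + 1 / δ)) fun x => δ ^ (-γ) - (x + δ) ^ (-γ) := by
  intro x hx
  have hd := Real.rpow_pos_of_pos hδ (-γ)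
  have hxd : 0 < x + δ := by linarith
  have hp := Real.rpow_pos_of_pos hxd (-γ)
  have h1 : (x + δ) ^ (-γ) ≤ δ ^ (-γ) :=
    Real.rpow_le_rpow_of_nonpos hδ (by linarith) (by linarith)
  have h2 : δ / (x + δ) ≤ (x + δ) ^ (-γ) / δ ^ (-γ) := by
    have hle : δ / (x + δ) ≤ 1 := (div_le_one hxd).2 (by linarith)
    rw [← Real.div_rpow hxd.le hδ.le, ← inv_div δ (x + δ), Real.inv_rpow (by positivity),
      Real.rpow_neg (by positivity), inv_inv]
    simpa using Real.rpow_le_rpow_of_exponent_ge (by positivity) hle hγ₁.le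
  rw [le_div_iff₀ hd] at h2
  rw [abs_of_nonneg (by linarith)]
  have h3 : δ / (x + δ) ≥ 1 - x / δ := by
    rw [ge_iff_le, le_div_iff₀ hxd]
    have : x / δ * δ = x := by field_simp
    have : 0 ≤ x / δ * x := by positivity
    nlinarith
  constructor
  · have : 0 ≤ δ ^ (-γ) * (1 / δ) := by positivity
    nlinarith
  · have : (1 - x / δ) * δ ^ (-γ) ≤ δ / (x + δ) * δ ^ (-γ) := by gcongr
    have h4 : 0 ≤ δ ^ (-γ) * x := by positivity
    have h5 : x / δ * δ ^ (-γ) = δ ^ (-γ) * (1 / δ) * x := by ring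
    nlinarith

theorem regPotential_density_monotoneOn (hγ₀ : 0 < γ) (hδ : 0 < δ) :
    MonotoneOn (fun x : ℝ => δ ^ (-γ) - (x + δ) ^ (-γ)) (Ioi 0) := by
  intro x hx y _ hxy
  have hx' : 0 < x := hx
  have := Real.rpow_le_rpow_of_nonpos (show 0 < x + δ by linarith)
    (show x + δ ≤ y + δ by linarith) (neg_nonpos.2 hγ₀.le)
  simp only
  linarith

/-- The term δ^(-γ) x only contributes a multiple of the mass, which is constant in time. It turns
the concave potential into a convex profile whose derivative vanishes at the origin, as `FluxBound`
requires. -/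
theorem isProfile_regPotential (hγ₀ : 0 < γ) (hγ₁ : γ < 1) (hδ : 0 < δ) :
    IsProfile (δ ^ (-γ) * (1 + 1 / δ)) (fun x => δ ^ (-γ) * x - regPotential γ δ x)
      fun x => δ ^ (-γ) - (x + δ) ^ (-γ) := by
  refine IsProfile.of_fluxBound ?_ (fun x hx => ?_) ?_ ?_
    (regPotential_density_fluxBound hγ₀ hγ₁ hδ)
  · refine (contDiff_const.mul contDiff_id).contDiffOn.sub ?_
    refine ContDiffOn.div_const (ContDiffOn.sub ?_ contDiffOn_const) _
    refine (contDiff_id.add contDiff_const).contDiffOn.rpow_const_of_ne fun x hx => ?_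
    have : 0 < x := hx
    simp
    linarith
  · have := ((hasDerivAt_id x).const_mul (δ ^ (-γ))).sub (hasDerivAt_regPotential (γ := γ) hγ₁ hδ hx)
    rw [mul_one] at this
    exact this
  · unfold regPotential
    refine ContinuousOn.sub (by fun_prop) ?_
    refine ContinuousOn.div_const (ContinuousOn.sub ?_ continuousOn_const) _
    exact ContinuousOn.rpow_const (by fun_prop) fun x _ => Or.inr (by linarith)
  · simp [regPotential]

theorem tendsto_regPotential (hγ₁ : γ < 1) {d : ℕ → ℝ} (hd : Tendsto d atTop (𝓝 0)) (x : ℝ) :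
    Tendsto (fun k => regPotential γ (d k) x) atTop (𝓝 (x ^ (1 - γ) / (1 - γ))) := by
  have h1 : Tendsto (fun k => (x + d k) ^ (1 - γ)) atTop (𝓝 ((x + 0) ^ (1 - γ))) :=
    ((Real.continuous_rpow_const (by linarith)).tendsto _).comp (hd.const_add x)
  have h2 : Tendsto (fun k => (d k) ^ (1 - γ)) atTop (𝓝 (0 ^ (1 - γ))) :=
    ((Real.continuous_rpow_const (by linarith)).tendsto _).comp hd
  have := (h1.sub h2).div_const (1 - γ)
  rwa [Real.zero_rpow (by linarith), sub_zero, add_zero] at this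

end regPotential

theorem energy_eq_lintegral (hq : 0 < q) (hγ₁ : γ < 1) (m : Measure ℝ) :
    energy γ q m = ENNReal.ofReal q * ∫⁻ x, ENNReal.ofReal (x ^ (1 - γ) / (1 - γ)) ∂m := by
  have h1 : 0 < 1 - γ := by linarith
  have e : ∀ x : ℝ, ENNReal.ofReal (x ^ (1 - γ) / (1 - γ))
      = ENNReal.ofReal (1 - γ)⁻¹ * ENNReal.ofReal (x ^ (1 - γ)) := fun x => by
    rw [← ENNReal.ofReal_mul (by positivity), div_eq_inv_mul]
  simp_rw [e]
  rw [lintegral_const_mul _ (by fun_prop), ← mul_assoc, ← ENNReal.ofReal_mul hq.le, energy,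
    div_eq_mul_inv]

theorem integrable_regPotential (hγ₀ : 0 < γ) (hγ₁ : γ < 1) {δ : ℝ} (hδ : 0 < δ) {m : Measure ℝ}
    (hρ : 0 ≤ ρ) (hm : IsState ρ m) : Integrable (regPotential γ δ) m ∧
    ∫ x, (δ ^ (-γ) * x - regPotential γ δ x) ∂m = δ ^ (-γ) * ρ - ∫ x, regPotential γ δ x ∂m := by
  have h1 := (hm.integrable_id.const_mul (δ ^ (-γ))).sub
    ((isProfile_regPotential hγ₀ hγ₁ hδ).integrable hm)
  have h2 : Integrable (regPotential γ δ) m := h1.congr (ae_of_all _ fun x => by simp)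
  refine ⟨h2, ?_⟩
  rw [integral_sub (hm.integrable_id.const_mul _) h2, integral_const_mul, hm.integral_id hρ]

theorem ofReal_integral_regPotential (hγ₀ : 0 < γ) (hγ₁ : γ < 1) {δ : ℝ} (hδ : 0 < δ)
    {m : Measure ℝ} (hρ : 0 ≤ ρ) (hm : IsState ρ m) :
    ENNReal.ofReal (∫ x, regPotential γ δ x ∂m) = ∫⁻ x, ENNReal.ofReal (regPotential γ δ x) ∂m :=
  ofReal_integral_eq_lintegral_ofReal (integrable_regPotential hγ₀ hγ₁ hδ hρ hm).1
    (hm.ae_pos.mono fun _ hx => regPotential_nonneg hγ₁ hδ hx)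

theorem ofReal_integral_regPotential_le (hγ₀ : 0 < γ) (hγ₁ : γ < 1) {δ : ℝ} (hδ : 0 < δ)
    {m : Measure ℝ} (hρ : 0 ≤ ρ) (hm : IsState ρ m) :
    ENNReal.ofReal (∫ x, regPotential γ δ x ∂m)
      ≤ ∫⁻ x, ENNReal.ofReal (x ^ (1 - γ) / (1 - γ)) ∂m := by
  rw [ofReal_integral_regPotential hγ₀ hγ₁ hδ hρ hm]
  exact lintegral_mono_ae (hm.ae_pos.mono fun x hx =>
    ENNReal.ofReal_le_ofReal (regPotential_le hγ₀ hγ₁ hδ hx))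

/-- The regularized potentials have nonincreasing integrals and lie below the true potential;
Fatou's lemma as δ → 0 recovers the energy at time t. -/
theorem IsBalancedFlow.energy_le (hα₀ : 0 ≤ α) (hα₁ : α ≤ 1) (hγ₀ : 0 < γ) (hγ₁ : γ < 1)
    (hq : 0 < q) (hρ : 0 ≤ ρ) (h : IsBalancedFlow α γ q ρ T ν u) {t : ℝ} (ht : t ∈ Icc 0 T) :
    energy γ q (ν t) ≤ energy γ q (ν 0) := by
  have h0 : (0 : ℝ) ∈ Icc 0 T := ⟨le_rfl, ht.1.trans ht.2⟩
  rw [energy_eq_lintegral hq hγ₁, energy_eq_lintegral hq hγ₁]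
  refine mul_le_mul' le_rfl (lintegral_le_of_tendsto
    (f := fun (k : ℕ) x => ENNReal.ofReal (regPotential γ (1 / ((k : ℝ) + 1)) x))
    (fun k => ?_) (ae_of_all _ fun x => (ENNReal.continuous_ofReal.tendsto _).comp
      (tendsto_regPotential hγ₁ tendsto_one_div_add_atTop_nhds_zero_nat x)) fun k => ?_)
  · unfold regPotential
    fun_prop
  · have hδ : (0 : ℝ) < 1 / ((k : ℝ) + 1) := by positivity
    have hm := h.integral_mono hα₀ hα₁ hρ hγ₀ hq (isProfile_regPotential hγ₀ hγ₁ hδ)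
      (regPotential_density_monotoneOn hγ₀ hδ) h0 ht ht.1
    rw [(integrable_regPotential hγ₀ hγ₁ hδ hρ (h.state t ht)).2,
      (integrable_regPotential hγ₀ hγ₁ hδ hρ (h.state 0 h0)).2] at hm
    rw [← ofReal_integral_regPotential hγ₀ hγ₁ hδ hρ (h.state t ht)]
    exact (ENNReal.ofReal_le_ofReal (by linarith)).trans
      (ofReal_integral_regPotential_le hγ₀ hγ₁ hδ hρ (h.state 0 h0))

/-- For each δ, q times the flux of the regularized profile integrates in time to a loss of
regularized energy, hence to at most the initial energy. Relative to the critical size the densities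
converge although δ^(-γ) diverges, and the limiting integrand is that of the dissipation. Two
applications of Fatou's lemma, in x and in t, give the inequality. -/
theorem IsBalancedFlow.dissipation_le (hα₀ : 0 ≤ α) (hα₁ : α ≤ 1) (hγ₀ : 0 < γ) (hγ₁ : γ < 1)
    (hq : 0 < q) (hρ : 0 ≤ ρ) (hT : 0 < T) (h : IsBalancedFlow α γ q ρ T ν u) :
    ∫⁻ t in Icc 0 T, dissipation α γ q (ν t) (u t) ≤ energy γ q (ν 0) := by
  have h0 : (0 : ℝ) ∈ Icc 0 T := ⟨le_rfl, hT.le⟩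
  have h1 : T ∈ Icc 0 T := ⟨hT.le, le_rfl⟩
  set d : ℕ → ℝ := fun k => 1 / ((k : ℝ) + 1) with hd
  have hdpos : ∀ k, 0 < d k := fun k => by positivity
  have hdlim : Tendsto d atTop (𝓝 0) := tendsto_one_div_add_atTop_nhds_zero_nat
  set ψ : ℕ → ℝ → ℝ := fun k x => d k ^ (-γ) - (x + d k) ^ (-γ) with hψ
  have hprof := fun k => isProfile_regPotential hγ₀ hγ₁ (hdpos k)
  have hmono := fun k => regPotential_density_monotoneOn hγ₀ (hdpos k)
  refine lintegral_le_of_le_liminf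
    (f := fun k t => ENNReal.ofReal (q * flux α γ q (ν t) (u t) (ψ k))) (fun k => ?_) ?_ fun k => ?_
  · exact ((h.aemeasurable_flux' hα₀ hα₁ (hprof k).continuousOn_deriv
      (hprof k).fluxBound).const_mul q).ennreal_ofReal
  · filter_upwards [h.balanced, h.ae_ne_top, ae_restrict_mem measurableSet_Icc] with t hb hdt ht
    have hst := h.state t ht
    set c := (q / u t) ^ (1 / γ) with hc
    have hc0 : 0 < c := by
      have := hb.pos
      positivity
    have e : ∀ k, ENNReal.ofReal (q * flux α γ q (ν t) (u t) (ψ k))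
        = ∫⁻ x, ENNReal.ofReal
          (q * ((ψ k x - ψ k c) * (x ^ α * (u t - q * x ^ (-γ))))) ∂(ν t) := by
      intro k
      rw [ENNReal.ofReal_mul hq.le, (hb.ofReal_flux hγ₀ hq hst (hmono k)
        (integrable_drift hα₀ hα₁ hst hdt (hprof k).continuousOn_deriv (hprof k).fluxBound)).2,
        ← lintegral_const_mul' _ _ ENNReal.ofReal_ne_top]
      simp_rw [ENNReal.ofReal_mul hq.le]
      rfl
    simp_rw [e]
    refine le_trans (lintegral_mono_ae ?_) (lintegral_liminf_le' fun k => ?_)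
    · filter_upwards [hst.ae_pos] with x hx
      have hl : ∀ y : ℝ, 0 < y → Tendsto (fun k => (y + d k) ^ (-γ)) atTop (𝓝 (y ^ (-γ))) := by
        intro y hy
        have := (hdlim.const_add y).rpow_const (p := -γ) (Or.inl (by simpa using hy.ne'))
        rwa [add_zero] at this
      have hlim : Tendsto (fun k => q * ((ψ k x - ψ k c) * (x ^ α * (u t - q * x ^ (-γ))))) atTop
          (𝓝 (x ^ α * (u t - q * x ^ (-γ)) ^ 2)) := by
        have h2 := (((hl c hc0).sub (hl x hx)).mul_const
          (x ^ α * (u t - q * x ^ (-γ)))).const_mul q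
        -- At the critical size q c^(-γ) = u, so one of the two factors of the square is q (c^(-γ) -
        -- x^(-γ)).
        have e2 : x ^ α * (u t - q * x ^ (-γ)) ^ 2
            = q * ((c ^ (-γ) - x ^ (-γ)) * (x ^ α * (u t - q * x ^ (-γ)))) := by
          rw [hc, IsBalanced.crit_rpow hγ₀ hq hb.pos]
          field_simp
        rw [e2]
        refine h2.congr fun k => ?_
        simp only [hψ]
        ring
      exact ((ENNReal.continuous_ofReal.tendsto _).comp hlim).liminf_eq.ge
    · refine Measurable.aemeasurable ?_
      simp only [hψ]
      fun_prop
  · have hi := h.integrableOn_flux hα₀ hα₁ hρ (hprof k).continuousOn_deriv (hprof k).fluxBound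
    have hnn := h.ae_flux_nonneg hα₀ hα₁ hγ₀ hq (hprof k).continuousOn_deriv (hprof k).fluxBound
      (hmono k)
    have hev := h.evolution_profile hα₀ hα₁ hρ (hprof k) h0 h1
    rw [(integrable_regPotential hγ₀ hγ₁ (hdpos k) hρ (h.state T h1)).2,
      (integrable_regPotential hγ₀ hγ₁ (hdpos k) hρ (h.state 0 h0)).2,
      intervalIntegral.integral_of_le hT.le, restrict_Ioc_eq_restrict_Icc] at hev
    rw [← ofReal_integral_eq_lintegral_ofReal (hi.const_mul q)
      (hnn.mono fun t ht => mul_nonneg hq.le ht), integral_const_mul, ENNReal.ofReal_mul hq.le,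
      energy_eq_lintegral hq hγ₁]
    gcongr
    refine le_trans (ENNReal.ofReal_le_ofReal ?_)
      (ofReal_integral_regPotential_le hγ₀ hγ₁ (hdpos k) hρ (h.state 0 h0))
    have hpos : 0 ≤ ∫ x, regPotential γ (d k) x ∂(ν T) := integral_nonneg_of_ae
      ((h.state T h1).ae_pos.mono fun x hx => regPotential_nonneg hγ₁ (hdpos k) hx)
    linarith

end LSW

/-! ### Quantitative continuity in time, and tails of the mass at infinity and at zero. -/

namespace LSW

variable {α γ q ρ T v : ℝ} {ν : ℝ → Measure ℝ} {u : ℝ → ℝ}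

/-! ### Weighted bounds of the flux -/

/-- Young's inequality with weight σ. The weight stays free because a small σ is needed for
equicontinuity, and a power of R for the tails. -/
theorem abs_drift_le_of_sq {x y w B σ : ℝ} (hx : 0 < x) (hσ : 0 < σ)
    (h : y ^ 2 * x ^ α ≤ B * x) : |y * (x ^ α * w)| ≤ σ⁻¹ * B * x + σ * (x ^ α * w ^ 2) := by
  have hp : 0 < x ^ α := Real.rpow_pos_of_pos hx α
  have h1 : σ * |y * (x ^ α * w)| ≤ y ^ 2 * x ^ α + σ ^ 2 * (x ^ α * w ^ 2) := by
    rw [abs_mul, abs_mul, abs_of_pos hp]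
    have := mul_nonneg hp.le (sq_nonneg (|y| - σ * |w|))
    have h2 : 0 ≤ x ^ α * (|y| ^ 2 + σ ^ 2 * |w| ^ 2) := by positivity
    rw [← sq_abs y, ← sq_abs w]
    nlinarith
  calc |y * (x ^ α * w)| = σ⁻¹ * (σ * |y * (x ^ α * w)|) := by field_simp
    _ ≤ σ⁻¹ * (B * x + σ ^ 2 * (x ^ α * w ^ 2)) := by gcongr; linarith
    _ = _ := by field_simp

theorem abs_flux_le_of_sq (hρ : 0 ≤ ρ) {m : Measure ℝ} (hm : IsState ρ m)
    (hd : dissipation α γ q m v ≠ ⊤) {ψ : ℝ → ℝ} {B σ : ℝ} (hσ : 0 < σ)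
    (hB : ∀ x > 0, ψ x ^ 2 * x ^ α ≤ B * x) :
    |flux α γ q m v ψ| ≤ σ⁻¹ * B * ρ + σ * (dissipation α γ q m v).toReal := by
  have i1 := hm.integrable_id.const_mul (σ⁻¹ * B)
  have i2 := (integrable_dissipation hm hd).1.const_mul σ
  have := norm_integral_le_of_norm_le (f := fun x => ψ x * (x ^ α * (v - q * x ^ (-γ))))
    (i1.add i2) (hm.ae_pos.mono fun x hx => abs_drift_le_of_sq hx hσ (hB x hx))
  simp only [Pi.add_apply] at this
  rwa [integral_add i1 i2, integral_const_mul, integral_const_mul, hm.integral_id hρ,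
    (integrable_dissipation hm hd).2] at this

theorem HasFiniteDissipation.integral_toReal_le (h : HasFiniteDissipation α γ q ρ T ν u) {D : ℝ}
    (hD0 : 0 ≤ D) (hD : ∫⁻ t in Icc 0 T, dissipation α γ q (ν t) (u t) ≤ ENNReal.ofReal D)
    {s t : ℝ} (hs : s ∈ Icc 0 T) (ht : t ∈ Icc 0 T) (hst : s ≤ t) :
    ∫ r in s..t, (dissipation α γ q (ν r) (u r)).toReal ≤ D := by
  rw [intervalIntegral.integral_of_le hst]
  calc ∫ r in Ioc s t, (dissipation α γ q (ν r) (u r)).toReal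
      ≤ ∫ r in Icc 0 T, (dissipation α γ q (ν r) (u r)).toReal :=
        setIntegral_mono_set h.integrableOn_toReal (ae_of_all _ fun _ => ENNReal.toReal_nonneg)
          (Eventually.of_forall fun r hr => ⟨hs.1.trans hr.1.le, hr.2.trans ht.2⟩)
    _ = (∫⁻ t in Icc 0 T, dissipation α γ q (ν t) (u t)).toReal :=
        integral_toReal (h.aemeasurable_dissipation h.aemeasurable)
          (h.ae_ne_top.mono fun _ hr => lt_top_iff_ne_top.2 hr)
    _ ≤ D := ENNReal.toReal_le_of_le_ofReal hD0 hD

/-- The dissipation is only integrable in time, so it costs the full budget D, but with the small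
factor σ; the rest is Lipschitz in time. -/
theorem IsFlow.abs_integral_sub_le (hα₀ : 0 ≤ α) (hα₁ : α ≤ 1) (hρ : 0 ≤ ρ)
    (h : IsFlow α γ q ρ T ν u) {C : ℝ} {η ψ : ℝ → ℝ} (hη : IsProfile C η ψ) {B σ D : ℝ}
    (hσ : 0 < σ) (hB : ∀ x > 0, ψ x ^ 2 * x ^ α ≤ B * x) (hD0 : 0 ≤ D)
    (hD : ∫⁻ t in Icc 0 T, dissipation α γ q (ν t) (u t) ≤ ENNReal.ofReal D)
    {s t : ℝ} (hs : s ∈ Icc 0 T) (ht : t ∈ Icc 0 T) :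
    |∫ x, η x ∂(ν t) - ∫ x, η x ∂(ν s)| ≤ σ⁻¹ * B * ρ * |t - s| + σ * D := by
  wlog hst : s ≤ t generalizing s t
  · rw [abs_sub_comm, abs_sub_comm t]
    exact this ht hs (le_of_not_ge hst)
  have hsub : Ioc s t ⊆ Icc 0 T := fun r hr => ⟨hs.1.trans hr.1.le, hr.2.trans ht.2⟩
  have i1 : IntervalIntegrable (fun _ : ℝ => σ⁻¹ * B * ρ) volume s t := by simp
  have i2 : IntervalIntegrable (fun r => σ * (dissipation α γ q (ν r) (u r)).toReal) volume s t :=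
    ((h.integrableOn_toReal.mono_set
      (ordConnected_Icc.uIcc_subset hs ht)).intervalIntegrable).const_mul σ
  rw [h.evolution_profile hα₀ hα₁ hρ hη hs ht]
  have := intervalIntegral.norm_integral_le_of_norm_le hst
    (f := fun r => flux α γ q (ν r) (u r) ψ) ?_ (i1.add i2)
  · refine this.trans ?_
    rw [intervalIntegral.integral_add i1 i2, intervalIntegral.integral_const,
      intervalIntegral.integral_const_mul, abs_of_nonneg (sub_nonneg.2 hst), smul_eq_mul,
      mul_comm (t - s)]
    gcongr
    exact h.integral_toReal_le hD0 hD hs ht hst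
  · filter_upwards [(ae_restrict_iff' measurableSet_Icc).1 h.ae_ne_top] with r hr hm
    exact abs_flux_le_of_sq hρ (h.state r (hsub hm)) (hr (hsub hm)) hσ hB

theorem IsTestFun.isProfile {ζ : ℝ → ℝ} (h : IsTestFun ζ) (hs : ContDiff ℝ ∞ ζ) :
    ∃ C, IsProfile C ζ (_root_.deriv ζ) := by
  obtain ⟨C, hC⟩ := (h.deriv hs).fluxBound
  refine ⟨C, IsProfile.of_fluxBound hs.contDiffOn
    (fun x _ => (hs.differentiable (by simp) x).hasDerivAt) h.1.continuousOn ?_ hC⟩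
  by_contra h0
  exact lt_irrefl (0 : ℝ) (h.2.2 (subset_tsupport ζ h0))

theorem FluxBound.sq_mul_rpow_le (hα₀ : 0 ≤ α) (hα₁ : α ≤ 1) {ψ : ℝ → ℝ} {C : ℝ}
    (h : FluxBound C ψ) : ∀ x > 0, ψ x ^ 2 * x ^ α ≤ C ^ 2 * x := by
  intro x hx
  obtain ⟨h1, h2⟩ := h x hx
  have hC : 0 ≤ C := (abs_nonneg _).trans h1
  rw [← sq_abs]
  rcases le_total x 1 with hx1 | hx1
  · calc |ψ x| ^ 2 * x ^ α ≤ |ψ x| ^ 2 * 1 := by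
          gcongr; exact Real.rpow_le_one hx.le hx1 hα₀
      _ = |ψ x| * |ψ x| := by ring
      _ ≤ C * (C * x) := by gcongr
      _ = C ^ 2 * x := by ring
  · calc |ψ x| ^ 2 * x ^ α ≤ C ^ 2 * x ^ (1 : ℝ) := by gcongr
      _ = C ^ 2 * x := by rw [Real.rpow_one]

/-! ### The moment `√(x² + R²) - R` -/

/-- A smooth convex moment, quadratic on scales below `R` and linear above. -/
noncomputable def rootMoment (R x : ℝ) : ℝ := √(x ^ 2 + R ^ 2) - R

section rootMoment

variable {R x : ℝ}

/-- Written as x times a bounded continuous function, the moment passes to the limit under weak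
convergence of the mass distributions, without any cutoff. -/
theorem rootMoment_eq (hR : 0 < R) (x : ℝ) :
    rootMoment R x = x * (x / (√(x ^ 2 + R ^ 2) + R)) := by
  have h1 := Real.sqrt_nonneg (x ^ 2 + R ^ 2)
  have h2 := Real.sq_sqrt (show 0 ≤ x ^ 2 + R ^ 2 by positivity)
  rw [rootMoment, mul_div_assoc', eq_div_iff (by positivity)]
  nlinarith

theorem le_root (R x : ℝ) : |x| ≤ √(x ^ 2 + R ^ 2) ∧ R ≤ √(x ^ 2 + R ^ 2) :=
  ⟨Real.abs_le_sqrt (by nlinarith), Real.le_sqrt_of_sq_le (by nlinarith)⟩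

theorem rootMoment_nonneg (R x : ℝ) : 0 ≤ rootMoment R x :=
  sub_nonneg.2 (le_root R x).2

theorem rootMoment_le (hR : 0 < R) (hx : 0 < x) :
    rootMoment R x ≤ x ∧ rootMoment R x ≤ x / R * x := by
  obtain ⟨h1, h2⟩ := le_root R x
  rw [abs_of_pos hx] at h1
  have h3 : 0 < √(x ^ 2 + R ^ 2) + R := by linarith
  rw [rootMoment_eq hR]
  constructor
  · exact mul_le_of_le_one_right hx.le ((div_le_one h3).2 (by linarith))
  · rw [mul_comm]
    gcongr
    linarith

/-- The ratio of the moment to x increases with x and equals √2 - 1 > 1 / 3 at x = R. -/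
theorem le_rootMoment (hR : 0 < R) (hx : R ≤ x) : x ≤ 3 * rootMoment R x := by
  have : R + x / 3 ≤ √(x ^ 2 + R ^ 2) := Real.le_sqrt_of_sq_le (by nlinarith)
  rw [rootMoment]
  linarith

theorem root_density_fluxBound (hR : 0 < R) (hx : 0 < x) :
    0 ≤ x / √(x ^ 2 + R ^ 2) ∧ x / √(x ^ 2 + R ^ 2) ≤ 1 ∧ x / √(x ^ 2 + R ^ 2) ≤ x / R := by
  obtain ⟨h1, h2⟩ := le_root R x
  rw [abs_of_pos hx] at h1
  have h3 : 0 < √(x ^ 2 + R ^ 2) := by linarith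
  refine ⟨by positivity, (div_le_one h3).2 h1, by gcongr⟩

theorem isProfile_rootMoment (hR : 0 < R) :
    IsProfile (1 + 1 / R) (rootMoment R) fun x => x / √(x ^ 2 + R ^ 2) := by
  have hpos : ∀ x : ℝ, x ^ 2 + R ^ 2 ≠ 0 := fun x => by positivity
  refine IsProfile.of_fluxBound ?_ (fun x hx => ?_) ?_ ?_ fun x hx => ?_
  · exact ((ContDiff.sqrt (by fun_prop) hpos).sub contDiff_const).contDiffOn
  · have := ((((hasDerivAt_id x).pow 2).add_const (R ^ 2)).sqrt (hpos x)).sub_const R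
    convert! this using 1
    simp
    field_simp
  · unfold rootMoment
    fun_prop
  · simp [rootMoment, Real.sqrt_sq hR.le]
  · obtain ⟨h0, h1, h2⟩ := root_density_fluxBound hR hx
    rw [abs_of_nonneg h0]
    have : 0 < 1 / R := by positivity
    refine ⟨by linarith, h2.trans ?_⟩
    rw [add_mul, one_mul, one_div_mul_eq_div]
    linarith

theorem root_density_monotoneOn (hR : 0 < R) :
    MonotoneOn (fun x : ℝ => x / √(x ^ 2 + R ^ 2)) (Ioi 0) := by
  intro x hx y hy hxy
  have hx' : 0 < x := hx
  have hy' : 0 < y := hy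
  have h1 : 0 < √(x ^ 2 + R ^ 2) := by positivity
  have h2 : 0 < √(y ^ 2 + R ^ 2) := by positivity
  simp only
  rw [div_le_div_iff₀ h1 h2, ← sq_le_sq₀ (by positivity) (by positivity), mul_pow, mul_pow,
    Real.sq_sqrt (by positivity), Real.sq_sqrt (by positivity)]
  have : x ^ 2 ≤ y ^ 2 := by gcongr
  nlinarith [sq_nonneg R]

/-- The density is small below R, while above R one has x^α = x^(α-1) x ≤ R^(α-1) x. For α < 1 the
constant tends to zero as R → ∞: little mass can be carried to large sizes in bounded time. -/
theorem root_density_sq_le (hα₀ : 0 ≤ α) (hα₁ : α ≤ 1) (hR : 0 < R) :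
    ∀ x > 0, (x / √(x ^ 2 + R ^ 2)) ^ 2 * x ^ α ≤ R ^ (α - 1) * x := by
  intro x hx
  obtain ⟨h0, h1, h2⟩ := root_density_fluxBound hR hx
  rcases le_total x R with h | h
  · calc (x / √(x ^ 2 + R ^ 2)) ^ 2 * x ^ α ≤ (x / R) ^ 2 * R ^ α := by gcongr
      _ = x / R * (R ^ α / R) * x := by ring
      _ ≤ 1 * (R ^ α / R) * x := by gcongr; exact (div_le_one hR).2 h
      _ = R ^ (α - 1) * x := by rw [Real.rpow_sub_one hR.ne', one_mul]
  · calc (x / √(x ^ 2 + R ^ 2)) ^ 2 * x ^ α ≤ 1 ^ 2 * x ^ α := by gcongr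
      _ = x ^ (α - 1) * x := by rw [Real.rpow_sub_one hx.ne']; field_simp
      _ ≤ R ^ (α - 1) * x := by
        gcongr ?_ * _
        exact Real.rpow_le_rpow_of_nonpos hR h (by linarith)

theorem lintegral_Ioi_le_rootMoment (hR : 0 < R) {m : Measure ℝ} (hm : IsState ρ m) :
    ∫⁻ x in Ioi R, ENNReal.ofReal x ∂m ≤ ENNReal.ofReal (3 * ∫ x, rootMoment R x ∂m) := by
  have hi := ((isProfile_rootMoment hR).integrable hm).const_mul 3
  rw [← integral_const_mul, ofReal_integral_eq_lintegral_ofReal hi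
    (ae_of_all _ fun x => mul_nonneg (by norm_num) (rootMoment_nonneg R x))]
  refine le_trans (setLIntegral_mono' measurableSet_Ioi fun x hx => ?_)
    (setLIntegral_le_lintegral (Ioi R) _)
  exact ENNReal.ofReal_le_ofReal (le_rootMoment hR (le_of_lt hx))

/-- Split at r: below it the moment is at most x² / R ≤ (r / R) x, above it at most x. -/
theorem integral_rootMoment_le (hR : 0 < R) (hρ : 0 ≤ ρ) {r : ℝ} (hr : 0 ≤ r) {m : Measure ℝ}
    (hm : IsState ρ m) {δ : ℝ} (hδ : 0 ≤ δ)
    (h : ∫⁻ x in Ioi r, ENNReal.ofReal x ∂m ≤ ENNReal.ofReal δ) :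
    ∫ x, rootMoment R x ∂m ≤ r / R * ρ + δ := by
  have i1 := hm.integrable_id.const_mul (r / R)
  have i2 : Integrable ((Ioi r).indicator fun x : ℝ => x) m :=
    hm.integrable_id.indicator measurableSet_Ioi
  calc ∫ x, rootMoment R x ∂m
      ≤ ∫ x, (r / R * x + (Ioi r).indicator (fun x : ℝ => x) x) ∂m := by
        refine integral_mono_ae ((isProfile_rootMoment hR).integrable hm) (i1.add i2)
          (hm.ae_pos.mono fun x hx => ?_)
        obtain ⟨h1, h2⟩ := rootMoment_le hR hx
        by_cases hxr : x ∈ Ioi r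
        · simp only [indicator_of_mem hxr]
          have : 0 ≤ r / R * x := by positivity
          linarith
        · simp only [indicator_of_notMem hxr, add_zero]
          refine h2.trans ?_
          gcongr
          exact not_lt.1 hxr
    _ = r / R * ρ + ∫ x in Ioi r, x ∂m := by
        rw [integral_add i1 i2, integral_const_mul, hm.integral_id hρ,
          integral_indicator measurableSet_Ioi]
    _ ≤ r / R * ρ + δ := by
        gcongr
        rw [integral_eq_lintegral_of_nonneg_ae (ae_restrict_of_ae
          (hm.ae_pos.mono fun x hx => hx.le)) measurable_id.aestronglyMeasurable]
        exact ENNReal.toReal_le_of_le_ofReal hδ h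

end rootMoment

theorem IsFlow.lintegral_Ioi_le (hα₀ : 0 ≤ α) (hα₁ : α ≤ 1) (hρ : 0 ≤ ρ)
    (h : IsFlow α γ q ρ T ν u) {D r R δ : ℝ} (hD0 : 0 ≤ D)
    (hD : ∫⁻ t in Icc 0 T, dissipation α γ q (ν t) (u t) ≤ ENNReal.ofReal D) (hr : 0 ≤ r)
    (hR : 0 < R) (hδ : 0 ≤ δ) (h0 : ∫⁻ x in Ioi r, ENNReal.ofReal x ∂(ν 0) ≤ ENNReal.ofReal δ)
    {t : ℝ} (ht : t ∈ Icc 0 T) :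
    ∫⁻ x in Ioi R, ENNReal.ofReal x ∂(ν t)
      ≤ ENNReal.ofReal (3 * (r / R * ρ + δ + R ^ ((α - 1) / 2) * (ρ * T + D))) := by
  have hm0 : (0 : ℝ) ∈ Icc 0 T := ⟨le_rfl, ht.1.trans ht.2⟩
  refine (lintegral_Ioi_le_rootMoment hR (h.state t ht)).trans (ENNReal.ofReal_le_ofReal ?_)
  -- The choice σ = R^((α-1)/2) equalizes the two error terms, since B = R^(α-1).
  have hσ : 0 < R ^ ((α - 1) / 2) := Real.rpow_pos_of_pos hR _
  have h1 := h.abs_integral_sub_le hα₀ hα₁ hρ (isProfile_rootMoment hR) hσ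
    (root_density_sq_le hα₀ hα₁ hR) hD0 hD hm0 ht
  have h2 := integral_rootMoment_le hR hρ hr (h.state 0 hm0) hδ h0
  have h3 : (R ^ ((α - 1) / 2))⁻¹ * R ^ (α - 1) = R ^ ((α - 1) / 2) := by
    rw [← Real.rpow_neg hR.le, ← Real.rpow_add hR]
    congr 1
    ring
  rw [h3, sub_zero, abs_of_nonneg ht.1] at h1
  have h4 := (le_abs_self _).trans h1
  have h5 : R ^ ((α - 1) / 2) * ρ * t ≤ R ^ ((α - 1) / 2) * ρ * T := by gcongr; exact ht.2
  nlinarith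

/-- Below a one has x = x^γ x^(1-γ) ≤ a^γ x^(1-γ), so bounded energy keeps the mass away from zero.
-/
theorem lintegral_Iio_le (hγ₀ : 0 < γ) (hγ₁ : γ < 1) (hq : 0 < q) {m : Measure ℝ}
    (hm : IsState ρ m) {E a : ℝ} (ha : 0 < a) (hE : energy γ q m ≤ ENNReal.ofReal E) :
    ∫⁻ x in Iio a, ENNReal.ofReal x ∂m ≤ ENNReal.ofReal (a ^ γ * ((1 - γ) / q * E)) := by
  have hc : 0 < q / (1 - γ) := div_pos hq (by linarith)
  have hI : ∫⁻ x, ENNReal.ofReal (x ^ (1 - γ)) ∂m ≤ ENNReal.ofReal ((1 - γ) / q * E) := by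
    rw [ENNReal.ofReal_mul (by rw [← inv_div]; positivity), ← inv_div,
      ENNReal.ofReal_inv_of_pos hc, mul_comm, ← div_eq_mul_inv,
      ENNReal.le_div_iff_mul_le (Or.inl (by simpa using hc)) (Or.inl ENNReal.ofReal_ne_top), mul_comm]
    exact hE
  rw [ENNReal.ofReal_mul (by positivity)]
  calc ∫⁻ x in Iio a, ENNReal.ofReal x ∂m
      ≤ ∫⁻ x in Iio a, ENNReal.ofReal (a ^ γ) * ENNReal.ofReal (x ^ (1 - γ)) ∂m := by
        refine lintegral_mono_ae ?_
        filter_upwards [ae_restrict_of_ae hm.ae_pos, ae_restrict_mem measurableSet_Iio]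
          with x hx hxa
        rw [← ENNReal.ofReal_mul (by positivity)]
        refine ENNReal.ofReal_le_ofReal ?_
        calc x = x ^ γ * x ^ (1 - γ) := by rw [← Real.rpow_add hx]; simp
          _ ≤ a ^ γ * x ^ (1 - γ) := by gcongr; exact le_of_lt hxa
    _ ≤ ENNReal.ofReal (a ^ γ) * ∫⁻ x, ENNReal.ofReal (x ^ (1 - γ)) ∂m := by
        rw [lintegral_const_mul' _ _ ENNReal.ofReal_ne_top]
        gcongr
        exact Measure.restrict_le_self
    _ ≤ _ := by gcongr

end LSW

namespace LSW

variable {α γ q ρ T E v : ℝ}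

/-! ### Uniform estimates for families of balanced flows -/

/-- The standing assumptions on the parameters. -/
structure IsAdmissible (α γ q ρ T : ℝ) : Prop where
  α_nonneg : 0 ≤ α
  α_lt_one : α < 1
  γ_pos : 0 < γ
  γ_lt_one : γ < 1
  q_pos : 0 < q
  ρ_pos : 0 < ρ
  T_pos : 0 < T

/-- A family of balanced flows with bounded energies and tight initial data. -/
structure IsTightFamily {ι : Type*} (α γ q ρ T E : ℝ) (ν : ι → ℝ → Measure ℝ) (u : ι → ℝ → ℝ) :
    Prop where
  flow : ∀ n, IsBalancedFlow α γ q ρ T (ν n) (u n)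
  energy_nonneg : 0 ≤ E
  energy_le : ∀ n, energy γ q (ν n 0) ≤ ENNReal.ofReal E
  tight : ∀ δ > 0, ∃ r ≥ 0, ∀ n, ∫⁻ x in Ioi r, ENNReal.ofReal x ∂(ν n 0) ≤ ENNReal.ofReal δ

namespace IsTightFamily

variable {ι : Type*} {ν : ι → ℝ → Measure ℝ} {u : ι → ℝ → ℝ}

theorem dissipation_le (hp : IsAdmissible α γ q ρ T) (h : IsTightFamily α γ q ρ T E ν u) (n : ι) :
    ∫⁻ t in Icc 0 T, dissipation α γ q (ν n t) (u n t) ≤ ENNReal.ofReal E :=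
  ((h.flow n).dissipation_le hp.α_nonneg hp.α_lt_one.le hp.γ_pos hp.γ_lt_one hp.q_pos
    hp.ρ_pos.le hp.T_pos).trans (h.energy_le n)

/-- The mass is uniformly concentrated on compact subsets of `(0, ∞)`. -/
theorem exists_tail_le (hp : IsAdmissible α γ q ρ T) (h : IsTightFamily α γ q ρ T E ν u) {ε : ℝ}
    (hε : 0 < ε) : ∃ a > 0, ∃ b, ∀ n, ∀ t ∈ Icc 0 T,
      ∫⁻ x in (Icc a b)ᶜ, ENNReal.ofReal x ∂(ν n t) ≤ ENNReal.ofReal ε := by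
  -- The factor 3 in `IsFlow.lintegral_Ioi_le` turns ε / 12 into ε / 4, strictly below the ε / 2
  -- allotted to the tail at infinity.
  obtain ⟨r, hr, htail⟩ := h.tight (ε / 12) (by positivity)
  have hlim : Tendsto (fun R : ℝ => 3 * (r / R * ρ + ε / 12 + R ^ ((α - 1) / 2) * (ρ * T + E)))
      atTop (𝓝 (3 * (0 * ρ + ε / 12 + 0 * (ρ * T + E)))) := by
    have h1 : Tendsto (fun R : ℝ => r / R) atTop (𝓝 0) := tendsto_const_nhds.div_atTop tendsto_id
    have h2 : Tendsto (fun R : ℝ => R ^ ((α - 1) / 2)) atTop (𝓝 0) := by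
      have := tendsto_rpow_neg_atTop (y := (1 - α) / 2) (by linarith [hp.α_lt_one])
      rwa [show -((1 - α) / 2) = (α - 1) / 2 by ring] at this
    exact (((h1.mul_const ρ).add_const _).add (h2.mul_const _)).const_mul 3
  obtain ⟨b, hbR, hb0⟩ := ((hlim.eventually_le_const (u := ε / 2) (by linarith)).and
    (eventually_gt_atTop 0)).exists
  have hlim0 : Tendsto (fun a : ℝ => a ^ γ * ((1 - γ) / q * E)) (𝓝[>] 0)
      (𝓝 (0 * ((1 - γ) / q * E))) := by
    have h1 : Tendsto (fun a : ℝ => a ^ γ) (𝓝[>] 0) (𝓝 (0 ^ γ)) :=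
      ((Real.continuous_rpow_const hp.γ_pos.le).tendsto 0).mono_left nhdsWithin_le_nhds
    rw [Real.zero_rpow hp.γ_pos.ne'] at h1
    exact h1.mul_const _
  obtain ⟨a, haR, ha0⟩ := ((hlim0.eventually_le_const (u := ε / 2) (by linarith)).and
    (self_mem_nhdsWithin)).exists
  refine ⟨a, ha0, b, fun n t ht => ?_⟩
  have hfl := h.flow n
  have hst := hfl.state t ht
  have e1 := hfl.lintegral_Ioi_le hp.α_nonneg hp.α_lt_one.le hp.ρ_pos.le h.energy_nonneg
    (h.dissipation_le hp n) hr hb0 (by positivity) (htail n) ht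
  have e2 := lintegral_Iio_le hp.γ_pos hp.γ_lt_one hp.q_pos hst ha0
    ((hfl.energy_le hp.α_nonneg hp.α_lt_one.le hp.γ_pos hp.γ_lt_one hp.q_pos hp.ρ_pos.le ht).trans
      (h.energy_le n))
  have hsub : (Icc a b)ᶜ ⊆ Iio a ∪ Ioi b := by
    intro x hx
    by_contra hn
    simp only [mem_union, mem_Iio, mem_Ioi, not_or, not_lt] at hn
    exact hx hn
  calc ∫⁻ x in (Icc a b)ᶜ, ENNReal.ofReal x ∂(ν n t)
      ≤ ∫⁻ x in Iio a ∪ Ioi b, ENNReal.ofReal x ∂(ν n t) := lintegral_mono_set hsub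
    _ ≤ ∫⁻ x in Iio a, ENNReal.ofReal x ∂(ν n t) + ∫⁻ x in Ioi b, ENNReal.ofReal x ∂(ν n t) :=
        lintegral_union_le _ _ _
    _ ≤ ENNReal.ofReal (ε / 2) + ENNReal.ofReal (ε / 2) :=
        add_le_add (e2.trans (ENNReal.ofReal_le_ofReal haR))
          (e1.trans (ENNReal.ofReal_le_ofReal hbR))
    _ = ENNReal.ofReal ε := by rw [← ENNReal.ofReal_add (by positivity) (by positivity)]; simp

/-- At least half of the mass lies in [a, b], where `cutoff J` is 1, and x^α ≥ (2 (J + 1))^(α-1) x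
on the support of `cutoff J`. This coefficient of v² in the localized dissipation stays away from
zero, so the dissipation controls the mean field. -/
theorem exists_cutoff_lower_bound (hp : IsAdmissible α γ q ρ T)
    (h : IsTightFamily α γ q ρ T E ν u) :
    ∃ J : ℕ, ∃ c > 0, ∀ n, ∀ t ∈ Icc 0 T, c ≤ ∫ x, cutoff J x * x ^ α ∂(ν n t) := by
  have hρ := hp.ρ_pos
  obtain ⟨a, ha, b, hab⟩ := h.exists_tail_le hp (ε := ρ / 2) (by positivity)
  obtain ⟨J, hJ⟩ := exists_nat_ge (max (2 / a) b)
  have hJa : 2 ≤ (J + 1) * a := by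
    have := (le_max_left _ _).trans hJ
    rw [div_le_iff₀ ha] at this
    linarith
  have hJb : b ≤ J + 1 := by linarith [(le_max_right (2 / a) b).trans hJ]
  have hJ0 : (0 : ℝ) < 2 * (J + 1) := by positivity
  have hc0 : (0 : ℝ) < (2 * (J + 1)) ^ (α - 1) := Real.rpow_pos_of_pos hJ0 _
  refine ⟨J, (2 * (J + 1)) ^ (α - 1) * (ρ / 2), by positivity, fun n t ht => ?_⟩
  have hst := (h.flow n).state t ht
  have hcx : Integrable (fun x => cutoff J x * x) (ν n t) :=
    ((cutoff_isTestFun J).mul continuousOn_id).integrable hst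
  have hmass : ρ / 2 ≤ ∫ x, cutoff J x * x ∂(ν n t) := by
    have hind : Integrable ((Icc a b)ᶜ.indicator fun x : ℝ => x) (ν n t) :=
      hst.integrable_id.indicator measurableSet_Icc.compl
    have h1 : ∫ x, x ∂(ν n t)
        ≤ ∫ x, (cutoff J x * x + (Icc a b)ᶜ.indicator (fun x : ℝ => x) x) ∂(ν n t) := by
      refine integral_mono_ae hst.integrable_id (hcx.add hind) (hst.ae_pos.mono fun x hx => ?_)
      by_cases hxm : x ∈ Icc a b
      · have : cutoff J x = 1 := cutoff_eq_one (hJa.trans (by gcongr; exact hxm.1))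
          (hxm.2.trans hJb)
        simp [this, hxm]
      · simp only [indicator_of_mem (mem_compl hxm)]
        have := mul_nonneg (cutoff_nonneg J x) hx.le
        linarith
    rw [integral_add hcx hind, integral_indicator measurableSet_Icc.compl,
      hst.integral_id hρ.le, integral_eq_lintegral_of_nonneg_ae (ae_restrict_of_ae
          (hst.ae_pos.mono fun x hx => hx.le)) measurable_id.aestronglyMeasurable] at h1
    have h2 := ENNReal.toReal_le_of_le_ofReal (by positivity) (hab n t ht)
    linarith
  calc (2 * (J + 1)) ^ (α - 1) * (ρ / 2)
      ≤ (2 * (J + 1)) ^ (α - 1) * ∫ x, cutoff J x * x ∂(ν n t) := by gcongr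
    _ = ∫ x, (2 * (J + 1)) ^ (α - 1) * (cutoff J x * x) ∂(ν n t) := (integral_const_mul _ _).symm
    _ ≤ ∫ x, cutoff J x * x ^ α ∂(ν n t) := by
        refine integral_mono_ae (hcx.const_mul _)
          (((cutoff_isTestFun J).mul_rpow α).integrable hst) (hst.ae_pos.mono fun x hx => ?_)
        by_cases hz : cutoff J x = 0
        · simp [hz]
        · have h1 : (2 * ((J : ℝ) + 1)) ^ (α - 1) ≤ x ^ (α - 1) :=
            Real.rpow_le_rpow_of_nonpos hx (cutoff_ne_zero hz).2 (by linarith [hp.α_lt_one])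
          have h2 : x ^ α = x ^ (α - 1) * x := by
            rw [Real.rpow_sub_one hx.ne']; field_simp
          have h3 := mul_nonneg (cutoff_nonneg J x) hx.le
          simp only
          rw [h2]
          nlinarith

theorem sq_mul_le_cutDissipation {m : Measure ℝ} (hm : IsState ρ m) (j : ℕ) :
    v ^ 2 * (∫ x, cutoff j x * x ^ α ∂m) ≤ 2 * cutDissipation α γ q j m v
      + 2 * q ^ 2 * ∫ x, cutoff j x * x ^ (α - 2 * γ) ∂m := by
  -- With p = q x^(-γ), the identity 2 (v - p)² + 2 p² - v² = (v - 2 p)² reduces the claim to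
  -- nonnegativity of the localized dissipation for 2 * q.
  have h0 : 0 ≤ cutDissipation α γ (2 * q) j m v := by
    rw [(cutDissipation_eq hm j).2]
    exact integral_nonneg_of_ae (hm.ae_pos.mono fun x hx =>
      mul_nonneg (cutoff_nonneg j x) (dissipation_integrand_nonneg hx))
  simp only [cutDissipation] at h0 ⊢
  linarith

/-- The mean fields are bounded in `L²(0, T)`. -/
theorem exists_sq_bound (hp : IsAdmissible α γ q ρ T) (h : IsTightFamily α γ q ρ T E ν u) :
    ∃ K ≥ 0, ∀ n, ∫⁻ t in Icc 0 T, ENNReal.ofReal (u n t ^ 2) ≤ ENNReal.ofReal K := by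
  obtain ⟨J, c, hc, hJ⟩ := h.exists_cutoff_lower_bound hp
  obtain ⟨C, hC0, hC⟩ := ((cutoff_isTestFun J).mul_rpow (α - 2 * γ)).exists_bound
  have hE := h.energy_nonneg
  have hρ := hp.ρ_pos
  have hT := hp.T_pos
  refine ⟨(2 / c) * E + (2 * q ^ 2 * (C * ρ) / c) * T, by positivity, fun n => ?_⟩
  have hfl := h.flow n
  have hmeas := (hfl.aemeasurable_dissipation (α := α) (γ := γ) (q := q) hfl.aemeasurable)
  calc ∫⁻ t in Icc 0 T, ENNReal.ofReal (u n t ^ 2)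
      ≤ ∫⁻ t in Icc 0 T, (ENNReal.ofReal (2 / c) * dissipation α γ q (ν n t) (u n t)
          + ENNReal.ofReal (2 * q ^ 2 * (C * ρ) / c)) := by
        refine lintegral_mono_ae ?_
        filter_upwards [ae_restrict_mem measurableSet_Icc] with t ht
        have hst := hfl.state t ht
        have h1 := sq_mul_le_cutDissipation (α := α) (γ := γ) (q := q) (v := u n t) hst J
        have h2 := hJ n t ht
        have h3 := (le_abs_self _).trans (hst.abs_integral_le hρ.le hC)
        have h0 : 0 ≤ cutDissipation α γ q J (ν n t) (u n t) := by
          rw [(cutDissipation_eq hst J).2]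
          exact integral_nonneg_of_ae (hst.ae_pos.mono fun x hx =>
            mul_nonneg (cutoff_nonneg J x) (dissipation_integrand_nonneg hx))
        have h4 : u n t ^ 2 ≤ 2 / c * cutDissipation α γ q J (ν n t) (u n t)
            + 2 * q ^ 2 * (C * ρ) / c := by
          have h5 : u n t ^ 2 * c ≤ 2 * cutDissipation α γ q J (ν n t) (u n t)
              + 2 * q ^ 2 * (C * ρ) :=
            calc u n t ^ 2 * c ≤ u n t ^ 2 * ∫ x, cutoff J x * x ^ α ∂(ν n t) := by gcongr
              _ ≤ _ := h1
              _ ≤ _ := by gcongr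
          rw [div_mul_eq_mul_div, ← add_div, le_div_iff₀ hc]
          exact h5
        refine (ENNReal.ofReal_le_ofReal h4).trans ?_
        rw [ENNReal.ofReal_add (by positivity) (by positivity), ENNReal.ofReal_mul (by positivity)]
        gcongr
        exact cutDissipation_le hst J
    _ = ENNReal.ofReal (2 / c) * (∫⁻ t in Icc 0 T, dissipation α γ q (ν n t) (u n t))
          + ENNReal.ofReal (2 * q ^ 2 * (C * ρ) / c) * ENNReal.ofReal T := by
        rw [lintegral_add_right _ measurable_const, lintegral_const_mul'' _ hmeas,
          setLIntegral_const, Real.volume_Icc, sub_zero]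
    _ ≤ ENNReal.ofReal (2 / c) * ENNReal.ofReal E
          + ENNReal.ofReal (2 * q ^ 2 * (C * ρ) / c) * ENNReal.ofReal T := by
        gcongr
        exact h.dissipation_le hp n
    _ = _ := by
        rw [← ENNReal.ofReal_mul (by positivity), ← ENNReal.ofReal_mul (by positivity),
          ENNReal.ofReal_add (by positivity) (by positivity)]

/-- Integrals of test functions are equicontinuous in time. -/
theorem equicontinuous (hp : IsAdmissible α γ q ρ T) (h : IsTightFamily α γ q ρ T E ν u)
    {ζ : ℝ → ℝ} (hζ : IsTestFun ζ) {ε : ℝ} (hε : 0 < ε) :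
    ∃ δ > 0, ∀ n, ∀ s ∈ Icc 0 T, ∀ t ∈ Icc 0 T, |t - s| < δ →
      |∫ x, ζ x ∂(ν n t) - ∫ x, ζ x ∂(ν n s)| ≤ ε := by
  have hρ := hp.ρ_pos
  have hE := h.energy_nonneg
  -- Four errors of size ε / 4: the smooth approximation at the times s and t, the dissipation term
  -- σ E, and the term Lipschitz in time.
  obtain ⟨g, hg, hgs, happ⟩ := hζ.exists_smooth_approx (ε := ε / (4 * ρ)) (by positivity)
  obtain ⟨C, hC⟩ := hg.isProfile hgs
  set σ : ℝ := ε / (4 * (E + 1)) with hσ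
  have hσ0 : 0 < σ := by positivity
  set M : ℝ := σ⁻¹ * C ^ 2 * ρ with hM
  have hM0 : 0 ≤ M := by positivity
  refine ⟨ε / (4 * (M + 1)), by positivity, fun n s hs t ht hst => ?_⟩
  have hfl := h.flow n
  have h1 := hfl.abs_integral_sub_le hp.α_nonneg hp.α_lt_one.le hρ.le hC hσ0
    (hC.fluxBound.sq_mul_rpow_le hp.α_nonneg hp.α_lt_one.le) hE (h.dissipation_le hp n) hs ht
  have h2 := (hfl.state t ht).abs_integral_sub_le hρ.le hζ hg happ
  have h3 := (hfl.state s hs).abs_integral_sub_le hρ.le hζ hg happ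
  have e1 : ε / (4 * ρ) * ρ = ε / 4 := by field_simp
  have e2 : σ * E ≤ ε / 4 := by
    rw [hσ, div_mul_eq_mul_div, div_le_div_iff₀ (by positivity) (by norm_num)]
    nlinarith
  have e3 : M * |t - s| ≤ ε / 4 := by
    calc M * |t - s| ≤ (M + 1) * (ε / (4 * (M + 1))) := by gcongr; linarith
      _ = ε / 4 := by field_simp
  rw [e1] at h2 h3
  rw [abs_le] at *
  constructor <;> linarith [h1.1, h1.2, h2.1, h2.2, h3.1, h3.2]

end IsTightFamily

end LSW

namespace LSW

/-! ### Weak compactness in `L²` -/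

theorem memLp_two_of_lintegral_le {X : Type*} [MeasurableSpace X] {μ : Measure X} {f : X → ℝ}
    {K : ℝ} (hf : AEMeasurable f μ) (hK : ∫⁻ x, ENNReal.ofReal (f x ^ 2) ∂μ ≤ ENNReal.ofReal K) :
    MemLp f 2 μ := by
  rw [memLp_two_iff_integrable_sq hf.aestronglyMeasurable]
  refine ⟨(hf.pow_const 2).aestronglyMeasurable, ?_⟩
  rw [hasFiniteIntegral_iff_ofReal (ae_of_all _ fun x => sq_nonneg _)]
  exact hK.trans_lt ENNReal.ofReal_lt_top

theorem integral_sq_le_of_lintegral_le {X : Type*} [MeasurableSpace X] {μ : Measure X} {f : X → ℝ}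
    {K : ℝ} (hK0 : 0 ≤ K) (hf : AEMeasurable f μ)
    (hK : ∫⁻ x, ENNReal.ofReal (f x ^ 2) ∂μ ≤ ENNReal.ofReal K) : ∫ x, f x ^ 2 ∂μ ≤ K := by
  rw [integral_eq_lintegral_of_nonneg_ae (ae_of_all _ fun x => sq_nonneg _)
    (hf.pow_const 2).aestronglyMeasurable]
  exact ENNReal.toReal_le_of_le_ofReal hK0 hK

/-- Bounded sequences in `L²` have weakly convergent subsequences. -/
theorem exists_weak_limit {μ : Measure ℝ} [SigmaFinite μ] {u : ℕ → ℝ → ℝ} {K : ℝ}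
    (hK0 : 0 ≤ K) (hu : ∀ n, AEMeasurable (u n) μ)
    (hK : ∀ n, ∫⁻ t, ENNReal.ofReal (u n t ^ 2) ∂μ ≤ ENNReal.ofReal K) :
    ∃ φ : ℕ → ℕ, StrictMono φ ∧ ∃ v : ℝ → ℝ, Measurable v ∧ MemLp v 2 μ ∧
      ∀ p, MemLp p 2 μ →
        Tendsto (fun n => ∫ t, u (φ n) t * p t ∂μ) atTop (𝓝 (∫ t, v t * p t ∂μ)) := by
  have hmem := fun n => memLp_two_of_lintegral_le (hu n) (hK n)
  -- A finite exponent makes the space separable, so that closed balls of the dual are weak*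
  -- sequentially compact; the Riesz isometry carries this over to L².
  have : Fact ((2 : ℝ≥0∞) ≠ ⊤) := ⟨by simp⟩
  set U : ℕ → Lp ℝ 2 μ := fun n => (hmem n).toLp with hU
  have hinner : ∀ (f g : ℝ → ℝ) (hf : MemLp f 2 μ) (hg : MemLp g 2 μ),
      inner ℝ hf.toLp hg.toLp = ∫ t, f t * g t ∂μ := by
    intro f g hf hg
    rw [L2.inner_def]
    refine integral_congr_ae ?_
    filter_upwards [hf.coeFn_toLp, hg.coeFn_toLp] with t h1 h2
    rw [h1, h2]
    simp [mul_comm]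
  have hnorm : ∀ n, ‖U n‖ ≤ √K := by
    intro n
    refine Real.le_sqrt_of_sq_le ?_
    rw [← real_inner_self_eq_norm_sq, hinner]
    simpa only [sq] using integral_sq_le_of_lintegral_le hK0 (hu n) (hK n)
  let ℓ : ℕ → WeakDual ℝ (Lp ℝ 2 μ) := fun n =>
    StrongDual.toWeakDual (InnerProductSpace.toDual ℝ (Lp ℝ 2 μ) (U n))
  have hball : ∀ n, ℓ n ∈ WeakDual.toStrongDual ⁻¹' Metric.closedBall 0 (√K) := by
    intro n
    simp only [mem_preimage, Metric.mem_closedBall, dist_zero_right]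
    change ‖InnerProductSpace.toDual ℝ (Lp ℝ 2 μ) (U n)‖ ≤ √K
    rw [LinearIsometryEquiv.norm_map]
    exact hnorm n
  obtain ⟨m, -, φ, hφ, hlim⟩ := WeakDual.isSeqCompact_closedBall ℝ (Lp ℝ 2 μ) 0 (√K) hball
  set V : Lp ℝ 2 μ := (InnerProductSpace.toDual ℝ (Lp ℝ 2 μ)).symm (WeakDual.toStrongDual m)
    with hV
  have hVm := Lp.memLp V
  refine ⟨φ, hφ, hVm.aestronglyMeasurable.aemeasurable.mk V,
    hVm.aestronglyMeasurable.aemeasurable.measurable_mk,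
    hVm.ae_eq hVm.aestronglyMeasurable.aemeasurable.ae_eq_mk, fun p hp => ?_⟩
  have h1 := ((WeakDual.eval_continuous (hp.toLp)).tendsto m).comp hlim
  have e1 : ∀ n, ℓ n hp.toLp = ∫ t, u n t * p t ∂μ := fun n => by
    rw [← hinner _ _ (hmem n) hp]
    rfl
  have e2 : m hp.toLp = ∫ t, hVm.aestronglyMeasurable.aemeasurable.mk V t * p t ∂μ := by
    have : m hp.toLp = inner ℝ V hp.toLp := by
      rw [hV, InnerProductSpace.toDual_symm_apply]
      rfl
    rw [this, L2.inner_def]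
    refine integral_congr_ae ?_
    filter_upwards [hp.coeFn_toLp, hVm.aestronglyMeasurable.aemeasurable.ae_eq_mk] with t h1 h2
    rw [h1, ← h2]
    simp [mul_comm]
  rw [← e2]
  refine h1.congr fun n => ?_
  exact e1 (φ n)

/-- Products of weakly convergent and dominated almost everywhere convergent sequences converge. -/
theorem tendsto_integral_mul_of_weak {μ : Measure ℝ} {u : ℕ → ℝ → ℝ}
    {v : ℝ → ℝ} {K : ℝ} (hK0 : 0 ≤ K) (hu : ∀ n, AEMeasurable (u n) μ)
    (hK : ∀ n, ∫⁻ t, ENNReal.ofReal (u n t ^ 2) ∂μ ≤ ENNReal.ofReal K)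
    (hw : ∀ p, MemLp p 2 μ → Tendsto (fun n => ∫ t, u n t * p t ∂μ) atTop (𝓝 (∫ t, v t * p t ∂μ)))
    {p : ℕ → ℝ → ℝ} {p' G : ℝ → ℝ} (hp : ∀ n, AEMeasurable (p n) μ)
    (hG : MemLp G 2 μ) (hC : ∀ n, ∀ᵐ t ∂μ, |p n t| ≤ G t)
    (hlim : ∀ᵐ t ∂μ, Tendsto (fun n => p n t) atTop (𝓝 (p' t))) :
    Tendsto (fun n => ∫ t, u n t * p n t ∂μ) atTop (𝓝 (∫ t, v t * p' t ∂μ)) := by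
  have hp' : AEMeasurable p' μ := aemeasurable_of_tendsto_metrizable_ae atTop hp hlim
  have hC' : ∀ᵐ t ∂μ, |p' t| ≤ G t := by
    filter_upwards [hlim, ae_all_iff.2 hC] with t ht hb
    exact le_of_tendsto ht.abs (Eventually.of_forall hb)
  have hpm := fun n => hG.mono' (hp n).aestronglyMeasurable (hC n)
  have hpm' := hG.mono' hp'.aestronglyMeasurable hC'
  have hum := fun n => memLp_two_of_lintegral_le (hu n) (hK n)
  have hsq : Tendsto (fun n => ∫ t, (p n t - p' t) ^ 2 ∂μ) atTop (𝓝 0) := by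
    have : Tendsto (fun n => ∫ t, (p n t - p' t) ^ 2 ∂μ) atTop (𝓝 (∫ _, (0 : ℝ) ∂μ)) := by
      refine tendsto_integral_of_dominated_convergence (fun t => 2 ^ 2 * G t ^ 2)
        (fun n => (((hp n).sub hp').pow_const 2).aestronglyMeasurable) (hG.integrable_sq.const_mul _)
        (fun n => ?_) ?_
      · filter_upwards [hC n, hC'] with t h1 h2
        rw [Real.norm_eq_abs, abs_pow, ← mul_pow]
        gcongr
        exact (abs_sub _ _).trans (by linarith)
      · filter_upwards [hlim] with t ht
        simpa using (ht.sub_const (p' t)).pow 2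
    simpa using this
  have hdiff : Tendsto (fun n => ∫ t, u n t * (p n t - p' t) ∂μ) atTop (𝓝 0) := by
    rw [Metric.tendsto_atTop]
    intro ε hε
    -- Young's inequality |u| |p - p'| ≤ σ u² + σ⁻¹ (p - p')²: this σ makes the first term at most ε
    -- / 2, and the strong L² convergence of p n then handles the second.
    set σ : ℝ := ε / (2 * (K + 1)) with hσ
    have hσ0 : 0 < σ := by positivity
    obtain ⟨N, hN⟩ := Metric.tendsto_atTop.1 hsq (σ * (ε / 2)) (by positivity)
    refine ⟨N, fun n hn => ?_⟩
    have i1 := (hum n).integrable_sq.const_mul σ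
    have i2 := ((hpm n).sub hpm').integrable_sq.const_mul σ⁻¹
    have hb := norm_integral_le_of_norm_le (f := fun t => u n t * (p n t - p' t)) (i1.add i2)
      (ae_of_all _ fun t => by
        have h2 : 0 ≤ σ⁻¹ * (σ * |u n t| - |p n t - p' t|) ^ 2 := by positivity
        have h3 : σ⁻¹ * (σ * |u n t| - |p n t - p' t|) ^ 2
            = σ * |u n t| ^ 2 - 2 * (|u n t| * |p n t - p' t|) + σ⁻¹ * |p n t - p' t| ^ 2 := by
          field_simp
          ring
        have h4 : 0 ≤ |u n t| * |p n t - p' t| := by positivity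
        simp only [Pi.add_apply, Pi.sub_apply, Real.norm_eq_abs, abs_mul]
        rw [← sq_abs (u n t), ← sq_abs (p n t - p' t)]
        linarith)
    simp only [Pi.add_apply, Pi.sub_apply] at hb
    have i2' : Integrable (fun t => σ⁻¹ * (p n t - p' t) ^ 2) μ := i2
    rw [integral_add i1 i2', integral_const_mul, integral_const_mul] at hb
    have h1 := integral_sq_le_of_lintegral_le hK0 (hu n) (hK n)
    have h2 := hN n hn
    rw [Real.dist_eq, sub_zero] at h2
    have h3 := (le_abs_self _).trans_lt h2
    rw [Real.dist_eq, sub_zero]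
    have h4 : σ * ∫ t, u n t ^ 2 ∂μ ≤ ε / 2 := by
      calc σ * ∫ t, u n t ^ 2 ∂μ ≤ σ * (K + 1) := by gcongr; linarith
        _ = ε / 2 := by rw [hσ]; field_simp
    have h5 : σ⁻¹ * ∫ t, (p n t - p' t) ^ 2 ∂μ < ε / 2 := by
      calc σ⁻¹ * ∫ t, (p n t - p' t) ^ 2 ∂μ < σ⁻¹ * (σ * (ε / 2)) := by gcongr
        _ = ε / 2 := by field_simp
    exact hb.trans_lt (by linarith)
  have := (hw p' hpm').add hdiff
  rw [add_zero] at this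
  refine this.congr fun n => ?_
  have j1 : Integrable (fun t => u n t * p' t) μ := (hum n).integrable_mul hpm'
  have j2 : Integrable (fun t => u n t * (p n t - p' t)) μ :=
    (hum n).integrable_mul ((hpm n).sub hpm')
  rw [← integral_add j1 j2]
  congr 1
  ext t
  ring

end LSW

/-! ### Compactness of the curves through normalized mass distributions. -/

namespace LSW

open scoped NNReal BoundedContinuousFunction

variable {α γ q ρ T E : ℝ}

/-! ### States and probability measures -/

/-- The normalized mass distribution of a state. -/
noncomputable def massDistribution (ρ : ℝ) (m : Measure ℝ) : Measure ℝ :=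
  (ENNReal.ofReal ρ)⁻¹ • m.withDensity fun x => ENNReal.ofReal x

/-- The measure with a prescribed normalized mass distribution. -/
noncomputable def ofMassDistribution (ρ : ℝ) (P : Measure ℝ) : Measure ℝ :=
  ENNReal.ofReal ρ • P.withDensity fun x => ENNReal.ofReal x⁻¹

theorem IsState.isProbabilityMeasure (hρ : 0 < ρ) {m : Measure ℝ} (hm : IsState ρ m) :
    IsProbabilityMeasure (massDistribution ρ m) := by
  constructor
  rw [massDistribution, Measure.smul_apply, withDensity_apply _ MeasurableSet.univ,
    Measure.restrict_univ, hm.2, smul_eq_mul,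
    ENNReal.inv_mul_cancel (by simpa using hρ) ENNReal.ofReal_ne_top]

theorem IsState.integral_massDistribution (hρ : 0 < ρ) {m : Measure ℝ} (hm : IsState ρ m)
    (f : ℝ → ℝ) : ∫ x, f x ∂(massDistribution ρ m) = ρ⁻¹ * ∫ x, x * f x ∂m := by
  rw [massDistribution, integral_smul_measure, integral_withDensity_eq_integral_toReal_smul
    (by fun_prop) (ae_of_all _ fun x => ENNReal.ofReal_lt_top), ENNReal.toReal_inv,
    ENNReal.toReal_ofReal hρ.le, smul_eq_mul]
  congr 1
  refine integral_congr_ae (hm.ae_pos.mono fun x hx => ?_)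
  simp only [ENNReal.toReal_ofReal hx.le, smul_eq_mul]

theorem integral_ofMassDistribution (hρ : 0 < ρ) {P : Measure ℝ} (hP : P (Iic 0) = 0)
    (f : ℝ → ℝ) : ∫ x, f x ∂(ofMassDistribution ρ P) = ρ * ∫ x, x⁻¹ * f x ∂P := by
  rw [ofMassDistribution, integral_smul_measure, integral_withDensity_eq_integral_toReal_smul
    (by fun_prop) (ae_of_all _ fun x => ENNReal.ofReal_lt_top),
    ENNReal.toReal_ofReal hρ.le, smul_eq_mul]
  congr 1
  refine integral_congr_ae ((ae_pos_of_measure_Iic hP).mono fun x hx => ?_)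
  simp only [ENNReal.toReal_ofReal (inv_pos.2 hx).le, smul_eq_mul]

theorem isState_ofMassDistribution {P : Measure ℝ} [IsProbabilityMeasure P]
    (hP : P (Iic 0) = 0) : IsState ρ (ofMassDistribution ρ P) := by
  constructor
  · rw [ofMassDistribution, Measure.smul_apply, withDensity_apply _ measurableSet_Iic,
      Measure.restrict_eq_zero.2 hP]
    simp
  · rw [ofMassDistribution, lintegral_smul_measure,
      lintegral_withDensity_eq_lintegral_mul _ (by fun_prop) (by fun_prop)]
    have : ∫⁻ x, ((fun x : ℝ => ENNReal.ofReal x⁻¹) * fun x => ENNReal.ofReal x) x ∂P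
        = ∫⁻ _, 1 ∂P := by
      refine lintegral_congr_ae ((ae_pos_of_measure_Iic hP).mono fun x hx => ?_)
      simp only [Pi.mul_apply]
      rw [← ENNReal.ofReal_mul (inv_pos.2 hx).le, inv_mul_cancel₀ hx.ne', ENNReal.ofReal_one]
    rw [this]
    simp

/-- Division of a test function by the identity, as a bounded continuous function. -/
noncomputable def IsTestFun.divId {ζ : ℝ → ℝ} (h : IsTestFun ζ) : ℝ →ᵇ ℝ :=
  BoundedContinuousFunction.ofNormedAddCommGroup (fun x => ζ x * x⁻¹)
    (h.mul (continuousOn_inv₀.mono fun _ hx => ne_of_gt hx)).1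
    (Classical.choose ((h.mul (continuousOn_inv₀.mono
      fun _ hx => ne_of_gt hx)).2.1.exists_bound_of_continuous
        (h.mul (continuousOn_inv₀.mono fun _ hx => ne_of_gt hx)).1))
    (Classical.choose_spec ((h.mul (continuousOn_inv₀.mono
      fun _ hx => ne_of_gt hx)).2.1.exists_bound_of_continuous
        (h.mul (continuousOn_inv₀.mono fun _ hx => ne_of_gt hx)).1))

theorem IsTestFun.mul_divId {ζ : ℝ → ℝ} (h : IsTestFun ζ) (x : ℝ) : x * h.divId x = ζ x := by
  change x * (ζ x * x⁻¹) = ζ x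
  rcases eq_or_ne x 0 with rfl | hx
  · have : ζ 0 = 0 := by
      by_contra h0
      exact lt_irrefl (0 : ℝ) (h.2.2 (subset_tsupport ζ h0))
    simp [this]
  · field_simp

/-- Finite measures on `(0, ∞)` are determined by the integrals of `ζ x / x`. -/
theorem probabilityMeasure_eq_of_integral_divId_eq {P Q : ProbabilityMeasure ℝ}
    (hP : (P : Measure ℝ) (Iic 0) = 0) (hQ : (Q : Measure ℝ) (Iic 0) = 0)
    (h : ∀ ζ (hζ : IsTestFun ζ), ∫ x, hζ.divId x ∂(P : Measure ℝ)
      = ∫ x, hζ.divId x ∂(Q : Measure ℝ)) : P = Q := by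
  have hint : ∀ (P : ProbabilityMeasure ℝ) (ζ : ℝ → ℝ), IsTestFun ζ → Integrable ζ (P : Measure ℝ) :=
    fun P ζ hζ => hζ.1.integrable_of_hasCompactSupport hζ.2.1
  refine Subtype.ext (measure_eq_of_integral_eq hP hQ (hint P) (hint Q) fun ζ hζ => ?_)
  have hx : IsTestFun fun x => ζ x * x := hζ.mul continuousOn_id
  have e : ∀ P : ProbabilityMeasure ℝ, (P : Measure ℝ) (Iic 0) = 0 →
      ∫ x, hx.divId x ∂(P : Measure ℝ) = ∫ x, ζ x ∂(P : Measure ℝ) := by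
    intro P hP
    refine integral_congr_ae ((ae_pos_of_measure_Iic hP).mono fun x hx => ?_)
    change ζ x * x * x⁻¹ = ζ x
    have : x ≠ 0 := ne_of_gt hx
    field_simp
  exact (e P hP).symm.trans ((h _ hx).trans (e Q hQ))

namespace IsTightFamily

variable {ν : ℕ → ℝ → Measure ℝ} {u : ℕ → ℝ → ℝ}

/-- Compactness of tight families: a subsequence converges at all times. -/
theorem exists_limit_curve (hp : IsAdmissible α γ q ρ T) (h : IsTightFamily α γ q ρ T E ν u) :
    ∃ φ : ℕ → ℕ, StrictMono φ ∧ ∃ μ : ℝ → Measure ℝ, IsCurve ρ T μ ∧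
      ∀ t ∈ Icc 0 T, ∀ f : ℝ →ᵇ ℝ, Tendsto (fun n => ∫ x, x * f x ∂(ν (φ n) t)) atTop
        (𝓝 (∫ x, x * f x ∂(μ t))) := by
  have hρ := hp.ρ_pos
  have hT := hp.T_pos
  -- a compact set of probability measures
  have htails : ∀ m : ℕ, ∃ a > 0, ∃ b, ∀ n, ∀ t ∈ Icc 0 T,
      ∫⁻ x in (Icc a b)ᶜ, ENNReal.ofReal x ∂(ν n t) ≤ ENNReal.ofReal (ρ * (1 / ((m : ℝ) + 1))) :=
    fun m => h.exists_tail_le hp (by positivity)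
  choose a ha b hab using htails
  set r : ℕ → ℝ≥0 := fun m => 1 / ((m : ℝ≥0) + 1) with hr
  have hr0 : Tendsto r atTop (𝓝 0) := tendsto_one_div_add_atTop_nhds_zero_nat
  set S : Set (ProbabilityMeasure ℝ) := {P | ∀ m, P (Icc (a m) (b m))ᶜ ≤ r m} with hS
  have hScomp : IsCompact S := isCompact_setOfPred_probabilityMeasure_mass_eq_compl_isCompact_le hr0
    (fun m => isCompact_Icc) (Or.inl inferInstance)
  -- The intervals start at a m > 0, so limits cannot charge (-∞, 0]: no mass is lost at size zero.
  have hSpos : ∀ P ∈ S, (P : Measure ℝ) (Iic 0) = 0 := by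
    intro P hP
    have h1 : ∀ m, P (Iic 0) ≤ r m := fun m =>
      (ProbabilityMeasure.apply_mono P (show Iic (0 : ℝ) ⊆ (Icc (a m) (b m))ᶜ from fun x hx hx' =>
        absurd (hx'.1.trans hx) (not_le.2 (ha m)))).trans (hP m)
    have h2 : P (Iic 0) = 0 := le_antisymm (ge_of_tendsto' hr0 h1) bot_le
    exact (ProbabilityMeasure.null_iff_toMeasure_null P _).1 h2
  have hst : ∀ n (t : Icc 0 T), IsState ρ (ν n t) := fun n t => (h.flow n).state t t.2
  let X : ℕ → Icc 0 T → ProbabilityMeasure ℝ := fun n t =>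
    ⟨massDistribution ρ (ν n t), (hst n t).isProbabilityMeasure hρ⟩
  have hXint : ∀ n t (f : ℝ → ℝ), ∫ x, f x ∂(X n t : Measure ℝ) = ρ⁻¹ * ∫ x, x * f x ∂(ν n t) :=
    fun n t f => (hst n t).integral_massDistribution hρ f
  have hXS : ∀ n t, X n t ∈ S := by
    intro n t m
    rw [← ENNReal.coe_le_coe, ProbabilityMeasure.ennreal_coeFn_eq_coeFn_toMeasure]
    change massDistribution ρ (ν n t) _ ≤ _
    rw [massDistribution, Measure.smul_apply, withDensity_apply _ measurableSet_Icc.compl,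
      smul_eq_mul]
    calc (ENNReal.ofReal ρ)⁻¹ * ∫⁻ x in (Icc (a m) (b m))ᶜ, ENNReal.ofReal x ∂(ν n t)
        ≤ (ENNReal.ofReal ρ)⁻¹ * ENNReal.ofReal (ρ * (1 / ((m : ℝ) + 1))) := by
          gcongr; exact hab m n t t.2
      _ = ENNReal.ofReal (1 / ((m : ℝ) + 1)) := by
          rw [ENNReal.ofReal_mul hρ.le, ← mul_assoc,
            ENNReal.inv_mul_cancel (by simpa using hρ) ENNReal.ofReal_ne_top, one_mul]
      _ ≤ r m := by
          rw [ENNReal.ofReal, ENNReal.coe_le_coe]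
          refine le_of_eq (NNReal.eq ?_)
          rw [Real.coe_toNNReal _ (by positivity)]
          simp [hr]
  -- convergence at rational times
  let τ : ℚ → Icc 0 T := fun p => projIcc 0 T hT.le p
  -- Projection onto [0, T] is nonexpansive, so projected rationals remain dense.
  have hdense : ∀ t : Icc 0 T, ∀ δ > 0, ∃ p, |(t : ℝ) - τ p| < δ := by
    intro t δ hδ
    obtain ⟨p, hp1, hp2⟩ := exists_rat_btwn (show (t : ℝ) - δ < t by linarith)
    refine ⟨p, lt_of_le_of_lt ?_ (show |(t : ℝ) - p| < δ by rw [abs_lt]; constructor <;> linarith)⟩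
    have := abs_projIcc_sub_projIcc (a := 0) (b := T) (c := t) (d := p) hT.le
    rwa [projIcc_val] at this
  -- Compactness of the countable product replaces a diagonal extraction over rational times.
  have hpi : IsCompact (Set.pi univ fun _ : ℚ => S) := isCompact_univ_pi fun _ => hScomp
  obtain ⟨z, -, φ, hφ, hz⟩ := hpi.tendsto_subseq (x := fun n p => X n (τ p))
    fun n p _ => hXS n (τ p)
  -- convergence of integrals of test functions at all times
  have hconv : ∀ ζ, IsTestFun ζ → ∀ t : Icc 0 T, ∃ L,
      Tendsto (fun n => ∫ x, ζ x ∂(ν (φ n) t)) atTop (𝓝 L) := by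
    intro ζ hζ t
    refine cauchySeq_tendsto_of_complete (Metric.cauchySeq_iff'.2 fun ε hε => ?_)
    obtain ⟨δ, hδ, hequi⟩ := h.equicontinuous hp hζ (ε := ε / 4) (by positivity)
    obtain ⟨p, hpt⟩ := hdense t δ hδ
    have hq1 : Tendsto (fun n => ∫ x, hζ.divId x ∂(X (φ n) (τ p) : Measure ℝ)) atTop
        (𝓝 (∫ x, hζ.divId x ∂(z p : Measure ℝ))) :=
      ProbabilityMeasure.tendsto_iff_forall_integral_tendsto.1 (tendsto_pi_nhds.1 hz p) hζ.divId
    have hq2 : CauchySeq fun n => ∫ x, ζ x ∂(ν (φ n) (τ p)) := by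
      have e : (fun n => ∫ x, ζ x ∂(ν (φ n) (τ p)))
          = fun n => ρ * ∫ x, hζ.divId x ∂(X (φ n) (τ p) : Measure ℝ) := by
        funext n
        rw [hXint, mul_inv_cancel_left₀ hρ.ne']
        simp_rw [hζ.mul_divId]
      rw [e]
      exact (hq1.const_mul ρ).cauchySeq
    obtain ⟨N, hN⟩ := Metric.cauchySeq_iff'.1 hq2 (ε / 4) (by positivity)
    refine ⟨N, fun n hn => ?_⟩
    have e1 := hequi (φ n) (τ p) (τ p).2 t t.2 hpt
    have e2 := hequi (φ N) (τ p) (τ p).2 t t.2 hpt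
    have e3 := hN n hn
    rw [Real.dist_eq, abs_lt] at *
    rw [abs_le] at e1 e2
    constructor <;> linarith [e1.1, e1.2, e2.1, e2.2, e3.1, e3.2]
  -- convergence of the mass distributions at all times
  have hlimit : ∀ t : Icc 0 T, ∃ P ∈ S, Tendsto (fun n => X (φ n) t) atTop (𝓝 P) := by
    intro t
    obtain ⟨P, hPS, ψ, hψ, hPlim⟩ := hScomp.tendsto_subseq (x := fun n => X (φ n) t)
      fun n => hXS (φ n) t
    -- No further subsequence is needed: integrals of test functions converge along the whole
    -- sequence, hence all cluster points in the compact set agree.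
    refine ⟨P, hPS, hScomp.tendsto_nhds_of_unique_mapClusterPt
      (Eventually.of_forall fun n => hXS (φ n) t) fun Q hQS hQ => ?_⟩
    obtain ⟨ψ', hψ', hQlim⟩ := hQ.tendsto_subseq
    refine probabilityMeasure_eq_of_integral_divId_eq (hSpos Q hQS) (hSpos P hPS) fun ζ hζ => ?_
    obtain ⟨L, hL⟩ := hconv ζ hζ t
    have key : ∀ (R : ProbabilityMeasure ℝ) (θ : ℕ → ℕ), StrictMono θ →
        Tendsto ((fun n => X (φ n) t) ∘ θ) atTop (𝓝 R) →
        ∫ x, hζ.divId x ∂(R : Measure ℝ) = ρ⁻¹ * L := by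
      intro R θ hθ hR
      refine tendsto_nhds_unique
        (ProbabilityMeasure.tendsto_iff_forall_integral_tendsto.1 hR hζ.divId) ?_
      refine ((hL.comp hθ.tendsto_atTop).const_mul ρ⁻¹).congr fun n => ?_
      simp only [Function.comp_apply]
      rw [hXint]
      simp_rw [hζ.mul_divId]
    rw [key Q ψ' hψ' hQlim, key P ψ hψ hPlim]
  choose P hPS hPlim using hlimit
  have hP0 := fun t => hSpos (P t) (hPS t)
  set μ : ℝ → Measure ℝ := fun t => ofMassDistribution ρ (P (projIcc 0 T hT.le t) : Measure ℝ)
    with hμ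
  have hμst : ∀ t ∈ Icc 0 T, IsState ρ (μ t) := fun t _ => isState_ofMassDistribution (hP0 _)
  have hμlim : ∀ t ∈ Icc 0 T, ∀ f : ℝ →ᵇ ℝ, Tendsto (fun n => ∫ x, x * f x ∂(ν (φ n) t)) atTop
      (𝓝 (∫ x, x * f x ∂(μ t))) := by
    intro t ht f
    have h1 := (ProbabilityMeasure.tendsto_iff_forall_integral_tendsto.1 (hPlim ⟨t, ht⟩) f).const_mul ρ
    have e : ∫ x, x * f x ∂(μ t) = ρ * ∫ x, f x ∂(P ⟨t, ht⟩ : Measure ℝ) := by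
      rw [hμ]
      simp only [projIcc_of_mem hT.le ht]
      rw [integral_ofMassDistribution hρ (hP0 _)]
      congr 1
      refine integral_congr_ae ((ae_pos_of_measure_Iic (hP0 _)).mono fun x hx => ?_)
      simp only
      have : x ≠ 0 := ne_of_gt hx
      field_simp
    rw [e]
    refine h1.congr fun n => ?_
    rw [hXint, mul_inv_cancel_left₀ hρ.ne']
  refine ⟨φ, hφ, μ, ⟨hμst, fun t ht ζ hζ => ?_⟩, hμlim⟩
  rw [Metric.tendsto_nhdsWithin_nhds]
  intro ε hε
  obtain ⟨δ, hδ, hequi⟩ := h.equicontinuous hp hζ (ε := ε / 2) (by positivity)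
  refine ⟨δ, hδ, fun s hs hst => ?_⟩
  have l : ∀ t ∈ Icc 0 T, Tendsto (fun n => ∫ x, ζ x ∂(ν (φ n) t)) atTop (𝓝 (∫ x, ζ x ∂(μ t))) := by
    intro t ht
    simpa only [hζ.mul_divId] using hμlim t ht hζ.divId
  rw [Real.dist_eq] at hst ⊢
  have := le_of_tendsto ((l s hs).sub (l t ht)).abs
    (Eventually.of_forall fun n => hequi (φ n) t ht s hs hst)
  linarith

end IsTightFamily

end LSW

/-! ### Passage to the limit in the continuity equation. -/

namespace LSW

open scoped NNReal BoundedContinuousFunction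

variable {α γ q ρ T E : ℝ}

/-! ### Space-time test functions -/

/-- Continuous functions on `ℝ × (0, ∞)` with compact support. -/
def IsSpaceTimeCut (g : ℝ × ℝ → ℝ) : Prop :=
  Continuous g ∧ HasCompactSupport g ∧ tsupport g ⊆ univ ×ˢ Ioi 0

namespace IsSpaceTimeCut

variable {g : ℝ × ℝ → ℝ}

theorem mul (h : IsSpaceTimeCut g) {f : ℝ → ℝ} (hf : ContinuousOn f (Ioi 0)) :
    IsSpaceTimeCut fun p => g p * f p.2 := by
  have hs : tsupport (fun p => g p * f p.2) ⊆ tsupport g := tsupport_mul_subset_left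
  refine ⟨?_, h.2.1.mul_right, hs.trans h.2.2⟩
  exact (h.1.continuousOn.mul (hf.comp continuousOn_snd fun p hp => hp.2)).continuous_of_tsupport_subset
    (isOpen_univ.prod isOpen_Ioi) (hs.trans h.2.2)

theorem isTestFun (h : IsSpaceTimeCut g) (t : ℝ) : IsTestFun fun x => g (t, x) := by
  have hcl : IsClosed (Prod.mk t ⁻¹' tsupport g) :=
    (isClosed_tsupport g).preimage (by fun_prop)
  have hs : tsupport (fun x => g (t, x)) ⊆ Prod.mk t ⁻¹' tsupport g :=
    closure_minimal (fun x hx => subset_tsupport g hx) hcl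
  refine ⟨h.1.comp (by fun_prop), ?_, fun x hx => (h.2.2 (hs hx)).2⟩
  refine HasCompactSupport.of_support_subset_isCompact (h.2.1.isCompact.image continuous_snd) ?_
  exact fun x hx => ⟨(t, x), subset_tsupport g hx, rfl⟩

theorem inv (h : IsSpaceTimeCut g) : IsSpaceTimeCut fun p => g p * p.2⁻¹ :=
  h.mul (f := fun x => x⁻¹) (continuousOn_inv₀.mono fun _ hx => ne_of_gt hx)

theorem abs_le_of_abs_mul_inv_le {x a C : ℝ} (hx : 0 < x) (h : |a * x⁻¹| ≤ C) : |a| ≤ C * x := by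
  rwa [abs_mul, abs_inv, abs_of_pos hx, ← div_eq_mul_inv, div_le_iff₀ hx] at h

theorem exists_bound (h : IsSpaceTimeCut g) : ∃ C ≥ 0, ∀ t, ∀ x > 0, |g (t, x)| ≤ C * x := by
  obtain ⟨C, hC⟩ := h.inv.2.1.exists_bound_of_continuous h.inv.1
  exact ⟨C, (norm_nonneg _).trans (hC 0), fun t x hx => abs_le_of_abs_mul_inv_le hx (hC (t, x))⟩

/-- The quotient of g by x is still continuous with compact support, hence uniformly continuous.
Measuring increments relative to x makes them integrate to a multiple of the mass, uniformly over
states. -/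
theorem exists_modulus (h : IsSpaceTimeCut g) {ε : ℝ} (hε : 0 < ε) :
    ∃ δ > 0, ∀ s t, |s - t| < δ → ∀ x > 0, |g (s, x) - g (t, x)| ≤ ε * x := by
  obtain ⟨δ, hδ, hu⟩ := Metric.uniformContinuous_iff.1
    (h.inv.2.1.uniformContinuous_of_continuous h.inv.1) ε hε
  refine ⟨δ, hδ, fun s t hst x hx => abs_le_of_abs_mul_inv_le hx ?_⟩
  have := hu (a := (s, x)) (b := (t, x)) (by
    rw [Prod.dist_eq, dist_self, max_eq_left dist_nonneg, Real.dist_eq]; exact hst)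
  rw [Real.dist_eq] at this
  rw [sub_mul]
  exact this.le

theorem continuousOn_integral (hρ : 0 ≤ ρ) (h : IsSpaceTimeCut g) {ν : ℝ → Measure ℝ}
    (hν : IsCurve ρ T ν) : ContinuousOn (fun t => ∫ x, g (t, x) ∂(ν t)) (Icc 0 T) := by
  intro t ht
  rw [Metric.continuousWithinAt_iff']
  intro ε hε
  obtain ⟨δ, hδ, hm⟩ := h.exists_modulus (ε := ε / (2 * (ρ + 1))) (by positivity)
  have h1 := Metric.tendsto_nhds.1 (hν.weakStar_continuous t ht _ (h.isTestFun t)) (ε / 2)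
    (by positivity)
  filter_upwards [h1, self_mem_nhdsWithin, nhdsWithin_le_nhds (Metric.ball_mem_nhds t hδ)]
    with s hs1 hs hst
  have h2 := (hν.state s hs).abs_integral_sub_le hρ (h.isTestFun s) (h.isTestFun t)
    (hm s t (by rwa [Metric.mem_ball, Real.dist_eq] at hst))
  have h3 : ε / (2 * (ρ + 1)) * ρ ≤ ε / 2 := by
    rw [div_mul_eq_mul_div, div_le_div_iff₀ (by positivity) (by positivity)]
    nlinarith
  rw [Real.dist_eq, abs_lt] at *
  rw [abs_le] at h2
  constructor <;> linarith [h2.1, h2.2, hs1.1, hs1.2]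

end IsSpaceTimeCut

namespace IsSpaceTimeTestFun

variable {φ : ℝ × ℝ → ℝ}

theorem fderiv_apply (h : IsSpaceTimeTestFun φ) (e : ℝ × ℝ) :
    IsSpaceTimeCut fun p => fderiv ℝ φ p e :=
  ⟨(h.1.continuous_fderiv (by simp)).clm_apply continuous_const, h.2.1.fderiv_apply ℝ e,
    (tsupport_fderiv_apply_subset ℝ e).trans h.2.2⟩

theorem isSpaceTimeCut (h : IsSpaceTimeTestFun φ) : IsSpaceTimeCut φ := ⟨h.1.continuous, h.2⟩

/-- The integrand of the continuity equation in terms of moments. -/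
theorem integral_eq (h : IsSpaceTimeTestFun φ) {m : Measure ℝ} (hm : IsState ρ m) {w : ℝ → ℝ}
    {v : ℝ} (hw : ∀ᵐ x ∂m, w x = v - q * x ^ (-γ)) (t : ℝ) :
    ∫ x, (fderiv ℝ φ (t, x) (1, 0) + fderiv ℝ φ (t, x) (0, 1) * (x ^ α * w x)) ∂m
      = (∫ x, fderiv ℝ φ (t, x) (1, 0) ∂m) + (v * (∫ x, fderiv ℝ φ (t, x) (0, 1) * x ^ α ∂m)
        - q * ∫ x, fderiv ℝ φ (t, x) (0, 1) * x ^ (α - γ) ∂m) := by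
  have h1 := (h.fderiv_apply (1, 0)).isTestFun t
  have h2 := (h.fderiv_apply (0, 1)).isTestFun t
  have e : ∀ᵐ x ∂m, fderiv ℝ φ (t, x) (1, 0) + fderiv ℝ φ (t, x) (0, 1) * (x ^ α * w x)
      = fderiv ℝ φ (t, x) (1, 0) + (v * (fderiv ℝ φ (t, x) (0, 1) * x ^ α)
        - q * (fderiv ℝ φ (t, x) (0, 1) * x ^ (α - γ))) := by
    filter_upwards [hw, hm.ae_pos] with x hx hx0
    rw [hx, rpow_mul_drift hx0]
  have i1 := ((h2.mul_rpow α).integrable hm).const_mul v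
  have i2 := ((h2.mul_rpow (α - γ)).integrable hm).const_mul q
  have i3 : Integrable (fun x => v * (fderiv ℝ φ (t, x) (0, 1) * x ^ α)
      - q * (fderiv ℝ φ (t, x) (0, 1) * x ^ (α - γ))) m := i1.sub i2
  rw [integral_congr_ae e, integral_add (h1.integrable hm) i3, integral_sub i1 i2,
    integral_const_mul, integral_const_mul]

end IsSpaceTimeTestFun

/-! ### Convergent families of flows -/

/-- Convergence of curves `ν n` with mean fields `u n` to `(μ, v)`: the curves converge weakly at
all times, and the mean fields are bounded and converge weakly in `L²`. -/
structure ConvergesTo (ρ T K : ℝ) (ν : ℕ → ℝ → Measure ℝ) (u : ℕ → ℝ → ℝ) (μ : ℝ → Measure ℝ)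
    (v : ℝ → ℝ) : Prop where
  curve : ∀ n, IsCurve ρ T (ν n)
  aemeasurable : ∀ n, AEMeasurable (u n) (volume.restrict (Icc 0 T))
  nonneg : 0 ≤ K
  sq_le : ∀ n, ∫⁻ t in Icc 0 T, ENNReal.ofReal (u n t ^ 2) ≤ ENNReal.ofReal K
  limit_curve : IsCurve ρ T μ
  measurable : Measurable v
  memLp : MemLp v 2 (volume.restrict (Icc 0 T))
  tendsto_mean : ∀ p, MemLp p 2 (volume.restrict (Icc 0 T)) →
    Tendsto (fun n => ∫ t in Icc 0 T, u n t * p t) atTop (𝓝 (∫ t in Icc 0 T, v t * p t))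
  tendsto_curve : ∀ t ∈ Icc 0 T, ∀ f : ℝ →ᵇ ℝ,
    Tendsto (fun n => ∫ x, x * f x ∂(ν n t)) atTop (𝓝 (∫ x, x * f x ∂(μ t)))

theorem IsTightFamily.comp {ν : ℕ → ℝ → Measure ℝ} {u : ℕ → ℝ → ℝ}
    (h : IsTightFamily α γ q ρ T E ν u) (φ : ℕ → ℕ) :
    IsTightFamily α γ q ρ T E (fun n => ν (φ n)) fun n => u (φ n) :=
  ⟨fun n => h.flow (φ n), h.energy_nonneg, fun n => h.energy_le (φ n), fun δ hδ =>
    (h.tight δ hδ).imp fun _ hr => ⟨hr.1, fun n => hr.2 (φ n)⟩⟩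

/-- Tight families have convergent subsequences. -/
theorem IsTightFamily.exists_convergesTo {ν : ℕ → ℝ → Measure ℝ} {u : ℕ → ℝ → ℝ}
    (hp : IsAdmissible α γ q ρ T) (h : IsTightFamily α γ q ρ T E ν u) :
    ∃ φ : ℕ → ℕ, StrictMono φ ∧ ∃ K μ v,
      ConvergesTo ρ T K (fun n => ν (φ n)) (fun n => u (φ n)) μ v := by
  obtain ⟨K, hK0, hK⟩ := h.exists_sq_bound hp
  obtain ⟨φ, hφ, v, hv, hv2, hlim⟩ := exists_weak_limit hK0 (fun n => (h.flow n).aemeasurable) hK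
  obtain ⟨ψ, hψ, μ, hμ, hμlim⟩ := (h.comp φ).exists_limit_curve hp
  exact ⟨φ ∘ ψ, hφ.comp hψ, K, μ, v, fun n => (h.flow _).toIsCurve, fun n => (h.flow _).aemeasurable,
    hK0, fun n => hK _, hμ, hv, hv2, fun p hp => (hlim p hp).comp hψ.tendsto_atTop, hμlim⟩

namespace ConvergesTo

variable {K : ℝ} {ν : ℕ → ℝ → Measure ℝ} {u : ℕ → ℝ → ℝ} {μ : ℝ → Measure ℝ} {v : ℝ → ℝ}

theorem tendsto_testFun (h : ConvergesTo ρ T K ν u μ v) {t : ℝ} (ht : t ∈ Icc 0 T) :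
    WeakStarTendsto (fun n => ν n t) atTop (μ t) := fun ζ hζ => by
  simpa only [hζ.mul_divId] using h.tendsto_curve t ht hζ.divId

theorem memLp_mean (h : ConvergesTo ρ T K ν u μ v) (n : ℕ) :
    MemLp (u n) 2 (volume.restrict (Icc 0 T)) :=
  memLp_two_of_lintegral_le (h.aemeasurable n) (h.sq_le n)

theorem memLp_integral (hρ : 0 ≤ ρ) {ν : ℝ → Measure ℝ} (hν : IsCurve ρ T ν) {g : ℝ × ℝ → ℝ}
    (hg : IsSpaceTimeCut g) :
    MemLp (fun t => ∫ x, g (t, x) ∂(ν t)) 2 (volume.restrict (Icc 0 T)) := by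
  obtain ⟨C, -, hC⟩ := hg.exists_bound
  exact MemLp.of_bound ((hg.continuousOn_integral hρ hν).aestronglyMeasurable measurableSet_Icc)
    (C * ρ) ((ae_restrict_mem measurableSet_Icc).mono fun t ht =>
      (hν.state t ht).abs_integral_le hρ (hC t))

theorem tendsto_setIntegral (hρ : 0 ≤ ρ) (h : ConvergesTo ρ T K ν u μ v) {g : ℝ × ℝ → ℝ}
    (hg : IsSpaceTimeCut g) :
    Tendsto (fun n => ∫ t in Icc 0 T, ∫ x, g (t, x) ∂(ν n t)) atTop
      (𝓝 (∫ t in Icc 0 T, ∫ x, g (t, x) ∂(μ t))) := by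
  obtain ⟨C, -, hC⟩ := hg.exists_bound
  exact tendsto_integral_of_dominated_convergence (fun _ => C * ρ)
    (fun n => (memLp_integral hρ (h.curve n) hg).1) (integrable_const _)
    (fun n => (ae_restrict_mem measurableSet_Icc).mono fun t ht =>
      ((h.curve n).state t ht).abs_integral_le hρ (hC t))
    ((ae_restrict_mem measurableSet_Icc).mono fun t ht => h.tendsto_testFun ht _ (hg.isTestFun t))

/-- The only term of the continuity equation with two varying factors: the mean fields converge
weakly, while the moments of the test function converge boundedly at each time, hence strongly in
L². -/
theorem tendsto_setIntegral_mul (hρ : 0 ≤ ρ) (h : ConvergesTo ρ T K ν u μ v) {g : ℝ × ℝ → ℝ}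
    (hg : IsSpaceTimeCut g) :
    Tendsto (fun n => ∫ t in Icc 0 T, u n t * ∫ x, g (t, x) ∂(ν n t)) atTop
      (𝓝 (∫ t in Icc 0 T, v t * ∫ x, g (t, x) ∂(μ t))) := by
  obtain ⟨C, -, hC⟩ := hg.exists_bound
  exact tendsto_integral_mul_of_weak h.nonneg h.aemeasurable h.sq_le h.tendsto_mean
    (fun n => (memLp_integral hρ (h.curve n) hg).1.aemeasurable) (memLp_const (C * ρ))
    (fun n => (ae_restrict_mem measurableSet_Icc).mono fun t ht =>
      ((h.curve n).state t ht).abs_integral_le hρ (hC t))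
    ((ae_restrict_mem measurableSet_Icc).mono fun t ht => h.tendsto_testFun ht _ (hg.isTestFun t))

theorem setIntegral_continuityEq (hρ : 0 ≤ ρ) (hT : 0 < T) {ν : ℝ → Measure ℝ} {u : ℝ → ℝ}
    {w : ℝ → ℝ → ℝ} (hν : IsCurve ρ T ν) (hu : MemLp u 2 (volume.restrict (Icc 0 T)))
    (hw : ∀ᵐ t ∂(volume.restrict (Icc 0 T)), ∀ᵐ x ∂(ν t), w t x = u t - q * x ^ (-γ))
    {φ : ℝ × ℝ → ℝ} (hφ : IsSpaceTimeTestFun φ) :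
    ∫ t in (0 : ℝ)..T, ∫ x, (fderiv ℝ φ (t, x) (1, 0)
        + fderiv ℝ φ (t, x) (0, 1) * (x ^ α * w t x)) ∂(ν t)
      = (∫ t in Icc 0 T, ∫ x, fderiv ℝ φ (t, x) (1, 0) ∂(ν t))
        + ((∫ t in Icc 0 T, u t * ∫ x, fderiv ℝ φ (t, x) (0, 1) * x ^ α ∂(ν t))
        - q * ∫ t in Icc 0 T, ∫ x, fderiv ℝ φ (t, x) (0, 1) * x ^ (α - γ) ∂(ν t)) := by
  have h2 : ∀ s : ℝ, IsSpaceTimeCut fun p : ℝ × ℝ => fderiv ℝ φ p (0, 1) * p.2 ^ s := fun s =>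
    (hφ.fderiv_apply (0, 1)).mul (continuousOn_rpow s)
  have i0 := (memLp_integral hρ hν (hφ.fderiv_apply (1, 0))).integrable (by norm_num)
  have i1 : Integrable (fun t => u t * ∫ x, fderiv ℝ φ (t, x) (0, 1) * x ^ α ∂(ν t))
      (volume.restrict (Icc 0 T)) := hu.integrable_mul (memLp_integral hρ hν (h2 α))
  have i2 : Integrable (fun t => q * ∫ x, fderiv ℝ φ (t, x) (0, 1) * x ^ (α - γ) ∂(ν t))
      (volume.restrict (Icc 0 T)) :=
    ((memLp_integral hρ hν (h2 (α - γ))).integrable (by norm_num)).const_mul q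
  have i3 : Integrable (fun t => u t * (∫ x, fderiv ℝ φ (t, x) (0, 1) * x ^ α ∂(ν t))
      - q * ∫ x, fderiv ℝ φ (t, x) (0, 1) * x ^ (α - γ) ∂(ν t)) (volume.restrict (Icc 0 T)) :=
    i1.sub i2
  rw [intervalIntegral.integral_of_le hT.le, restrict_Ioc_eq_restrict_Icc, ← integral_const_mul,
    ← integral_sub i1 i2, ← integral_add i0 i3]
  refine integral_congr_ae ?_
  filter_upwards [hw, ae_restrict_mem measurableSet_Icc] with t hwt ht
  exact hφ.integral_eq (hν.state t ht) hwt t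

/-- The continuity equation passes to the limit. -/
theorem continuityEq (hρ : 0 ≤ ρ) (hT : 0 < T) (h : ConvergesTo ρ T K ν u μ v)
    {w : ℕ → ℝ → ℝ → ℝ} (hc : ∀ n, ContinuityEq α T (ν n) (w n))
    (hw : ∀ n, ∀ᵐ t ∂(volume.restrict (Icc 0 T)), ∀ᵐ x ∂(ν n t), w n t x = u n t - q * x ^ (-γ)) :
    ContinuityEq α T μ fun t x => v t - q * x ^ (-γ) := by
  intro φ hφ
  have h2 : ∀ s : ℝ, IsSpaceTimeCut fun p : ℝ × ℝ => fderiv ℝ φ p (0, 1) * p.2 ^ s := fun s =>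
    (hφ.fderiv_apply (0, 1)).mul (continuousOn_rpow s)
  rw [setIntegral_continuityEq hρ hT h.limit_curve h.memLp
    (ae_of_all _ fun t => ae_of_all _ fun x => rfl) hφ]
  refine tendsto_nhds_unique ((h.tendsto_setIntegral hρ (hφ.fderiv_apply (1, 0))).add
    ((h.tendsto_setIntegral_mul hρ (h2 α)).sub
      ((h.tendsto_setIntegral hρ (h2 (α - γ))).const_mul q))) ?_
  refine ((h.tendsto_testFun ⟨hT.le, le_rfl⟩ _ (hφ.isSpaceTimeCut.isTestFun T)).sub
    (h.tendsto_testFun ⟨le_rfl, hT.le⟩ _ (hφ.isSpaceTimeCut.isTestFun 0))).congr fun n => ?_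
  rw [← hc n φ hφ, setIntegral_continuityEq hρ hT (h.curve n) (h.memLp_mean n) (hw n) hφ]

end ConvergesTo

end LSW

/-! ### Finite dissipation of the limit and identification of its mean field. -/

namespace LSW

open scoped NNReal BoundedContinuousFunction

variable {α γ q ρ T E v : ℝ}

/-! ### Moments of states of finite dissipation -/

/-- At the size c the term q x^(-γ) equals 2 (|v| + 1). Below c it dominates v, so the squared drift
exceeds both 1 and (q / 2) x^(-γ); above c both powers are at most a constant times x. Hence finite
dissipation makes both moments in the mean field finite, even if α - γ < 0. The constant depends on
v and so gives no bound uniform in time. -/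
theorem rpow_le_add_drift_sq (hγ : 0 < γ) (hq : 0 < q) (hα₁ : α ≤ 1) (v : ℝ) :
    ∃ C, ∀ x > 0, x ^ α ≤ C * (x + x ^ α * (v - q * x ^ (-γ)) ^ 2) ∧
      x ^ (α - γ) ≤ C * (x + x ^ α * (v - q * x ^ (-γ)) ^ 2) := by
  set c : ℝ := (q / (2 * (|v| + 1))) ^ (1 / γ) with hc
  have hv := abs_nonneg v
  have hb : 0 < q / (2 * (|v| + 1)) := by positivity
  have hc0 : 0 < c := Real.rpow_pos_of_pos hb _
  have hcγ : c ^ γ = q / (2 * (|v| + 1)) := by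
    rw [hc, ← Real.rpow_mul hb.le, one_div, inv_mul_cancel₀ hγ.ne', Real.rpow_one]
  have hd : ∀ s : ℝ, 0 < c ^ (s - 1) := fun s => Real.rpow_pos_of_pos hc0 _
  have hd1 := hd α
  have hd2 := hd (α - γ)
  have hq2 : 0 < 2 / q := by positivity
  set C := c ^ (α - 1) + c ^ (α - γ - 1) + 1 + 2 / q with hC
  have far : ∀ s : ℝ, s ≤ 1 → ∀ x > 0, c ≤ x → x ^ s ≤ c ^ (s - 1) * x := by
    intro s hs x hx hcx
    have : x ^ s = x ^ (s - 1) * x := by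
      rw [← Real.rpow_add_one hx.ne', sub_add_cancel]
    rw [this]
    exact mul_le_mul_of_nonneg_right
      (Real.rpow_le_rpow_of_nonpos hc0 hcx (sub_nonpos.2 hs)) (le_of_lt hx)
  refine ⟨C, fun x hx => ?_⟩
  have hxa : 0 < x ^ α := Real.rpow_pos_of_pos hx _
  set w := v - q * x ^ (-γ) with hw
  have hw0 : 0 ≤ x ^ α * w ^ 2 := by positivity
  rcases le_total c x with h | h
  · have h1 := far α hα₁ x hx h
    have h2 := far (α - γ) (by linarith) x hx h
    constructor <;> nlinarith
  · have hxγ : 0 < x ^ (-γ) := Real.rpow_pos_of_pos hx _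
    have h1 : 2 * (|v| + 1) ≤ q * x ^ (-γ) := by
      have : x ^ γ ≤ q / (2 * (|v| + 1)) := hcγ ▸ Real.rpow_le_rpow hx.le h hγ.le
      rw [Real.rpow_neg hx.le, ← div_eq_mul_inv, le_div_iff₀ (Real.rpow_pos_of_pos hx _)]
      rw [le_div_iff₀ (by positivity)] at this
      linarith
    have h2 : 1 ≤ -w := by linarith [le_abs_self v]
    have h3 : q / 2 * x ^ (-γ) ≤ -w := by linarith [le_abs_self v]
    have h4 : 1 ≤ w ^ 2 := by nlinarith
    have h5 : q / 2 * x ^ (-γ) ≤ w ^ 2 := by nlinarith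
    have h6 : x ^ α ≤ x ^ α * w ^ 2 := le_mul_of_one_le_right hxa.le h4
    have h7 : x ^ (α - γ) ≤ 2 / q * (x ^ α * w ^ 2) := by
      rw [sub_eq_add_neg, Real.rpow_add hx]
      calc x ^ α * x ^ (-γ) = 2 / q * (x ^ α * (q / 2 * x ^ (-γ))) := by field_simp
        _ ≤ _ := by gcongr
    constructor <;> nlinarith

theorem integrable_rpow_of_dissipation (hγ : 0 < γ) (hq : 0 < q) (hα₁ : α ≤ 1) {m : Measure ℝ}
    (hm : IsState ρ m) (hd : dissipation α γ q m v ≠ ⊤) :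
    Integrable (fun x : ℝ => x ^ α) m ∧ Integrable (fun x : ℝ => x ^ (α - γ)) m := by
  obtain ⟨C, hC⟩ := rpow_le_add_drift_sq hγ hq hα₁ v
  have hi := (hm.integrable_id.add (integrable_dissipation hm hd).1).const_mul C
  refine ⟨hi.mono' (by fun_prop) ?_, hi.mono' (by fun_prop) ?_⟩ <;>
    filter_upwards [hm.ae_pos] with x hx <;>
    rw [Real.norm_eq_abs, abs_of_pos (Real.rpow_pos_of_pos hx _)]
  exacts [(hC x hx).1, (hC x hx).2]

theorem integral_drift {m : Measure ℝ} (hm : IsState ρ m)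
    (h1 : Integrable (fun x : ℝ => x ^ α) m) (h2 : Integrable (fun x : ℝ => x ^ (α - γ)) m) :
    Integrable (fun x => x ^ α * (v - q * x ^ (-γ))) m ∧
    ∫ x, x ^ α * (v - q * x ^ (-γ)) ∂m = v * (∫ x, x ^ α ∂m) - q * ∫ x, x ^ (α - γ) ∂m := by
  have e : ∀ᵐ x ∂m, v * x ^ α - q * x ^ (α - γ) = x ^ α * (v - q * x ^ (-γ)) :=
    hm.ae_pos.mono fun x hx => by
      simpa using (rpow_mul_drift (α := α) (γ := γ) (q := q) (v := v) hx 1).symm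
  refine ⟨((h1.const_mul v).sub (h2.const_mul q)).congr e, ?_⟩
  rw [← integral_congr_ae e, integral_sub (h1.const_mul v) (h2.const_mul q), integral_const_mul,
    integral_const_mul]

/-! ### Lower semicontinuity of the dissipation -/

theorem cutDissipation_nonneg {m : Measure ℝ} (hm : IsState ρ m) (j : ℕ) :
    0 ≤ cutDissipation α γ q j m v := by
  rw [(cutDissipation_eq hm j).2]
  exact integral_nonneg_of_ae (hm.ae_pos.mono fun x hx =>
    mul_nonneg (cutoff_nonneg j x) (dissipation_integrand_nonneg hx))

/-- The tangent of the convex quadratic u ↦ u² at v, weighted by the nonnegative moment of x^α. The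
minorant is affine in u, so it survives weak convergence of the mean fields. -/
theorem le_cutDissipation {m : Measure ℝ} (hm : IsState ρ m) (j : ℕ) (u v : ℝ) :
    u * (2 * v * (∫ x, cutoff j x * x ^ α ∂m) - 2 * q * ∫ x, cutoff j x * x ^ (α - γ) ∂m)
      + (q ^ 2 * (∫ x, cutoff j x * x ^ (α - 2 * γ) ∂m) - v ^ 2 * ∫ x, cutoff j x * x ^ α ∂m)
      ≤ cutDissipation α γ q j m u := by
  have h0 : 0 ≤ ∫ x, cutoff j x * x ^ α ∂m := integral_nonneg_of_ae (hm.ae_pos.mono fun x hx =>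
    mul_nonneg (cutoff_nonneg j x) (Real.rpow_nonneg (le_of_lt hx) _))
  have := mul_nonneg (sq_nonneg (u - v)) h0
  simp only [cutDissipation]
  linarith

namespace ConvergesTo

variable {K : ℝ} {ν : ℕ → ℝ → Measure ℝ} {u : ℕ → ℝ → ℝ} {μ : ℝ → Measure ℝ} {v : ℝ → ℝ}

theorem lintegral_cutDissipation_le (hρ : 0 ≤ ρ) (h : ConvergesTo ρ T K ν u μ v) (hE : 0 ≤ E)
    (hd : ∀ n, ∫⁻ t in Icc 0 T, dissipation α γ q (ν n t) (u n t) ≤ ENNReal.ofReal E) (j : ℕ) :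
    ∫⁻ t in Icc 0 T, ENNReal.ofReal (cutDissipation α γ q j (μ t) (v t)) ≤ ENNReal.ofReal E := by
  set A : ℝ → Measure ℝ → ℝ := fun s m => ∫ x, cutoff j x * x ^ s ∂m with hA
  have htest : ∀ s : ℝ, IsTestFun fun x => cutoff j x * x ^ s := fun s =>
    (cutoff_isTestFun j).mul_rpow s
  choose C hC0 hC using fun s => (htest s).exists_bound
  have hb : ∀ s m, IsState ρ m → |A s m| ≤ C s * ρ := fun s m hm => hm.abs_integral_le hρ (hC s)
  have hAm : ∀ s n, AEMeasurable (fun t => A s (ν n t)) (volume.restrict (Icc 0 T)) := fun s n =>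
    (h.curve n).aemeasurable_integral (htest s)
  have hAm' : ∀ s, AEMeasurable (fun t => A s (μ t)) (volume.restrict (Icc 0 T)) := fun s =>
    h.limit_curve.aemeasurable_integral (htest s)
  have hlim : ∀ s, ∀ t ∈ Icc 0 T, Tendsto (fun n => A s (ν n t)) atTop (𝓝 (A s (μ t))) :=
    fun s t ht => h.tendsto_testFun ht _ (htest s)
  have hvm := h.memLp.1.aemeasurable
  set P : Measure ℝ → ℝ → ℝ := fun m t => 2 * v t * A α m - 2 * q * A (α - γ) m with hP
  set Q : Measure ℝ → ℝ → ℝ := fun m t => q ^ 2 * A (α - 2 * γ) m - v t ^ 2 * A α m with hQ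
  -- With the tangent taken at the limit v, the slope P is dominated by G in L² and the offset Q by
  -- H in L¹, uniformly in the state.
  set G : ℝ → ℝ := fun t => 2 * (C α * ρ) * |v t| + 2 * |q| * (C (α - γ) * ρ) with hG
  set H : ℝ → ℝ := fun t => q ^ 2 * (C (α - 2 * γ) * ρ) + (C α * ρ) * v t ^ 2 with hH
  have hGm : MemLp G 2 (volume.restrict (Icc 0 T)) :=
    (h.memLp.abs.const_mul _).add (memLp_const _)
  have hHi : Integrable H (volume.restrict (Icc 0 T)) :=
    (integrable_const _).add (h.memLp.integrable_sq.const_mul _)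
  have hPb : ∀ m t, IsState ρ m → |P m t| ≤ G t := by
    intro m t hm
    refine (abs_sub _ _).trans ?_
    rw [abs_mul, abs_mul, abs_mul, abs_mul, abs_two]
    have h1 := mul_le_mul_of_nonneg_left (hb α m hm) (abs_nonneg (v t))
    have h2 := mul_le_mul_of_nonneg_left (hb (α - γ) m hm) (abs_nonneg q)
    simp only [hG]
    linarith
  have hQb : ∀ m t, IsState ρ m → |Q m t| ≤ H t := by
    intro m t hm
    refine (abs_sub _ _).trans ?_
    rw [abs_mul, abs_mul, abs_of_nonneg (sq_nonneg q), abs_of_nonneg (sq_nonneg (v t))]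
    have h1 := mul_le_mul_of_nonneg_left (hb α m hm) (sq_nonneg (v t))
    have h2 := mul_le_mul_of_nonneg_left (hb (α - 2 * γ) m hm) (sq_nonneg q)
    simp only [hH]
    linarith
  have hPm : ∀ n, AEMeasurable (fun t => P (ν n t) t) (volume.restrict (Icc 0 T)) := fun n =>
    ((hvm.const_mul 2).mul (hAm _ n)).sub ((hAm _ n).const_mul _)
  have hQm : ∀ n, AEMeasurable (fun t => Q (ν n t) t) (volume.restrict (Icc 0 T)) := fun n =>
    ((hAm _ n).const_mul _).sub ((hvm.pow_const 2).mul (hAm _ n))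
  have hPm' : AEMeasurable (fun t => P (μ t) t) (volume.restrict (Icc 0 T)) :=
    ((hvm.const_mul 2).mul (hAm' _)).sub ((hAm' _).const_mul _)
  have hQm' : AEMeasurable (fun t => Q (μ t) t) (volume.restrict (Icc 0 T)) :=
    ((hAm' _).const_mul _).sub ((hvm.pow_const 2).mul (hAm' _))
  have hmem : ∀ᵐ t ∂(volume.restrict (Icc 0 T)), t ∈ Icc 0 T := ae_restrict_mem measurableSet_Icc
  have limP : Tendsto (fun n => ∫ t in Icc 0 T, u n t * P (ν n t) t) atTop
      (𝓝 (∫ t in Icc 0 T, v t * P (μ t) t)) :=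
    tendsto_integral_mul_of_weak h.nonneg h.aemeasurable h.sq_le h.tendsto_mean hPm hGm
      (fun n => hmem.mono fun t ht => hPb _ _ ((h.curve n).state t ht))
      (hmem.mono fun t ht => ((hlim α t ht).const_mul _).sub ((hlim _ t ht).const_mul _))
  have limQ : Tendsto (fun n => ∫ t in Icc 0 T, Q (ν n t) t) atTop
      (𝓝 (∫ t in Icc 0 T, Q (μ t) t)) :=
    tendsto_integral_of_dominated_convergence H (fun n => (hQm n).aestronglyMeasurable) hHi
      (fun n => hmem.mono fun t ht => hQb _ _ ((h.curve n).state t ht))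
      (hmem.mono fun t ht => ((hlim _ t ht).const_mul _).sub ((hlim _ t ht).const_mul _))
  have iP : ∀ n, Integrable (fun t => u n t * P (ν n t) t) (volume.restrict (Icc 0 T)) := fun n =>
    (h.memLp_mean n).integrable_mul (hGm.mono' (hPm n).aestronglyMeasurable
      (hmem.mono fun t ht => hPb _ _ ((h.curve n).state t ht)))
  have iQ : ∀ n, Integrable (fun t => Q (ν n t) t) (volume.restrict (Icc 0 T)) := fun n =>
    hHi.mono' (hQm n).aestronglyMeasurable
      (hmem.mono fun t ht => hQb _ _ ((h.curve n).state t ht))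
  have iP' : Integrable (fun t => v t * P (μ t) t) (volume.restrict (Icc 0 T)) :=
    h.memLp.integrable_mul (hGm.mono' hPm'.aestronglyMeasurable
      (hmem.mono fun t ht => hPb _ _ (h.limit_curve.state t ht)))
  have iQ' : Integrable (fun t => Q (μ t) t) (volume.restrict (Icc 0 T)) :=
    hHi.mono' hQm'.aestronglyMeasurable (hmem.mono fun t ht => hQb _ _ (h.limit_curve.state t ht))
  have hle : ∀ n, (∫ t in Icc 0 T, u n t * P (ν n t) t) + ∫ t in Icc 0 T, Q (ν n t) t ≤ E := by
    intro n
    have hcm := ((h.curve n).aemeasurable_cutDissipation (α := α) (γ := γ) (q := q)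
      (h.aemeasurable n) j)
    have hc0 : ∀ᵐ t ∂(volume.restrict (Icc 0 T)), 0 ≤ cutDissipation α γ q j (ν n t) (u n t) :=
      hmem.mono fun t ht => cutDissipation_nonneg ((h.curve n).state t ht) j
    have hcl : ∫⁻ t in Icc 0 T, ENNReal.ofReal (cutDissipation α γ q j (ν n t) (u n t))
        ≤ ENNReal.ofReal E :=
      (lintegral_mono_ae (hmem.mono fun t ht =>
        cutDissipation_le ((h.curve n).state t ht) j)).trans (hd n)
    have hci : Integrable (fun t => cutDissipation α γ q j (ν n t) (u n t))
        (volume.restrict (Icc 0 T)) := by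
      refine ⟨hcm.aestronglyMeasurable, ?_⟩
      rw [hasFiniteIntegral_iff_ofReal hc0]
      exact hcl.trans_lt ENNReal.ofReal_lt_top
    calc (∫ t in Icc 0 T, u n t * P (ν n t) t) + ∫ t in Icc 0 T, Q (ν n t) t
        = ∫ t in Icc 0 T, (u n t * P (ν n t) t + Q (ν n t) t) := (integral_add (iP n) (iQ n)).symm
      _ ≤ ∫ t in Icc 0 T, cutDissipation α γ q j (ν n t) (u n t) :=
          integral_mono_ae ((iP n).add (iQ n)) hci (hmem.mono fun t ht =>
            le_cutDissipation ((h.curve n).state t ht) j (u n t) (v t))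
      _ ≤ E := by
          rw [integral_eq_lintegral_of_nonneg_ae hc0 hcm.aestronglyMeasurable]
          exact ENNReal.toReal_le_of_le_ofReal hE hcl
  have e : ∀ t, cutDissipation α γ q j (μ t) (v t) = v t * P (μ t) t + Q (μ t) t := by
    intro t
    simp only [cutDissipation, hP, hQ, hA]
    ring
  have h0 : ∀ᵐ t ∂(volume.restrict (Icc 0 T)), 0 ≤ v t * P (μ t) t + Q (μ t) t :=
    hmem.mono fun t ht => e t ▸ cutDissipation_nonneg (h.limit_curve.state t ht) j
  simp_rw [e]
  have iPQ : Integrable (fun t => v t * P (μ t) t + Q (μ t) t) (volume.restrict (Icc 0 T)) :=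
    iP'.add iQ'
  rw [← ofReal_integral_eq_lintegral_ofReal iPQ h0]
  refine ENNReal.ofReal_le_ofReal ?_
  rw [integral_add iP' iQ']
  exact le_of_tendsto' (limP.add limQ) hle

/-- Lower semicontinuity of the total dissipation. -/
theorem hasFiniteDissipation (hρ : 0 ≤ ρ) (h : ConvergesTo ρ T K ν u μ v) (hE : 0 ≤ E)
    (hd : ∀ n, ∫⁻ t in Icc 0 T, dissipation α γ q (ν n t) (u n t) ≤ ENNReal.ofReal E) :
    HasFiniteDissipation α γ q ρ T μ v := by
  refine ⟨h.limit_curve, h.measurable.aemeasurable, lt_of_le_of_lt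
    (lintegral_le_of_tendsto (fun j => ((h.limit_curve.aemeasurable_cutDissipation (α := α) (γ := γ)
      (q := q) h.measurable.aemeasurable j).ennreal_ofReal)) ?_
      (h.lintegral_cutDissipation_le hρ hE hd)) ENNReal.ofReal_lt_top⟩
  filter_upwards [ae_restrict_mem measurableSet_Icc] with t ht
  rw [dissipation_eq_iSup (h.limit_curve.state t ht)]
  exact tendsto_atTop_iSup (ofReal_cutDissipation_mono (h.limit_curve.state t ht))

/-! ### The constraint in the limit -/

theorem tendsto_integral_rootMoment (h : ConvergesTo ρ T K ν u μ v) {R : ℝ} (hR : 0 < R) {t : ℝ}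
    (ht : t ∈ Icc 0 T) : Tendsto (fun n => ∫ x, rootMoment R x ∂(ν n t)) atTop
      (𝓝 (∫ x, rootMoment R x ∂(μ t))) := by
  have hd : ∀ x : ℝ, 0 < √(x ^ 2 + R ^ 2) + R := fun x => by positivity
  have := h.tendsto_curve t ht (BoundedContinuousFunction.ofNormedAddCommGroup
    (fun x => x / (√(x ^ 2 + R ^ 2) + R))
    (continuous_id.div (by fun_prop) fun x => (hd x).ne') 1 fun x => by
      rw [Real.norm_eq_abs, abs_div, abs_of_pos (hd x), div_le_one (hd x)]
      have : |x| ≤ √(x ^ 2 + R ^ 2) := Real.abs_le_sqrt (by nlinarith)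
      linarith)
  simp only [BoundedContinuousFunction.coe_ofNormedAddCommGroup] at this
  simpa only [rootMoment_eq hR] using this

end ConvergesTo

theorem tendsto_rootMoment {d : ℕ → ℝ} (hd : Tendsto d atTop (𝓝 0)) {x : ℝ} (hx : 0 < x) :
    Tendsto (fun k => rootMoment (d k) x) atTop (𝓝 x) := by
  have : Continuous fun R : ℝ => rootMoment R x := by unfold rootMoment; fun_prop
  have h := (this.tendsto 0).comp hd
  simpa [rootMoment, Real.sqrt_sq hx.le, Function.comp_def] using h

theorem tendsto_root_density {d : ℕ → ℝ} (hd : Tendsto d atTop (𝓝 0)) {x : ℝ} (hx : 0 < x) :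
    Tendsto (fun k => x / √(x ^ 2 + d k ^ 2)) atTop (𝓝 1) := by
  have h : Tendsto (fun k => x / √(x ^ 2 + d k ^ 2)) atTop (𝓝 (x / √(x ^ 2 + 0 ^ 2))) :=
    tendsto_const_nhds.div (Real.continuous_sqrt.continuousAt.tendsto.comp
      ((hd.pow 2).const_add _)) (by positivity)
  simpa [Real.sqrt_sq hx.le, hx.ne'] using h

/-- An integrable function whose primitive is nondecreasing is nonnegative. -/
theorem ae_nonneg_of_forall_intervalIntegral_nonneg (hT : 0 < T) {f : ℝ → ℝ}
    (hf : IntervalIntegrable f volume 0 T)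
    (h : ∀ s ∈ Icc 0 T, ∀ t ∈ Icc 0 T, s ≤ t → 0 ≤ ∫ r in s..t, f r) :
    ∀ᵐ t ∂(volume.restrict (Icc 0 T)), 0 ≤ f t := by
  rw [ae_restrict_iff' measurableSet_Icc]
  filter_upwards [hf.ae_hasDerivAt_integral] with t ht hm
  have h0 : (0 : ℝ) ∈ Icc 0 T := ⟨le_rfl, hT.le⟩
  rw [uIcc_of_le hT.le] at ht
  have hmono : MonotoneOn (fun t => ∫ r in (0 : ℝ)..t, f r) (Icc 0 T) := by
    intro a ha b hb hab
    have hi : ∀ c ∈ Icc 0 T, IntervalIntegrable f volume 0 c := fun c hc =>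
      hf.mono_set (by rw [uIcc_of_le hT.le, uIcc_of_le hc.1]; exact Icc_subset_Icc_right hc.2)
    have := h a ha b hb hab
    rw [← intervalIntegral.integral_interval_sub_left (hi b hb) (hi a ha)] at this
    exact sub_nonneg.1 this
  have hder := (ht hm 0 h0).hasDerivWithinAt (s := Icc 0 T)
  rw [← hder.derivWithin (uniqueDiffOn_Icc hT t hm)]
  exact hmono.derivWithin_nonneg

/-- Flows along which the moments of convex profiles are nondecreasing preserve the mass at almost
every time. -/
theorem IsFlow.ae_integral_drift_eq_zero {ν : ℝ → Measure ℝ} {u : ℝ → ℝ}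
    (hp : IsAdmissible α γ q ρ T) (h : IsFlow α γ q ρ T ν u)
    (hmono : ∀ R > 0, ∀ s ∈ Icc 0 T, ∀ t ∈ Icc 0 T, s ≤ t →
      ∫ x, rootMoment R x ∂(ν s) ≤ ∫ x, rootMoment R x ∂(ν t)) :
    ∀ᵐ t ∂(volume.restrict (Icc 0 T)), ∫ x, x ^ α * (u t - q * x ^ (-γ)) ∂(ν t) = 0 := by
  have hα₀ := hp.α_nonneg
  have hα₁ := hp.α_lt_one.le
  have hρ := hp.ρ_pos.le
  have hT := hp.T_pos
  have h0 : (0 : ℝ) ∈ Icc 0 T := ⟨le_rfl, hT.le⟩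
  have h1 : T ∈ Icc 0 T := ⟨hT.le, le_rfl⟩
  -- Here R = d k tends to zero: the moments increase to the mass and their densities tend to the
  -- inadmissible density 1.
  set d : ℕ → ℝ := fun k => 1 / ((k : ℝ) + 1) with hd
  have hd0 : ∀ k, 0 < d k := fun k => by positivity
  have hdlim : Tendsto d atTop (𝓝 0) := tendsto_one_div_add_atTop_nhds_zero_nat
  set ψ : ℕ → ℝ → ℝ := fun k x => x / √(x ^ 2 + d k ^ 2) with hψ
  have hprof := fun k => isProfile_rootMoment (hd0 k)
  have hint : ∀ k, IntegrableOn (fun t => flux α γ q (ν t) (u t) (ψ k)) (Icc 0 T) := fun k =>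
    h.integrableOn_flux hα₀ hα₁ hρ (hprof k).continuousOn_deriv (hprof k).fluxBound
  have hnonneg : ∀ᵐ t ∂(volume.restrict (Icc 0 T)), ∀ k, 0 ≤ flux α γ q (ν t) (u t) (ψ k) := by
    rw [ae_all_iff]
    intro k
    refine ae_nonneg_of_forall_intervalIntegral_nonneg hT
      (h.intervalIntegrable_flux hα₀ hα₁ hρ (hprof k).continuousOn_deriv (hprof k).fluxBound h0 h1)
      fun s hs t ht hst => ?_
    rw [← h.evolution_profile hα₀ hα₁ hρ (hprof k) hs ht]
    exact sub_nonneg.2 (hmono _ (hd0 k) s hs t ht hst)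
  have hlim : ∀ᵐ t ∂(volume.restrict (Icc 0 T)),
      Tendsto (fun k => flux α γ q (ν t) (u t) (ψ k)) atTop
        (𝓝 (∫ x, x ^ α * (u t - q * x ^ (-γ)) ∂(ν t))) := by
    filter_upwards [h.ae_ne_top, ae_restrict_mem measurableSet_Icc] with t ht hm
    have hst := h.state t hm
    have hi := integrable_rpow_of_dissipation hp.γ_pos hp.q_pos hα₁ hst ht
    refine tendsto_integral_of_dominated_convergence _
      (fun k => aestronglyMeasurable_drift hst (hprof k).continuousOn_deriv)
      (integral_drift (v := u t) (q := q) hst hi.1 hi.2).1.abs (fun k => ?_) ?_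
    · filter_upwards [hst.ae_pos] with x hx
      have := root_density_fluxBound (hd0 k) hx
      rw [Real.norm_eq_abs, abs_mul, abs_of_nonneg this.1]
      exact mul_le_of_le_one_left (abs_nonneg _) this.2.1
    · filter_upwards [hst.ae_pos] with x hx
      simpa using (tendsto_root_density hdlim hx).mul_const (x ^ α * (u t - q * x ^ (-γ)))
  have hmass : ∀ t ∈ Icc 0 T,
      Tendsto (fun k => ∫ x, rootMoment (d k) x ∂(ν t)) atTop (𝓝 ρ) := by
    intro t ht
    have hst := h.state t ht
    rw [← hst.integral_id hρ]
    refine tendsto_integral_of_dominated_convergence (fun x => x)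
      (fun k => (hst.aestronglyMeasurable (hprof k).continuousOn)) hst.integrable_id
      (fun k => hst.ae_pos.mono fun x hx => ?_)
      (hst.ae_pos.mono fun x hx => tendsto_rootMoment hdlim hx)
    rw [Real.norm_eq_abs, abs_of_nonneg (rootMoment_nonneg _ _)]
    exact (rootMoment_le (hd0 k) hx).1
  have htotal : ∀ k, ∫⁻ t in Icc 0 T, ENNReal.ofReal (flux α γ q (ν t) (u t) (ψ k))
      = ENNReal.ofReal (∫ x, rootMoment (d k) x ∂(ν T) - ∫ x, rootMoment (d k) x ∂(ν 0)) := by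
    intro k
    rw [h.evolution_profile hα₀ hα₁ hρ (hprof k) h0 h1, intervalIntegral.integral_of_le hT.le,
      restrict_Ioc_eq_restrict_Icc,
      ofReal_integral_eq_lintegral_ofReal (hint k) (hnonneg.mono fun t ht => ht k)]
  have hzero : Tendsto (fun k => ∫⁻ t in Icc 0 T,
      ENNReal.ofReal (flux α γ q (ν t) (u t) (ψ k))) atTop (𝓝 0) := by
    simp_rw [htotal]
    have := (ENNReal.continuous_ofReal.tendsto _).comp ((hmass T h1).sub (hmass 0 h0))
    rwa [sub_self, ENNReal.ofReal_zero] at this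
  have hmeas := fun k => (hint k).1.aemeasurable
  -- No dominating function in time is available for the full drift. Nonnegativity of the fluxes
  -- permits Fatou's lemma instead, and the total fluxes tend to ρ - ρ = 0.
  have hle : ∫⁻ t in Icc 0 T,
      ENNReal.ofReal (∫ x, x ^ α * (u t - q * x ^ (-γ)) ∂(ν t)) ≤ 0 :=
    calc ∫⁻ t in Icc 0 T, ENNReal.ofReal (∫ x, x ^ α * (u t - q * x ^ (-γ)) ∂(ν t))
        = ∫⁻ t in Icc 0 T, liminf (fun k => ENNReal.ofReal (flux α γ q (ν t) (u t) (ψ k))) atTop :=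
          lintegral_congr_ae (hlim.mono fun t ht =>
            ((ENNReal.continuous_ofReal.tendsto _).comp ht).liminf_eq.symm)
      _ ≤ liminf (fun k => ∫⁻ t in Icc 0 T,
            ENNReal.ofReal (flux α γ q (ν t) (u t) (ψ k))) atTop :=
          lintegral_liminf_le' fun k => (hmeas k).ennreal_ofReal
      _ = 0 := hzero.liminf_eq
  have hGm := aemeasurable_of_tendsto_metrizable_ae atTop hmeas hlim
  have hG0 := (lintegral_eq_zero_iff' hGm.ennreal_ofReal).1 (le_antisymm hle bot_le)
  filter_upwards [hG0, hlim, hnonneg] with t ht hl hn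
  exact le_antisymm (ENNReal.ofReal_eq_zero.1 ht) (ge_of_tendsto' hl hn)

/-- Flows which preserve the mass and solve the continuity equation are solutions. -/
theorem HasFiniteDissipation.isSolution {μ : ℝ → Measure ℝ} {v : ℝ → ℝ}
    (hp : IsAdmissible α γ q ρ T) (h : HasFiniteDissipation α γ q ρ T μ v) (hv : Measurable v)
    (hc : ContinuityEq α T μ fun t x => v t - q * x ^ (-γ))
    (hz : ∀ᵐ t ∂(volume.restrict (Icc 0 T)), ∫ x, x ^ α * (v t - q * x ^ (-γ)) ∂(μ t) = 0) :
    IsSolution α γ q ρ T μ := by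
  have hmom : ∀ᵐ t ∂(volume.restrict (Icc 0 T)), t ∈ Icc 0 T ∧
      Integrable (fun x : ℝ => x ^ α) (μ t) ∧ Integrable (fun x : ℝ => x ^ (α - γ)) (μ t) := by
    filter_upwards [h.ae_ne_top, ae_restrict_mem measurableSet_Icc] with t ht hm
    exact ⟨hm, integrable_rpow_of_dissipation hp.γ_pos hp.q_pos hp.α_lt_one.le (h.state t hm) ht⟩
  refine ⟨fun t x => v t - q * x ^ (-γ), ⟨h.state, h.weakStar_continuous, ?_, ?_,
    h.dissipation_lt_top, hc⟩, ?_⟩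
  · exact (hv.comp measurable_fst).sub ((measurable_snd.pow_const _).const_mul q)
  · filter_upwards [hmom, hz] with t ⟨hm, h1, h2⟩ hzt
    exact ⟨(integral_drift (h.state t hm) h1 h2).1, hzt⟩
  · filter_upwards [hmom, hz] with t ⟨hm, h1, h2⟩ hzt
    refine ⟨h1, h2, ae_of_all _ fun x => ?_⟩
    rw [(integral_drift (h.state t hm) h1 h2).2, sub_eq_zero] at hzt
    have hpos := integral_rpow_pos hp.ρ_pos (h.state t hm) h1
    rw [meanField, ← hzt, mul_div_cancel_right₀ _ hpos.ne']

end LSW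

/-! ### Existence of the limit solution and proof of the corollary. -/

namespace LSW

open scoped NNReal BoundedContinuousFunction

variable {α γ q ρ T E : ℝ}

/-- Test functions are integrable for measures of finite energy. -/
theorem IsTestFun.integrable_of_energy_lt_top (hq : 0 < q) (hγ₁ : γ < 1) {m : Measure ℝ}
    (h0 : m (Iic 0) = 0) (hE : energy γ q m < ⊤) {ζ : ℝ → ℝ} (hζ : IsTestFun ζ) :
    Integrable ζ m := by
  have hpos := ae_pos_of_measure_Iic h0
  have hlt : ∫⁻ x, ENNReal.ofReal (x ^ (1 - γ)) ∂m < ⊤ := by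
    refine ENNReal.lt_top_of_mul_ne_top_right hE.ne ?_
    rw [Ne, ENNReal.ofReal_eq_zero, not_le]
    exact div_pos hq (by linarith)
  have hi : Integrable (fun x : ℝ => x ^ (1 - γ)) m := by
    refine ⟨by fun_prop, ?_⟩
    rwa [hasFiniteIntegral_iff_ofReal (hpos.mono fun x hx => Real.rpow_nonneg (le_of_lt hx) _)]
  obtain ⟨C, -, hC⟩ := hζ.exists_bound_rpow (1 - γ)
  exact (hi.const_mul C).mono' hζ.1.aestronglyMeasurable (hpos.mono fun x hx => hC x hx)

/-- Tight families of solutions have subsequences which converge to solutions. -/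
theorem IsTightFamily.exists_solution {ν : ℕ → ℝ → Measure ℝ} (hp : IsAdmissible α γ q ρ T)
    (hsol : ∀ n, IsSolution α γ q ρ T (ν n))
    (h : IsTightFamily α γ q ρ T E ν fun n t => meanField α γ q (ν n t)) :
    ∃ φ : ℕ → ℕ, StrictMono φ ∧ ∃ μ : ℝ → Measure ℝ, IsSolution α γ q ρ T μ ∧
      ∀ t ∈ Icc 0 T, WeakStarTendsto (fun n => ν (φ n) t) atTop (μ t) := by
  have hα₀ := hp.α_nonneg
  have hα₁ := hp.α_lt_one.le
  have hρ := hp.ρ_pos.le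
  obtain ⟨φ, hφ, K, μ, v, hlim⟩ := h.exists_convergesTo hp
  refine ⟨φ, hφ, μ, ?_, fun t ht => hlim.tendsto_testFun ht⟩
  choose w hw hwu using hsol
  have hd := hlim.hasFiniteDissipation (α := α) (γ := γ) (q := q) hρ h.energy_nonneg
    fun n => h.dissipation_le hp (φ n)
  have hc := hlim.continuityEq (q := q) (γ := γ) hρ hp.T_pos
    (fun n => (hw (φ n)).continuity_eq) fun n => (hwu (φ n)).mono fun t ht => ht.2.2
  have hflow := hd.isFlow hα₀ hα₁ hρ hp.T_pos hc (ae_of_all _ fun t => ae_of_all _ fun x => rfl)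
  refine hd.isSolution hp hlim.measurable hc (hflow.ae_integral_drift_eq_zero hp ?_)
  intro R hR s hs t ht hst
  exact le_of_tendsto_of_tendsto' (hlim.tendsto_integral_rootMoment hR hs)
    (hlim.tendsto_integral_rootMoment hR ht) fun n =>
      (h.flow (φ n)).integral_mono hα₀ hα₁ hρ hp.γ_pos hp.q_pos (isProfile_rootMoment hR)
        (root_density_monotoneOn hR) hs ht hst

end LSW

theorem corollary3p8 (α γ q ρ T : ℝ) (hα₀ : 0 ≤ α) (hα₁ : α < 1) (hγ₀ : 0 < γ) (hγ₁ : γ < 1)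
    (hq : 0 < q) (hρ : 0 < ρ) (hT : 0 < T)
    -- the initial data `ν_0^ε`, their limit `ν_0`, and solutions `ν^ε` starting from `ν_0^ε`
    (νinit : ℝ → Measure ℝ) (ν₀ : Measure ℝ) (ν : ℝ → ℝ → Measure ℝ)
    (hsol : ∀ ε > 0, LSW.IsSolution α γ q ρ T (ν ε))
    (hinit : ∀ ε > 0, ν ε 0 = νinit ε)
    (htight : LSW.IsTight νinit)
    (hν₀ : ν₀ (Iic 0) = 0)
    (hweak : LSW.WeakStarTendsto νinit (𝓝[>] 0) ν₀)
    (henergy : Tendsto (fun ε => LSW.energy γ q (νinit ε)) (𝓝[>] 0) (𝓝 (LSW.energy γ q ν₀)))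
    (hfinite : LSW.energy γ q ν₀ < ⊤) :
    -- every sequence `e n → 0+` has a subsequence along which the solutions converge
    ∀ e : ℕ → ℝ, Tendsto e atTop (𝓝[>] 0) →
      ∃ k : ℕ → ℕ, StrictMono k ∧ ∃ μ : ℝ → Measure ℝ,
        LSW.IsSolution α γ q ρ T μ ∧ μ 0 = ν₀ ∧
        ∀ t ∈ Icc 0 T, LSW.WeakStarTendsto (fun n => ν (e (k n)) t) atTop (μ t) := by
  intro e he
  have hp : LSW.IsAdmissible α γ q ρ T := ⟨hα₀, hα₁, hγ₀, hγ₁, hq, hρ, hT⟩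
  -- The added 1 gives strict room above the finite limiting energy, so the initial energies are at
  -- most E from some index on. Shifting by that index makes the bound hold for the whole sequence.
  set E : ℝ := (LSW.energy γ q ν₀ + 1).toReal with hE
  have hE1 : ENNReal.ofReal E = LSW.energy γ q ν₀ + 1 :=
    ENNReal.ofReal_toReal (ENNReal.add_ne_top.2 ⟨hfinite.ne, ENNReal.one_ne_top⟩)
  have hlt : LSW.energy γ q ν₀ < LSW.energy γ q ν₀ + 1 :=
    ENNReal.lt_add_right hfinite.ne one_ne_zero
  obtain ⟨N, hN⟩ := eventually_atTop.1 ((he.eventually self_mem_nhdsWithin).and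
    ((henergy.comp he).eventually_le_const hlt))
  have hpos : ∀ n, 0 < e (n + N) := fun n => (hN _ (Nat.le_add_left N n)).1
  have hfam : LSW.IsTightFamily α γ q ρ T E (fun n => ν (e (n + N)))
      fun n t => LSW.meanField α γ q (ν (e (n + N)) t) := by
    refine ⟨fun n => (hsol _ (hpos n)).isBalancedFlow hα₀ hα₁.le hq hρ hT, ENNReal.toReal_nonneg,
      fun n => ?_, fun δ hδ => ?_⟩
    · rw [hinit _ (hpos n), hE1]
      exact (hN _ (Nat.le_add_left N n)).2
    · obtain ⟨R, hR⟩ := htight δ hδ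
      refine ⟨max R 0, le_max_right _ _, fun n => ?_⟩
      rw [hinit _ (hpos n)]
      exact hR _ (le_max_left _ _) _ (hpos n)
  obtain ⟨φ, hφ, μ, hμ, hlim⟩ := hfam.exists_solution hp fun n => hsol _ (hpos n)
  refine ⟨fun n => φ n + N, fun m n hmn => Nat.add_lt_add_right (hφ hmn) N, μ, hμ, ?_, hlim⟩
  have h0 : (0 : ℝ) ∈ Icc 0 T := ⟨le_rfl, hT.le⟩
  obtain ⟨w, hw, -⟩ := hμ
  have hst := hw.state 0 h0
  -- The initial value of the limit and ν₀ are both weak* limits of the same initial data. As ν₀ is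
  -- not known to be a state, its finite energy is what makes test functions integrable.
  refine LSW.measure_eq_of_integral_eq hst.1 hν₀ (fun ζ hζ => hζ.integrable hst)
    (fun ζ hζ => hζ.integrable_of_energy_lt_top hq hγ₁ hν₀ hfinite) fun ζ hζ => ?_
  have hk : Tendsto (fun n => e (φ n + N)) atTop (𝓝[>] 0) :=
    he.comp ((tendsto_add_atTop_nat N).comp hφ.tendsto_atTop)
  refine tendsto_nhds_unique (hlim 0 h0 ζ hζ) (((hweak ζ hζ).comp hk).congr fun n => ?_)
  simp only [Function.comp_apply]
  rw [hinit _ (hpos (φ n))]
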